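/- **Setting.** Let $d\in\{1,2,3\}$, let $\Omega_0\subset\mathbb R^d$ be a bounded convex domain with polygonal boundary, and for $t\in[0,T]$, $T>0$, let $G(t)\subset\Omega_0$ be a bounded domain with polygonal boundary. Let $0=t_0<t_1<\dots<t_N=T$, $N\ge 1$, $I_n=(t_{n-1},t_n]$, $k_n=t_n-t_{n-1}$. Let $\mathcal T_0$ be a simplicial mesh of $\Omega_0$ and, for $n=1,\dots,N$, let $\mathcal T_{G,n}$ be a simplicial mesh of $G(t_n)$; all simplices $K$ are closed, with diameter $h_K$. Assume quasi-uniformity with a constant $\sigma$: in each of these meshes the largest diameter is at most $\sigma$ times the radius of some ball contained in any given simplex; $k_n\le\sigma k_m$ for all $n,m$; and $h_K\le\sigma k_n$, $k_n\le\sigma h_K$ for all $n$ and all simplices $K$ of all the meshes. On the slab $n$ put $\Omega_{1,n}=\Omega_0\setminus\overline{G(t_n)}$, $\Omega_{2,n}=\Omega_0\cap G(t_n)$, $\Gamma_n=\partial\Omega_{1,n}\cap\partial\Omega_{2,n}$, $\mathcal T_{0,\Gamma_n}=\{K\in\mathcal T_0: K\cap\Gamma_n\ne\emptyset\}$ and $\Omega_{O,n}=\bigcup_{K\in\mathcal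 T_{0,\Gamma_n}}K\cap\Omega_{2,n}$. Let $p,q\ge 0$ be integers. $V_{h,0}$ is the space of continuous piecewise polynomials of degree $\le p$ on $\mathcal T_0$ that vanish on $\partial\Omega_0$, and $V_{h,G,n}$ is the space of continuous piecewise polynomials of degree $\le p$ on $\mathcal T_{G,n}$. The space $V_h$ consists of the functions $v$ that on each slab $\Omega_0\times I_n$ are given by a pair $(v_0,v_G)$, $v=v_0$ on $\Omega_{1,n}$ and $v=v_G$ on $\Omega_{2,n}$, where $v_0$ and $v_G$ are polynomials in $t\in I_n$ of degree $\le q$ with coefficients in $V_{h,0}$ and $V_{h,G,n}$, respectively. A subscript $1$ or $2$ refers to $v_0$ or $v_G$: on $\Gamma_n$, with unit normal $n$ pointing from $\Omega_{1,n}$ to $\Omega_{2,n}$, it denotes the limit from the side of $\Omega_{1,n}$ or $\Omega_{2,n}$, and on $\Omega_{O,n}$ one puts $(\nabla v)_1=\nabla v_0$, $(\nabla v)_2=\nabla v_G$. Let $[v]=v_1-v_2$, $[\nabla v]=(\nabla v)_1-(\nabla v)_2$, and $\langle\partial_n v\rangle=\omega_1\, n\cdot(\nabla v)_1+\omega_2\,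 n\cdot(\nabla v)_2$ with $\omega_1,\omega_2\in[0,1]$, $\omega_1+\omega_2=1$. For $\gamma\ge 0$ let $$A_n(w,v)=\sum_{i=1}^2(\nabla w,\nabla v)_{\Omega_{i,n}}-(\langle\partial_n w\rangle,[v])_{\Gamma_n}-(\langle\partial_n v\rangle,[w])_{\Gamma_n}+(\gamma h_K^{-1}[w],[v])_{\Gamma_n}+([\nabla w],[\nabla v])_{\Omega_{O,n}},$$ where at a point $x$ the value $h_K=h_K(x)$ is the diameter of the simplex of $\mathcal T_0$ containing $x$ (the largest such diameter if there are several), and $$|||v|||_{A_n}^2=\sum_{i=1}^2\|\nabla v\|_{\Omega_{i,n}}^2+\sum_{K\in\mathcal T_{0,\Gamma_n}}\Big(h_K\|\langle\partial_n v\rangle\|_{K\cap\Gamma_n}^2+h_K^{-1}\|[v]\|_{K\cap\Gamma_n}^2\Big)+\|[\nabla v]\|_{\Omega_{O,n}}^2 .$$ With $v_n^\pm=\lim_{\varepsilon\to0+}v(\cdot,t_n\pm\varepsilon)$ and $[v]_n=v_n^+-v_n^-$ let $$B_h(w,v)=\sum_{n=1}^N\int_{I_n}\big((\dot w,v)_{\Omega_0}+A_n(w,v)\big)\,dt+\sum_{n=1}^{N-1}([w]_n,v_n^+)_{\Omega_0}+(w_0^+,v_0^+)_{\Omega_0}.$$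 **Lemma (basic stability estimate).** For all $d$, $p$, $\sigma$ there are constants $\gamma_0>0$ and $C>0$, depending only on $d$, $p$ and $\sigma$, such that the following holds in the above setting for every $\gamma\ge\gamma_0$. Let $u_0\in L^2(\Omega_0)$ (in particular, $u_0\in H^2(\Omega_0)\cap H^1_0(\Omega_0)$), and let $u_h\in V_h$ solve the finite element formulation of the heat equation with source $f\equiv0$ and initial value $u_0$, that is, $B_h(u_h,v)=(u_0,v_0^+)_{\Omega_0}$ for all $v\in V_h$. Then, with $[u_h]_0:=u_{h,0}^+-u_0$, $$\|u_{h,N}^-\|_{\Omega_0}^2+\sum_{n=1}^N\int_{I_n}|||u_h|||_{A_n}^2\,dt+\sum_{n=1}^N\|[u_h]_{n-1}\|_{\Omega_0}^2\le C\,\|u_0\|_{\Omega_0}^2 .$$ -/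

import Mathlib

open MeasureTheory Filter Topology

noncomputable section

namespace OverlappingCutFEM

/-- The Euclidean space `ℝ^d`. -/
abbrev E (d : ℕ) : Type := EuclideanSpace ℝ (Fin d)

/-! ### Domains, meshes, finite element functions -/

/-- The boundary of `Ω` is polygonal: it lies in a finite union of affine hyperplanes. -/
def HasPolygonalBoundary {d : ℕ} (Ω : Set (E d)) : Prop :=
  ∃ S : Set (AffineSubspace ℝ (E d)), S.Finite ∧
    (∀ H ∈ S, Module.finrank ℝ H.direction + 1 = d) ∧
    frontier Ω ⊆ ⋃ H ∈ S, (H : Set (E d))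

/-- A bounded domain (non-empty, open, connected) with polygonal boundary. -/
structure IsPolygonalDomain {d : ℕ} (Ω : Set (E d)) : Prop where
  isOpen : IsOpen Ω
  isConnected : IsConnected Ω
  isBounded : Bornology.IsBounded Ω
  polygonal : HasPolygonalBoundary Ω

/-- A finite geometric simplicial complex whose underlying space is the closure of `Ω`. -/
structure IsMeshOf {d : ℕ} (𝒯 : Geometry.SimplicialComplex ℝ (E d)) (Ω : Set (E d)) : Prop where
  finite : 𝒯.faces.Finite
  space_eq : 𝒯.space = closure Ω

/-- The (closed, `d`-dimensional) simplices `K` of a mesh. -/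
def cells {d : ℕ} (𝒯 : Geometry.SimplicialComplex ℝ (E d)) : Set (Set (E d)) :=
  {K | ∃ s ∈ 𝒯.faces, s.card = d + 1 ∧ K = convexHull ℝ (s : Set (E d))}

/-- Quasi-uniformity of a mesh with constant `σ`: the largest diameter of a cell is at most `σ`
times the radius of a ball inscribed in any cell. -/
def IsQuasiUniform {d : ℕ} (σ : ℝ) (𝒯 : Geometry.SimplicialComplex ℝ (E d)) : Prop :=
  ∀ K ∈ cells 𝒯, ∀ K' ∈ cells 𝒯, ∃ (c : E d) (r : ℝ),
    0 < r ∧ Metric.closedBall c r ⊆ K' ∧ Metric.diam K ≤ σ * r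

/-- `v` is (on the closure of `Ω`) a continuous piecewise polynomial of degree `≤ p` on the mesh
`𝒯` of `Ω`. The values of `v` outside the closure of `Ω` play no role. -/
def IsFEFunction {d : ℕ} (p : ℕ) (𝒯 : Geometry.SimplicialComplex ℝ (E d)) (Ω : Set (E d))
    (v : E d → ℝ) : Prop :=
  ContinuousOn v (closure Ω) ∧
    ∀ K ∈ cells 𝒯, ∃ P : MvPolynomial (Fin d) ℝ, P.totalDegree ≤ p ∧
      ∀ x ∈ K, v x = MvPolynomial.eval (fun i => x i) P

/-! ### The cut geometry at a fixed time

`Ω₀` is the background domain, `G` the overlapping domain. -/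

/-- `Ω₁ = Ω₀ \ (G ∪ ∂G)`. -/
def Omega1 {d : ℕ} (Ω₀ G : Set (E d)) : Set (E d) := Ω₀ \ (G ∪ frontier G)

/-- `Ω₂ = Ω₀ ∩ G`. -/
def Omega2 {d : ℕ} (Ω₀ G : Set (E d)) : Set (E d) := Ω₀ ∩ G

/-- `Γ = ∂Ω₁ ∩ ∂Ω₂`. -/
def Gam {d : ℕ} (Ω₀ G : Set (E d)) : Set (E d) :=
  frontier (Omega1 Ω₀ G) ∩ frontier (Omega2 Ω₀ G)

/-- The background cells that are cut by `Γ`. -/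
def cutCells {d : ℕ} (Ω₀ G : Set (E d)) (𝒯₀ : Geometry.SimplicialComplex ℝ (E d)) :
    Set (Set (E d)) :=
  {K ∈ cells 𝒯₀ | (K ∩ Gam Ω₀ G).Nonempty}

/-- The overlap region `Ω_O`: the part of the cut background cells that is covered by `Ω₂`. -/
def OmegaO {d : ℕ} (Ω₀ G : Set (E d)) (𝒯₀ : Geometry.SimplicialComplex ℝ (E d)) : Set (E d) :=
  ⋃ K ∈ cutCells Ω₀ G 𝒯₀, K ∩ Omega2 Ω₀ G

/-- `ν` is the unit normal at `s` to the interface between `Ω₁` and `Ω₂`, pointing from `Ω₁` to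
`Ω₂`: near `s`, the two sides of the hyperplane through `s` orthogonal to `ν` lie in `Ω₁` and in
`Ω₂`, respectively. -/
def IsUnitNormal {d : ℕ} (Ω₁ Ω₂ : Set (E d)) (s ν : E d) : Prop :=
  ‖ν‖ = 1 ∧ ∃ δ > 0, ∀ y ∈ Metric.ball s δ,
    (inner ℝ (y - s) ν < 0 → y ∈ Ω₁) ∧ (0 < inner ℝ (y - s) ν → y ∈ Ω₂)

open Classical in
/-- The unit normal field `n = n₁ = -n₂` on `Γ`; it is set to `0` at the (surface-measure null) set
of points of `Γ` without a normal, such as corners. -/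
def unitNormal {d : ℕ} (Ω₀ G : Set (E d)) (s : E d) : E d :=
  if h : ∃ ν, IsUnitNormal (Omega1 Ω₀ G) (Omega2 Ω₀ G) s ν then h.choose else 0

/-- The one-sided limit `lim_{ε → 0+} φ (s - ε m)`. -/
def sideLim {d : ℕ} {F : Type*} [TopologicalSpace F] [Nonempty F] (φ : E d → F) (m s : E d) : F :=
  limUnder (𝓝[>] (0 : ℝ)) fun ε : ℝ => φ (s - ε • m)

/-- The surface measure on `Γ` (the `(d-1)`-dimensional Hausdorff measure, normalized to agree
with Lebesgue measure on hyperplanes). -/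
def surface (d : ℕ) : Measure (E d) := Measure.euclideanHausdorffMeasure (d - 1)

/-- `h_K(x)`, the diameter of the background cell that contains `x`; where several
cells meet, the largest of their diameters. -/
def localSize {d : ℕ} (𝒯₀ : Geometry.SimplicialComplex ℝ (E d)) (x : E d) : ℝ :=
  sSup {r | ∃ K ∈ cells 𝒯₀, x ∈ K ∧ r = Metric.diam K}

/-! ### Broken functions, the form `A_{h,t}` and the energy norm -/

/-- A broken function `v`, given by the pair `(v₀, v_G)` of a function on the background domain and
a function on the overlapping domain: `v = v₀` on `Ω₁` and `v = v_G` on `Ω₂`. The pair also carries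
the extension of `v|_{Ω₁}` into `Ω_O`. -/
abbrev Broken (d : ℕ) : Type := (E d → ℝ) × (E d → ℝ)

open Classical in
/-- The broken function as a function on `Ω₀` (set to `0` off `Ω₁ ∪ Ω₂`). -/
def Broken.val {d : ℕ} (Ω₀ G : Set (E d)) (v : Broken d) (x : E d) : ℝ :=
  if x ∈ Omega1 Ω₀ G then v.1 x else if x ∈ Omega2 Ω₀ G then v.2 x else 0

/-- The jump `[v] = v₁ - v₂` over `Γ`, where `v_i(s) = lim_{ε → 0+} v(s - ε n_i)`. -/
def jumpGam {d : ℕ} (Ω₀ G : Set (E d)) (v : Broken d) (s : E d) : ℝ :=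
  sideLim v.1 (unitNormal Ω₀ G s) s - sideLim v.2 (-unitNormal Ω₀ G s) s

/-- The weighted average `⟨∂_n v⟩ = ω₁ (n · ∇v)₁ + ω₂ (n · ∇v)₂` on `Γ`. -/
def avgNormalDeriv {d : ℕ} (ω₁ ω₂ : ℝ) (Ω₀ G : Set (E d)) (v : Broken d) (s : E d) : ℝ :=
  ω₁ * inner ℝ (unitNormal Ω₀ G s) (sideLim (gradient v.1) (unitNormal Ω₀ G s) s) +
    ω₂ * inner ℝ (unitNormal Ω₀ G s) (sideLim (gradient v.2) (-unitNormal Ω₀ G s) s)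

/-- The jump `[∇v] = (∇v)₁ - (∇v)₂` on `Ω_O`. -/
def jumpGrad {d : ℕ} (v : Broken d) (x : E d) : E d := gradient v.1 x - gradient v.2 x

/-- The bilinear form `A_{h,t}`. -/
def formA {d : ℕ} (ω₁ ω₂ γ : ℝ) (Ω₀ G : Set (E d)) (𝒯₀ : Geometry.SimplicialComplex ℝ (E d))
    (w v : Broken d) : ℝ :=
  (∫ x in Omega1 Ω₀ G, inner ℝ (gradient w.1 x) (gradient v.1 x)) +
    (∫ x in Omega2 Ω₀ G, inner ℝ (gradient w.2 x) (gradient v.2 x)) -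
    (∫ s in Gam Ω₀ G, avgNormalDeriv ω₁ ω₂ Ω₀ G w s * jumpGam Ω₀ G v s ∂(surface d)) -
    (∫ s in Gam Ω₀ G, avgNormalDeriv ω₁ ω₂ Ω₀ G v s * jumpGam Ω₀ G w s ∂(surface d)) +
    (∫ s in Gam Ω₀ G,
      γ * (localSize 𝒯₀ s)⁻¹ * jumpGam Ω₀ G w s * jumpGam Ω₀ G v s ∂(surface d)) +
    (∫ x in OmegaO Ω₀ G 𝒯₀, inner ℝ (jumpGrad w x) (jumpGrad v x))

/-- `‖φ‖²_{1/2,h,Γ} = ∑_{K cut} h_K⁻¹ ‖φ‖²_{K ∩ Γ}`. -/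
def normSqHalf {d : ℕ} (Ω₀ G : Set (E d)) (𝒯₀ : Geometry.SimplicialComplex ℝ (E d))
    (φ : E d → ℝ) : ℝ :=
  ∑ᶠ K ∈ cutCells Ω₀ G 𝒯₀, (Metric.diam K)⁻¹ * ∫ s in K ∩ Gam Ω₀ G, φ s ^ 2 ∂(surface d)

/-- `‖φ‖²_{-1/2,h,Γ} = ∑_{K cut} h_K ‖φ‖²_{K ∩ Γ}`. -/
def normSqNegHalf {d : ℕ} (Ω₀ G : Set (E d)) (𝒯₀ : Geometry.SimplicialComplex ℝ (E d))
    (φ : E d → ℝ) : ℝ :=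
  ∑ᶠ K ∈ cutCells Ω₀ G 𝒯₀, Metric.diam K * ∫ s in K ∩ Gam Ω₀ G, φ s ^ 2 ∂(surface d)

/-- The squared energy norm `|||v|||²_{A_{h,t}}`. -/
def energySq {d : ℕ} (ω₁ ω₂ : ℝ) (Ω₀ G : Set (E d)) (𝒯₀ : Geometry.SimplicialComplex ℝ (E d))
    (v : Broken d) : ℝ :=
  (∫ x in Omega1 Ω₀ G, ‖gradient v.1 x‖ ^ 2) + (∫ x in Omega2 Ω₀ G, ‖gradient v.2 x‖ ^ 2) +
    normSqNegHalf Ω₀ G 𝒯₀ (avgNormalDeriv ω₁ ω₂ Ω₀ G v) +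
    normSqHalf Ω₀ G 𝒯₀ (jumpGam Ω₀ G v) +
    ∫ x in OmegaO Ω₀ G 𝒯₀, ‖jumpGrad v x‖ ^ 2

/-! ### The space-time discretization -/

/-- The geometry, the time partition and the meshes: a bounded convex polygonal domain `Ω₀`, an
evolving polygonal domain `G(t) ⊆ Ω₀`, a partition `0 = t₀ < ⋯ < t_N = T`, a mesh `𝒯₀` of `Ω₀` and,
for `n = 1, …, N`, the mesh `𝒯_G` on `I_n = (t_{n-1}, t_n]`, which is a mesh of `G(t_n)`. -/
structure Discretization (d : ℕ) where
  Ω₀ : Set (E d)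
  G : ℝ → Set (E d)
  N : ℕ
  t : ℕ → ℝ
  𝒯₀ : Geometry.SimplicialComplex ℝ (E d)
  𝒯G : ℕ → Geometry.SimplicialComplex ℝ (E d)
  domain_Ω₀ : IsPolygonalDomain Ω₀
  convex_Ω₀ : Convex ℝ Ω₀
  N_pos : 0 < N
  t_zero : t 0 = 0
  t_lt : ∀ n < N, t n < t (n + 1)
  domain_G : ∀ τ ∈ Set.Icc 0 (t N), IsPolygonalDomain (G τ)
  G_subset : ∀ τ ∈ Set.Icc 0 (t N), G τ ⊆ Ω₀
  mesh₀ : IsMeshOf 𝒯₀ Ω₀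
  meshG : ∀ n ∈ Set.Icc 1 N, IsMeshOf (𝒯G n) (G (t n))

namespace Discretization

variable {d : ℕ} (D : Discretization d)

/-- The final time `T`. -/
def T : ℝ := D.t D.N

/-- The time interval `I_n = (t_{n-1}, t_n]`, for `n = 1, …, N`. -/
def I (n : ℕ) : Set ℝ := Set.Ioc (D.t (n - 1)) (D.t n)

/-- The length `k_n` of `I_n`. -/
def k (n : ℕ) : ℝ := D.t n - D.t (n - 1)

/-- All cells of the background mesh and of the overlapping meshes. -/
def allCells : Set (Set (E d)) :=
  cells D.𝒯₀ ∪ ⋃ n ∈ Set.Icc 1 D.N, cells (D.𝒯G n)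

/-- Quasi-uniformity with constant `σ` of the meshes, of the time partition, and of both jointly
(`h ≤ σ k_min` and `k ≤ σ h_min`). -/
structure QuasiUniform (σ : ℝ) : Prop where
  mesh₀ : IsQuasiUniform σ D.𝒯₀
  meshG : ∀ n ∈ Set.Icc 1 D.N, IsQuasiUniform σ (D.𝒯G n)
  time : ∀ n ∈ Set.Icc 1 D.N, ∀ m ∈ Set.Icc 1 D.N, D.k n ≤ σ * D.k m
  space_le_time : ∀ K ∈ D.allCells, ∀ n ∈ Set.Icc 1 D.N, Metric.diam K ≤ σ * D.k n
  time_le_space : ∀ K ∈ D.allCells, ∀ n ∈ Set.Icc 1 D.N, D.k n ≤ σ * Metric.diam K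

/-- The discrete overlapping domain at time `τ`: it is constant, equal to `G(t_n)`, on `I_n`. -/
def Gh (τ : ℝ) : Set (E d) := {x | ∃ n ∈ Set.Icc 1 D.N, τ ∈ D.I n ∧ x ∈ D.G (D.t n)}

/-- `V_{h,0}`. -/
def IsVh0 (p : ℕ) (v : E d → ℝ) : Prop :=
  IsFEFunction p D.𝒯₀ D.Ω₀ v ∧ ∀ x ∈ frontier D.Ω₀, v x = 0

/-- `V_{h,G}` on the slab with index `n`. -/
def IsVhG (p n : ℕ) (v : E d → ℝ) : Prop := IsFEFunction p (D.𝒯G n) (D.G (D.t n)) v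

/-- The space-time space `V_h`: on every slab, `v₀` and `v_G` are polynomials in time of degree
`≤ q` with coefficients in `V_{h,0}` and `V_{h,G}`, respectively. -/
def IsVh (p q : ℕ) (v : ℝ → Broken d) : Prop :=
  ∀ n ∈ Set.Icc 1 D.N,
    (∃ c : Fin (q + 1) → E d → ℝ, (∀ j, D.IsVh0 p (c j)) ∧
      ∀ τ ∈ D.I n, ∀ x ∈ closure D.Ω₀, (v τ).1 x = ∑ j : Fin (q + 1), τ ^ (j : ℕ) * c j x) ∧
    (∃ c : Fin (q + 1) → E d → ℝ, (∀ j, D.IsVhG p n (c j)) ∧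
      ∀ τ ∈ D.I n, ∀ x ∈ closure (D.G (D.t n)), (v τ).2 x = ∑ j : Fin (q + 1), τ ^ (j : ℕ) * c j x)

/-- The value `v(x, τ)`. -/
def val (v : ℝ → Broken d) (τ : ℝ) (x : E d) : ℝ := (v τ).val D.Ω₀ (D.Gh τ) x

/-- `v_n^+ = lim_{ε → 0+} v(·, t_n + ε)`. -/
def plus (v : ℝ → Broken d) (n : ℕ) (x : E d) : ℝ :=
  limUnder (𝓝[>] (0 : ℝ)) fun ε => D.val v (D.t n + ε) x

/-- `v_n^- = lim_{ε → 0+} v(·, t_n - ε)`. -/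
def minus (v : ℝ → Broken d) (n : ℕ) (x : E d) : ℝ :=
  limUnder (𝓝[>] (0 : ℝ)) fun ε => D.val v (D.t n - ε) x

/-- The time jump `[v]_n = v_n^+ - v_n^-`. -/
def jump (v : ℝ → Broken d) (n : ℕ) (x : E d) : ℝ := D.plus v n x - D.minus v n x

/-- The time jump `[v]_n` of a function with initial value `u₀`, that is, with `v_0^- = u₀`. -/
def jumpFrom (u₀ : E d → ℝ) (v : ℝ → Broken d) (n : ℕ) (x : E d) : ℝ :=
  if n = 0 then D.plus v 0 x - u₀ x else D.jump v n x

/-- The inner product of `L²(Ω₀)`. -/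
def ip (φ ψ : E d → ℝ) : ℝ := ∫ x in D.Ω₀, φ x * ψ x

/-- The squared norm of `L²(Ω₀)`. -/
def normSq (φ : E d → ℝ) : ℝ := ∫ x in D.Ω₀, φ x ^ 2

/-- The form `A_{h,τ}`. -/
def A (ω₁ ω₂ γ τ : ℝ) (w v : Broken d) : ℝ := formA ω₁ ω₂ γ D.Ω₀ (D.Gh τ) D.𝒯₀ w v

/-- The bilinear form `B_h`. -/
def B (ω₁ ω₂ γ : ℝ) (w v : ℝ → Broken d) : ℝ :=
  (∑ n ∈ Finset.Icc 1 D.N, ∫ τ in D.I n,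
      (D.ip (fun x => deriv (fun r => D.val w r x) τ) (D.val v τ) +
        D.A ω₁ ω₂ γ τ (w τ) (v τ))) +
    (∑ n ∈ Finset.Icc 1 (D.N - 1), D.ip (D.jump w n) (D.plus v n)) +
    D.ip (D.plus w 0) (D.plus v 0)

/-- `u` solves the finite element formulation with source `f` and initial value `u₀`. -/
def IsSolution (p q : ℕ) (ω₁ ω₂ γ : ℝ) (f : ℝ → E d → ℝ) (u₀ : E d → ℝ)
    (u : ℝ → Broken d) : Prop :=
  D.IsVh p q u ∧ ∀ v : ℝ → Broken d, D.IsVh p q v →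
    D.B ω₁ ω₂ γ u v = (∫ τ in Set.Ioc 0 D.T, D.ip (f τ) (D.val v τ)) + D.ip u₀ (D.plus v 0)

end Discretization

end OverlappingCutFEM

end

open MeasureTheory Filter Topology

noncomputable section

namespace OverlappingCutFEM

section

/-! ### Polynomials on Euclidean space -/

/-! Testing the discrete equation with `v = u_h` gives an exact energy balance. On a slab the domain
`G(t_n)` is frozen and `u_h` is a polynomial in time with values in `L²(Ω₀)`, so the time derivative
term integrates to half the difference of the squared norms at the two ends. By polarisation each
jump term is `½(‖u_n^+‖² - ‖u_n^-‖² + ‖[u]_n‖²)`; the sum telescopes, and the data term is polarised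
in the same way. This gives `IsSolution.energy_identity`: `‖u_N^-‖² + ∑ ‖[u]_{n-1}‖² + 2 ∑ ∫ A_n(u,
u) = ‖u₀‖²`.

What remains is coercivity at a fixed time, `|||v|||² ≤ C A_n(v, v)`, which is `exists_coercivity`.
Its constants see only `d`, `p` and the mesh regularity; the degree `q` in time plays no role
because time is fixed. The only terms of `A_n(v, v)` without a sign are the two consistency terms on
`Γ`. They are absorbed by Young's inequality and a large penalty, once `h ‖⟨∂_n v⟩‖²_Γ` is bounded
by the volume terms (`integral_avgNormalDeriv_sq_le`).

That trace inequality has three ingredients. A polynomial gradient at a point of a cell is bounded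
by its `L²` norm on an inscribed ball, by finite dimensionality and scaling
(`exists_sup_grad_le_L2_ball`). The part of `Γ` in a ball of radius of order `h` has surface measure
of order `h ^ (d - 1)`, because `Γ` runs along boundaries of overlapping cells and only boundedly
many of these are nearby (`IsCutSetting.surface_le`). Finally, however small the part of a
background cell lying in `Ω₁`, the gradient of `v₀` on the whole cell is controlled, because on
`Ω_O` it differs from the gradient of `v_G` by the stabilised jump (`sum_integral_cut₀_le`).

The remaining work makes the integrals meaningful. `gradient` is `0` where a function is not
differentiable, so limits of gradients towards `Γ` must be shown to exist
(`IsPiecewise.exists_tendsto_gradient`), and the resulting traces must be measurable in space and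
time. -/

/-- The value of a polynomial at a point of `ℝ^d`. -/
abbrev pev {d : ℕ} (P : MvPolynomial (Fin d) ℝ) (x : E d) : ℝ :=
  MvPolynomial.eval (fun i => x i) P

/-- The gradient of a polynomial. -/
def polyGrad {d : ℕ} (P : MvPolynomial (Fin d) ℝ) (x : E d) : E d :=
  WithLp.toLp 2 fun i => pev (MvPolynomial.pderiv i P) x

variable {d : ℕ}

@[simp]
lemma polyGrad_apply (P : MvPolynomial (Fin d) ℝ) (x : E d) (i : Fin d) :
    polyGrad P x i = pev (MvPolynomial.pderiv i P) x := rfl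

lemma continuous_pev (P : MvPolynomial (Fin d) ℝ) : Continuous (pev P) :=
  (MvPolynomial.continuous_eval P).comp (by fun_prop)

lemma continuous_polyGrad (P : MvPolynomial (Fin d) ℝ) : Continuous (polyGrad P) :=
  (PiLp.continuous_toLp 2 _).comp (continuous_pi fun _ => continuous_pev _)

lemma totalDegree_pderiv_le (P : MvPolynomial (Fin d) ℝ) (i : Fin d) :
    (MvPolynomial.pderiv i P).totalDegree ≤ P.totalDegree := by
  refine Finset.sup_le fun m hm => ?_
  rw [MvPolynomial.mem_support_iff, MvPolynomial.coeff_pderiv] at hm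
  have h : m + Finsupp.single i 1 ∈ P.support := by
    rw [MvPolynomial.mem_support_iff]
    intro h0
    simp [h0] at hm
  refine le_trans ?_ (MvPolynomial.le_totalDegree h)
  rw [Finsupp.sum_add_index' (by simp) (by simp)]
  exact Nat.le_add_right _ _

lemma hasGradientAt_pev (P : MvPolynomial (Fin d) ℝ) (x : E d) :
    HasGradientAt (pev P) (polyGrad P x) x := by
  classical
  rw [hasGradientAt_iff_hasFDerivAt]
  induction P using MvPolynomial.induction_on with
  | C a =>
    have : polyGrad (MvPolynomial.C a) x = 0 := by ext i; simp
    have h : pev (MvPolynomial.C a) = fun _ : E d => a := by ext; simp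
    rw [this, h, map_zero]
    exact hasFDerivAt_const a x
  | add p q hp hq =>
    have : polyGrad (p + q) x = polyGrad p x + polyGrad q x := by ext i; simp
    have h : pev (p + q) = pev p + pev q := by ext y; simp
    rw [this, h, map_add]
    exact hp.add hq
  | mul_X p i hp =>
    have : polyGrad (p * MvPolynomial.X i) x =
        pev p x • EuclideanSpace.single i 1 + x i • polyGrad p x := by
      ext j
      simp only [polyGrad_apply, Derivation.leibniz, map_add, smul_eq_mul, map_mul,
        MvPolynomial.eval_X, PiLp.add_apply, PiLp.smul_apply, MvPolynomial.pderiv_X]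
      by_cases h : i = j
      · subst h; simp
      · simp [h, Ne.symm h]
    rw [this]
    have h2 : HasFDerivAt (fun y : E d => y i)
        (InnerProductSpace.toDual ℝ (E d) (EuclideanSpace.single i 1)) x := by
      have h3 : InnerProductSpace.toDual ℝ (E d) (EuclideanSpace.single i 1) =
          (EuclideanSpace.proj i : E d →L[ℝ] ℝ) := by
        refine ContinuousLinearMap.ext fun y => ?_
        rw [InnerProductSpace.toDual_apply_apply, EuclideanSpace.inner_single_left]
        simp
      rw [h3]
      exact (EuclideanSpace.proj i : E d →L[ℝ] ℝ).hasFDerivAt (x := x)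
    have h : pev (p * MvPolynomial.X i) = pev p * fun y : E d => y i := by ext y; simp
    rw [h, map_add, map_smul, map_smul]
    exact hp.mul h2

/-- Along a line a polynomial is analytic in the parameter. Applied to partial derivatives, this
yields the dichotomy that two gradient pieces agree near the start of a ray or differ at all small
nonzero parameters. -/
lemma analyticAt_pev_line (P : MvPolynomial (Fin d) ℝ) (s m : E d) (ε : ℝ) :
    AnalyticAt ℝ (fun ε : ℝ => pev P (s - ε • m)) ε := by
  have h := AnalyticAt.aeval_mvPolynomial (𝕜 := ℝ) (A := ℝ) (B := ℝ) (z := ε)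
    (f := fun ε : ℝ => fun i => s i - ε * m i) (fun i => by fun_prop) P
  exact h

/-- Substitution of an affine change of variables keeps the total degree. -/
lemma exists_pev_comp_affine {p : ℕ} (P : MvPolynomial (Fin d) ℝ) (hP : P.totalDegree ≤ p)
    (c : E d) (r : ℝ) :
    ∃ Q : MvPolynomial (Fin d) ℝ, Q.totalDegree ≤ p ∧ ∀ y, pev Q y = pev P (c + r • y) := by
  classical
  refine ⟨MvPolynomial.bind₁ (fun i => MvPolynomial.C (c i) + MvPolynomial.C r * MvPolynomial.X i) P,
    ?_, fun y => ?_⟩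
  · conv_lhs => rw [P.as_sum, map_sum]
    refine MvPolynomial.totalDegree_finsetSum_le fun m hm => ?_
    rw [MvPolynomial.bind₁_monomial]
    refine (MvPolynomial.totalDegree_mul _ _).trans ?_
    rw [MvPolynomial.totalDegree_C, zero_add]
    refine (MvPolynomial.totalDegree_finsetProd _ _).trans ?_
    refine le_trans ?_ ((MvPolynomial.le_totalDegree hm).trans hP)
    refine Finset.sum_le_sum fun i _ => (MvPolynomial.totalDegree_pow _ _).trans ?_
    have h1 : (MvPolynomial.C (c i) + MvPolynomial.C r * MvPolynomial.X i :
        MvPolynomial (Fin d) ℝ).totalDegree ≤ 1 := by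
      refine (MvPolynomial.totalDegree_add _ _).trans (max_le (by simp) ?_)
      refine (MvPolynomial.totalDegree_mul _ _).trans (by simp)
    calc m i * _ ≤ m i * 1 := Nat.mul_le_mul_left _ h1
      _ = m i := mul_one _
  · rw [pev, MvPolynomial.eval, MvPolynomial.eval₂Hom_bind₁, ← MvPolynomial.eval]
    simp
    rfl

/-- The ball contains a cube, and a polynomial vanishing on a product of infinite sets is zero.
Hence the `L²` norm on the ball is definite on polynomials. -/
lemma pev_eq_zero_of_ball {P : MvPolynomial (Fin d) ℝ}
    (h : ∀ x ∈ Metric.ball (0 : E d) 1, pev P x = 0) : P = 0 := by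
  obtain ⟨δ, hδ, hsub⟩ : ∃ δ > 0, ∀ z : Fin d → ℝ, (∀ i, z i ∈ Set.Ioo (-δ) δ) →
      (WithLp.toLp 2 z : E d) ∈ Metric.ball (0 : E d) 1 := by
    have hc : Continuous fun z : Fin d → ℝ => (WithLp.toLp 2 z : E d) := PiLp.continuous_toLp 2 _
    have h0 : (fun z : Fin d → ℝ => (WithLp.toLp 2 z : E d)) ⁻¹' Metric.ball 0 1 ∈ 𝓝 0 :=
      hc.continuousAt.preimage_mem_nhds (by simpa using Metric.ball_mem_nhds (0 : E d) one_pos)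
    obtain ⟨δ, hδ, hb⟩ := Metric.mem_nhds_iff.1 h0
    refine ⟨δ, hδ, fun z hz => hb ?_⟩
    rw [mem_ball_zero_iff, pi_norm_lt_iff hδ]
    exact fun i => abs_lt.2 (hz i)
  refine MvPolynomial.funext_set (fun _ => Set.Ioo (-δ) δ)
    (fun _ => Set.Ioo_infinite (by linarith)) fun z hz => ?_
  rw [map_zero]
  exact h _ (hsub z fun i => hz i trivial)

/-- Norm equivalence on the unit ball for polynomials of bounded degree. -/
lemma exists_sup_le_L2_unit (d p : ℕ) (κ : ℝ) :
    ∃ C : ℝ, 0 < C ∧ ∀ P : MvPolynomial (Fin d) ℝ, P.totalDegree ≤ p →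
      ∀ y ∈ Metric.closedBall (0 : E d) κ,
        pev P y ^ 2 ≤ C * ∫ x in Metric.ball (0 : E d) 1, pev P x ^ 2 := by
  set μ : Measure (E d) := volume.restrict (Metric.ball (0 : E d) 1) with hμ
  set V := MvPolynomial.restrictTotalDegree (Fin d) ℝ p
  have : IsFiniteMeasure μ := ⟨by rw [hμ, Measure.restrict_apply_univ]; exact measure_ball_lt_top⟩
  have hmem : ∀ P : MvPolynomial (Fin d) ℝ, MemLp (pev P) 2 μ := by
    intro P
    obtain ⟨M, hM⟩ := (isCompact_closedBall (0 : E d) 1).exists_bound_of_continuousOn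
      (continuous_pev P).continuousOn
    refine MemLp.of_bound (continuous_pev P).aestronglyMeasurable M ?_
    refine (ae_restrict_iff' Metric.isOpen_ball.measurableSet).2 (ae_of_all _ fun x hx => ?_)
    exact hM x (Metric.ball_subset_closedBall hx)
  let T : V →ₗ[ℝ] Lp ℝ 2 μ :=
    { toFun := fun P => (hmem P.1).toLp _
      map_add' := fun P Q => by
        rw [← MemLp.toLp_add]
        congr 1
        ext x; simp [pev]
      map_smul' := fun a P => by
        rw [RingHom.id_apply, ← MemLp.toLp_const_smul]
        congr 1
        ext x; simp [pev, MvPolynomial.smul_eval] }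
  have hnorm : ∀ P : V, ‖T P‖ ^ 2 = ∫ x in Metric.ball (0 : E d) 1, pev P.1 x ^ 2 := by
    intro P
    rw [← real_inner_self_eq_norm_sq, L2.inner_def]
    refine integral_congr_ae ?_
    filter_upwards [(hmem P.1).coeFn_toLp] with x hx
    change inner ℝ (((hmem P.1).toLp _ : Lp ℝ 2 μ) x) (((hmem P.1).toLp _ : Lp ℝ 2 μ) x) = _
    rw [hx]
    simp [sq]
  have hinj : Function.Injective T := by
    rw [← LinearMap.ker_eq_bot, LinearMap.ker_eq_bot']
    intro P hP
    have h0 : pev P.1 =ᵐ[μ] 0 := by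
      have := (hmem P.1).coeFn_toLp
      have h2 : ((hmem P.1).toLp _ : Lp ℝ 2 μ) = 0 := hP
      rw [h2] at this
      exact this.symm.trans (Lp.coeFn_zero ℝ 2 μ)
    have h1 : Set.EqOn (pev P.1) 0 (Metric.ball (0 : E d) 1) :=
      Measure.eqOn_open_of_ae_eq h0 Metric.isOpen_ball (continuous_pev _).continuousOn
        continuousOn_const
    exact Subtype.ext (pev_eq_zero_of_ball h1)
  -- Restriction to the ball of radius `κ` factors through the image in `L²`. A linear map out of
  -- this finite-dimensional space is bounded, and its norm supplies the constant.
  have : FiniteDimensional ℝ (LinearMap.range T) := inferInstance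
  let S : V →ₗ[ℝ] C(Metric.closedBall (0 : E d) κ, ℝ) :=
    { toFun := fun P => ⟨fun x => pev P.1 x.1, (continuous_pev _).comp continuous_subtype_val⟩
      map_add' := fun P Q => by ext x; simp [pev]
      map_smul' := fun a P => by ext x; simp [pev, MvPolynomial.smul_eval] }
  let L : LinearMap.range T →L[ℝ] C(Metric.closedBall (0 : E d) κ, ℝ) :=
    LinearMap.toContinuousLinearMap (S ∘ₗ (LinearEquiv.ofInjective T hinj).symm.toLinearMap)
  refine ⟨‖L‖ ^ 2 + 1, by positivity, fun P hP y hy => ?_⟩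
  let P' : V := ⟨P, (MvPolynomial.mem_restrictTotalDegree _ _ _).2 hP⟩
  have h1 : L (LinearEquiv.ofInjective T hinj P') = S P' := by
    simp [L]
  have h2 : |pev P y| ≤ ‖L‖ * ‖T P'‖ := by
    calc |pev P y| = ‖(S P') ⟨y, hy⟩‖ := rfl
      _ ≤ ‖S P'‖ := ContinuousMap.norm_coe_le_norm _ _
      _ ≤ ‖L‖ * ‖LinearEquiv.ofInjective T hinj P'‖ := by rw [← h1]; exact L.le_opNorm _
      _ = ‖L‖ * ‖T P'‖ := rfl
  have h3 : pev P y ^ 2 ≤ ‖L‖ ^ 2 * ‖T P'‖ ^ 2 := by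
    rw [← sq_abs, ← mul_pow]
    exact pow_le_pow_left₀ (abs_nonneg _) h2 2
  rw [← hnorm P']
  nlinarith [sq_nonneg ‖T P'‖]

/-- Inverse estimate on balls for polynomials of bounded degree. -/
lemma exists_sup_le_L2_ball (d p : ℕ) (κ : ℝ) :
    ∃ C : ℝ, 0 < C ∧ ∀ P : MvPolynomial (Fin d) ℝ, P.totalDegree ≤ p →
      ∀ (c : E d) (r : ℝ), 0 < r → ∀ x ∈ Metric.closedBall c (κ * r),
        pev P x ^ 2 ≤ C / r ^ d * ∫ x in Metric.ball c r, pev P x ^ 2 := by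
  obtain ⟨C, hC, h⟩ := exists_sup_le_L2_unit d p κ
  refine ⟨C, hC, fun P hP c r hr x hx => ?_⟩
  obtain ⟨Q, hQ, hQP⟩ := exists_pev_comp_affine P hP c r
  -- The unit-ball estimate is applied to the pullback under `y ↦ c + r y`; the factor `r ^ d` in
  -- the result is the Jacobian.
  have h1 := h Q hQ (r⁻¹ • (x - c)) (by
    rw [mem_closedBall_zero_iff, norm_smul, norm_inv, Real.norm_of_nonneg hr.le, inv_mul_le_iff₀ hr,
      mul_comm]
    rwa [mem_closedBall_iff_norm] at hx)
  rw [hQP, smul_smul, mul_inv_cancel₀ hr.ne', one_smul, add_sub_cancel] at h1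
  refine h1.trans (le_of_eq ?_)
  have h2 : ∫ x in Metric.ball (0 : E d) 1, pev Q x ^ 2 =
      (r ^ d)⁻¹ * ∫ x in Metric.ball c r, pev P x ^ 2 := by
    simp_rw [hQP]
    rw [← integral_indicator measurableSet_ball, ← integral_indicator measurableSet_ball]
    have h3 : ∀ y : E d, (Metric.ball (0 : E d) 1).indicator (fun x => pev P (c + r • x) ^ 2) y =
        (fun z => (Metric.ball c r).indicator (fun x => pev P x ^ 2) (c + z)) (r • y) := by
      intro y
      have : y ∈ Metric.ball (0 : E d) 1 ↔ c + r • y ∈ Metric.ball c r := by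
        rw [mem_ball_zero_iff, mem_ball_iff_norm, add_sub_cancel_left, norm_smul,
          Real.norm_of_nonneg hr.le]
        constructor
        · intro h; nlinarith
        · intro h; nlinarith
      by_cases hy : y ∈ Metric.ball (0 : E d) 1
      · simp only [Set.indicator_of_mem hy, Set.indicator_of_mem (this.1 hy)]
      · simp only [Set.indicator_of_notMem hy, Set.indicator_of_notMem (fun h => hy (this.2 h))]
    simp_rw [h3]
    rw [Measure.integral_comp_smul volume (fun z => (Metric.ball c r).indicator (fun x => pev P x ^ 2) (c + z)) r,
      integral_add_left_eq_self (fun z => (Metric.ball c r).indicator (fun x => pev P x ^ 2) z)]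
    rw [finrank_euclideanSpace_fin, abs_of_pos (by positivity), smul_eq_mul]
  rw [h2, div_eq_mul_inv, mul_assoc]

/-- Inverse estimate on balls for gradients of polynomials of bounded degree. -/
lemma exists_sup_grad_le_L2_ball (d p : ℕ) (κ : ℝ) :
    ∃ C : ℝ, 0 < C ∧ ∀ P : MvPolynomial (Fin d) ℝ, P.totalDegree ≤ p →
      ∀ (c : E d) (r : ℝ), 0 < r → ∀ x ∈ Metric.closedBall c (κ * r),
        ‖polyGrad P x‖ ^ 2 ≤ C / r ^ d * ∫ x in Metric.ball c r, ‖polyGrad P x‖ ^ 2 := by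
  obtain ⟨C, hC, h⟩ := exists_sup_le_L2_ball d p κ
  refine ⟨C, hC, fun P hP c r hr x hx => ?_⟩
  simp_rw [EuclideanSpace.norm_sq_eq, polyGrad_apply, Real.norm_eq_abs, sq_abs]
  rw [integral_finsetSum, Finset.mul_sum]
  · exact Finset.sum_le_sum fun i _ => h _ ((totalDegree_pderiv_le P i).trans hP) c r hr x hx
  · intro i _
    exact (((continuous_pev _).pow 2).continuousOn.integrableOn_compact
      (isCompact_closedBall c r)).mono_set Metric.ball_subset_closedBall

end

section

/-! ### Simplices and meshes -/

variable {d : ℕ} {𝒯 : Geometry.SimplicialComplex ℝ (E d)} {Ω : Set (E d)}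

lemma isCompact_of_mem_cells {K : Set (E d)} (hK : K ∈ cells 𝒯) : IsCompact K := by
  obtain ⟨s, -, -, rfl⟩ := hK
  exact s.finite_toSet.isCompact_convexHull ℝ

lemma convex_of_mem_cells {K : Set (E d)} (hK : K ∈ cells 𝒯) : Convex ℝ K := by
  obtain ⟨s, -, -, rfl⟩ := hK
  exact convex_convexHull ℝ _

lemma isClosed_of_mem_cells {K : Set (E d)} (hK : K ∈ cells 𝒯) : IsClosed K :=
  (isCompact_of_mem_cells hK).isClosed

lemma affineSpan_eq_top_of_face {s : Finset (E d)} (hs : s ∈ 𝒯.faces) (hc : s.card = d + 1) :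
    affineSpan ℝ (s : Set (E d)) = ⊤ := by
  have h := (𝒯.indep hs).affineSpan_eq_top_iff_card_eq_finrank_add_one
  rw [Subtype.range_coe_subtype] at h
  simpa [hc] using h

lemma affineSpan_ne_top_of_card_le {s : Finset (E d)} (hc : s.card ≤ d) :
    affineSpan ℝ (s : Set (E d)) ≠ ⊤ := by
  intro h
  rcases s.eq_empty_or_nonempty with rfl | hne
  · simp at h
  · have h1 := finrank_vectorSpan_range_le ℝ (fun x : s => (x : E d)) (n := s.card - 1)
      (by have := hne.card_pos; simp; omega)
    rw [Subtype.range_coe_subtype] at h1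
    have h2 : vectorSpan ℝ {x | x ∈ s} = ⊤ := by
      have := congrArg AffineSubspace.direction h
      rwa [direction_affineSpan, AffineSubspace.direction_top] at this
    rw [h2, finrank_top, finrank_euclideanSpace_fin] at h1
    have := hne.card_pos
    omega

lemma interior_nonempty_of_mem_cells {K : Set (E d)} (hK : K ∈ cells 𝒯) :
    (interior K).Nonempty := by
  obtain ⟨s, hs, hc, rfl⟩ := hK
  exact interior_convexHull_nonempty_iff_affineSpan_eq_top.2 (affineSpan_eq_top_of_face hs hc)

/-- Two cells of a complex meet inside the hull of their common vertices. Distinct cells share at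
most `d` of these, so that hull has empty interior. -/
lemma disjoint_interior_of_mem_cells {K K' : Set (E d)} (hK : K ∈ cells 𝒯) (hK' : K' ∈ cells 𝒯)
    (hne : K ≠ K') : Disjoint (interior K) (interior K') := by
  classical
  obtain ⟨s, hs, hc, rfl⟩ := hK
  obtain ⟨t, ht, hc', rfl⟩ := hK'
  have hst : s ≠ t := fun h => hne (by rw [h])
  have hcard : (s ∩ t).card ≤ d := by
    by_contra! hlt
    have h1 : s ∩ t = s := Finset.eq_of_subset_of_card_le Finset.inter_subset_left (by omega)
    have h2 : s ∩ t = t := Finset.eq_of_subset_of_card_le Finset.inter_subset_right (by omega)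
    exact hst (h1.symm.trans h2)
  rw [Set.disjoint_iff_inter_eq_empty, ← interior_inter]
  by_contra hne'
  have hne'' := Set.nonempty_iff_ne_empty.2 hne'
  have h3 : (interior (convexHull ℝ ((s ∩ t : Finset (E d)) : Set (E d)))).Nonempty := by
    refine hne''.mono (interior_mono ?_)
    rw [Finset.coe_inter]
    exact 𝒯.inter_subset_convexHull hs ht
  exact affineSpan_ne_top_of_card_le hcard (interior_convexHull_nonempty_iff_affineSpan_eq_top.1 h3)

lemma IsMeshOf.finite_cells (hm : IsMeshOf 𝒯 Ω) : (cells 𝒯).Finite := by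
  refine (hm.finite.image fun s : Finset (E d) => convexHull ℝ (s : Set (E d))).subset ?_
  rintro K ⟨s, hs, -, rfl⟩
  exact ⟨s, hs, rfl⟩

lemma IsMeshOf.cell_subset (hm : IsMeshOf 𝒯 Ω) {K : Set (E d)} (hK : K ∈ cells 𝒯) :
    K ⊆ closure Ω := by
  obtain ⟨s, hs, -, rfl⟩ := hK
  rw [← hm.space_eq]
  exact Geometry.SimplicialComplex.convexHull_subset_space hs

lemma card_le_of_face {s : Finset (E d)} (hs : s ∈ 𝒯.faces) : s.card ≤ d + 1 := by
  have h := (𝒯.indep hs).card_le_finrank_succ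
  have h2 := (vectorSpan ℝ (Set.range ((↑) : s → E d))).finrank_le
  rw [finrank_euclideanSpace_fin] at h2
  simp only [Fintype.card_coe] at h
  omega

/-- The cells of a mesh of an open set cover its closure. -/
lemma IsMeshOf.exists_cell (hm : IsMeshOf 𝒯 Ω) (ho : IsOpen Ω) {x : E d} (hx : x ∈ closure Ω) :
    ∃ K ∈ cells 𝒯, x ∈ K := by
  set U := ⋃ K ∈ cells 𝒯, K with hU
  have hUc : IsClosed U := hm.finite_cells.isClosed_biUnion fun K hK => isClosed_of_mem_cells hK
  suffices h : Ω ⊆ U by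
    have := closure_minimal h hUc hx
    simpa [hU] using this
  -- Faces with at most `d` vertices lie in proper affine subspaces, which are null. Hence the
  -- uncovered part of `Ω` is an open null set, and so empty.
  have hnull : volume (Ω \ U) = 0 := by
    have hsub : Ω \ U ⊆ ⋃ s ∈ {s ∈ 𝒯.faces | s.card ≤ d},
        (affineSpan ℝ (s : Set (E d)) : Set (E d)) := by
      rintro y ⟨hy, hyU⟩
      have hy' : y ∈ 𝒯.space := by rw [hm.space_eq]; exact subset_closure hy
      obtain ⟨s, hs, hys⟩ := Geometry.SimplicialComplex.mem_space_iff.1 hy'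
      have hc : s.card ≤ d := by
        by_contra! hlt
        refine hyU (Set.mem_biUnion (⟨s, hs, ?_, rfl⟩ : convexHull ℝ (s : Set (E d)) ∈ cells 𝒯) hys)
        have := card_le_of_face hs
        omega
      exact Set.mem_biUnion (show s ∈ {s ∈ 𝒯.faces | s.card ≤ d} from ⟨hs, hc⟩)
        (convexHull_subset_affineSpan _ hys)
    refine measure_mono_null hsub ?_
    rw [measure_biUnion_null_iff (hm.finite.subset (Set.sep_subset _ _)).countable]
    exact fun s hs => Measure.addHaar_affineSubspace _ _ (affineSpan_ne_top_of_card_le hs.2)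
  have hopen : IsOpen (Ω \ U) := ho.sdiff hUc
  have := (hopen.measure_eq_zero_iff volume).1 hnull
  exact Set.sdiff_eq_empty.1 this

/-- The boundary of a cell is covered by the facets. -/
lemma frontier_subset_facets [DecidableEq (E d)] {s : Finset (E d)} (hs : s ∈ 𝒯.faces)
    (hc : s.card = d + 1) :
    frontier (convexHull ℝ (s : Set (E d))) ⊆
      ⋃ x ∈ s, convexHull ℝ ((s.erase x : Finset (E d)) : Set (E d)) := by
  let b : AffineBasis s ℝ (E d) := ⟨((↑) : s → E d), 𝒯.indep hs, by
    rw [Subtype.range_coe_subtype]; exact affineSpan_eq_top_of_face hs hc⟩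
  have hb : Set.range b = (s : Set (E d)) := by
    change Set.range ((↑) : s → E d) = _
    rw [Subtype.range_coe_subtype]; rfl
  intro x hx
  rw [(s.finite_toSet.isCompact_convexHull ℝ).isClosed.frontier_eq, ← hb, b.interior_convexHull,
    b.convexHull_eq_nonneg_coord] at hx
  obtain ⟨h1, h2⟩ := hx
  simp only [Set.mem_ofPred_eq, not_forall, not_lt] at h1 h2
  -- A point of the simplex outside its interior has a vanishing barycentric coordinate; it is then
  -- a convex combination of the other vertices.
  obtain ⟨i, hi⟩ := h2
  have hi0 : b.coord i x = 0 := le_antisymm hi (h1 i)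
  refine Set.mem_biUnion i.2 ?_
  rw [← b.linear_combination_coord_eq_self x, ← Finset.sum_erase (a := i) _ (by rw [hi0, zero_smul])]
  refine (convex_convexHull ℝ _).sum_mem (fun j _ => h1 j) ?_ ?_
  · rw [Finset.sum_erase (f := fun j => b.coord j x) _ hi0, b.sum_coord_apply_eq_one]
  · intro j hj
    refine subset_convexHull ℝ _ ?_
    have hne : (j : E d) ≠ i := fun h => (Finset.mem_erase.1 hj).1 (Subtype.ext h)
    exact Finset.mem_coe.2 (Finset.mem_erase.2 ⟨hne, j.2⟩)

/-! ### Surface measure of facets, and packing of cells -/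

/-- The surface measure of a bounded piece of a hyperplane. -/
lemma surface_le_of_subset_hyperplane {S : Set (E d)} {x : E d} {W : Submodule ℝ (E d)}
    (hW : Module.finrank ℝ W = d - 1) {R : ℝ} (hR : 0 ≤ R) (hSW : ∀ y ∈ S, y - x ∈ W)
    (hSR : S ⊆ Metric.closedBall x R) :
    surface d S ≤ ENNReal.ofReal (R ^ (d - 1)) * volume (Metric.ball (0 : E (d - 1)) 1) := by
  -- The hyperplane is parametrised isometrically by `ℝ^(d-1)`. Isometries preserve the Hausdorff
  -- measure, which is Lebesgue measure there.
  let e : E (d - 1) ≃ₗᵢ[ℝ] W := ((stdOrthonormalBasis ℝ W).reindex (finCongr hW)).repr.symm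
  let f : E (d - 1) → E d := fun z => (e z : E d) + x
  have hf : Isometry f := by
    refine Isometry.of_dist_eq fun z z' => ?_
    simp only [f, dist_add_right]
    exact e.isometry.dist_eq z z'
  have hsub : S ⊆ f '' Metric.closedBall 0 R := by
    intro y hy
    refine ⟨e.symm ⟨y - x, hSW y hy⟩, ?_, ?_⟩
    · rw [mem_closedBall_zero_iff, LinearIsometryEquiv.norm_map]
      have := hSR hy
      rwa [mem_closedBall_iff_norm] at this
    · simp [f]
  refine (measure_mono hsub).trans ?_
  rw [surface, hf.euclideanHausdorffMeasure_image,
    EuclideanSpace.euclideanHausdorffMeasure_eq_volume, Measure.addHaar_closedBall _ _ hR,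
    finrank_euclideanSpace_fin]

/-- There are `d + 1` facets, each in a hyperplane and within distance `R` of one of its vertices.
Positivity of `d` ensures that a facet has a vertex. -/
lemma surface_frontier_cell_le (hd : 0 < d) {K : Set (E d)} (hK : K ∈ cells 𝒯) {R : ℝ}
    (hR : Metric.diam K ≤ R) :
    surface d (frontier K) ≤
      (d + 1) * (ENNReal.ofReal (R ^ (d - 1)) * volume (Metric.ball (0 : E (d - 1)) 1)) := by
  classical
  have hcomp := isCompact_of_mem_cells hK
  obtain ⟨s, hs, hc, rfl⟩ := hK
  refine (measure_mono (frontier_subset_facets hs hc)).trans ?_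
  refine (measure_biUnion_finset_le s _).trans ?_
  have hR0 : 0 ≤ R := Metric.diam_nonneg.trans hR
  refine (Finset.sum_le_card_nsmul s _ _ fun x hx => ?_).trans
    (le_of_eq (by rw [hc, nsmul_eq_mul]; push_cast; rfl))
  have hcard : (s.erase x).card = d := by rw [Finset.card_erase_of_mem hx, hc]; rfl
  have hne : (s.erase x).Nonempty := Finset.card_pos.1 (by omega)
  obtain ⟨y, hy⟩ := hne
  have hind : AffineIndependent ℝ ((↑) : (s.erase x) → E d) :=
    (𝒯.indep hs).mono (s := ((s.erase x : Finset (E d)) : Set (E d))) (by simp)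
  have hW := hind.finrank_vectorSpan (n := d - 1) (by simp only [Fintype.card_coe]; omega)
  refine surface_le_of_subset_hyperplane (x := y) hW hR0 ?_ ?_
  · intro z hz
    have h1 := convexHull_subset_affineSpan _ hz
    have h2 : y ∈ affineSpan ℝ ((s.erase x : Finset (E d)) : Set (E d)) := mem_affineSpan ℝ hy
    have h3 := AffineSubspace.vsub_mem_direction h1 h2
    rw [direction_affineSpan] at h3
    rw [Subtype.range_coe_subtype]
    exact h3
  · intro z hz
    have hsub : ((s.erase x : Finset (E d)) : Set (E d)) ⊆ s := by simp
    rw [Metric.mem_closedBall]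
    refine (Metric.dist_le_diam_of_mem hcomp.isBounded (convexHull_mono hsub hz) ?_).trans hR
    exact subset_convexHull ℝ _ (hsub hy)

/-- The cells of the mesh have diameter at most `κ h` and contain a ball of radius `h / κ`. -/
structure MeshReg {d : ℕ} (κ h : ℝ) (𝒯 : Geometry.SimplicialComplex ℝ (E d)) : Prop where
  diam_le : ∀ K ∈ cells 𝒯, Metric.diam K ≤ κ * h
  ball : ∀ K ∈ cells 𝒯, ∃ c, Metric.closedBall c (h / κ) ⊆ K

/-- The number of cells that meet a ball of radius comparable to the mesh size is bounded. -/
lemma MeshReg.card_le {κ h R : ℝ} (hr : MeshReg κ h 𝒯) (hκ : 0 < κ) (hh : 0 < h) (hR : 0 ≤ R)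
    (x : E d) (F : Finset (Set (E d))) (hF : ∀ K ∈ F, K ∈ cells 𝒯)
    (hFx : ∀ K ∈ F, (K ∩ Metric.closedBall x (R * h)).Nonempty) :
    (F.card : ℝ) ≤ ((R + κ) * κ) ^ d := by
  have hc : ∀ K : Set (E d), ∃ c, K ∈ F → Metric.closedBall c (h / κ) ⊆ K := by
    intro K
    by_cases hK : K ∈ F
    · obtain ⟨c, hc⟩ := hr.ball K (hF K hK)
      exact ⟨c, fun _ => hc⟩
    · exact ⟨0, fun h => absurd h hK⟩
  choose c hc using hc
  -- Packing argument: the inscribed balls of radius `h / κ` are disjoint and all lie in a ball of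
  -- radius `(R + κ) h`, so comparing volumes bounds their number.
  have hdisj : (F : Set (Set (E d))).PairwiseDisjoint fun K => Metric.ball (c K) (h / κ) := by
    intro K hK K' hK' hne
    refine (disjoint_interior_of_mem_cells (hF K hK) (hF K' hK') hne).mono ?_ ?_
    · exact interior_maximal (Metric.ball_subset_closedBall.trans (hc K hK)) Metric.isOpen_ball
    · exact interior_maximal (Metric.ball_subset_closedBall.trans (hc K' hK')) Metric.isOpen_ball
  have hsub : (⋃ K ∈ F, Metric.ball (c K) (h / κ)) ⊆ Metric.closedBall x ((R + κ) * h) := by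
    refine Set.iUnion₂_subset fun K hK y hy => ?_
    obtain ⟨z, hzK, hzx⟩ := hFx K hK
    have h1 := Metric.dist_le_diam_of_mem (isCompact_of_mem_cells (hF K hK)).isBounded
      (hc K hK (Metric.ball_subset_closedBall hy)) hzK
    have h2 := hr.diam_le K (hF K hK)
    rw [Metric.mem_closedBall] at hzx ⊢
    linarith [dist_triangle y z x]
  have hvol := measure_mono (μ := volume) hsub
  rw [measure_biUnion_finset hdisj fun _ _ => measurableSet_ball] at hvol
  have hpos : 0 < h / κ := by positivity
  simp_rw [Measure.addHaar_ball_of_pos volume _ hpos] at hvol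
  rw [Measure.addHaar_closedBall _ _ (by positivity), finrank_euclideanSpace_fin, Finset.sum_const,
    nsmul_eq_mul, ← mul_assoc] at hvol
  have hB0 : volume (Metric.ball (0 : E d) 1) ≠ 0 := (Metric.measure_ball_pos _ _ one_pos).ne'
  have hvol2 := (ENNReal.mul_le_mul_iff_left hB0 measure_ball_lt_top.ne).1 hvol
  rw [← ENNReal.ofReal_natCast, ← ENNReal.ofReal_mul (by positivity),
    ENNReal.ofReal_le_ofReal_iff (by positivity), div_pow, ← mul_div_assoc,
    div_le_iff₀ (by positivity)] at hvol2
  have hhd : 0 < h ^ d := by positivity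
  have : (F.card : ℝ) * h ^ d ≤ ((R + κ) * κ) ^ d * h ^ d := by
    refine hvol2.trans (le_of_eq ?_)
    rw [mul_pow, mul_pow]; ring
  exact le_of_mul_le_mul_right this hhd

end

section

/-! ### Gradients of finite element functions -/

variable {d : ℕ} {𝒯 : Geometry.SimplicialComplex ℝ (E d)} {Ω : Set (E d)}

/-- On every cell `K`, the function `v` is given by the polynomial `P K` of degree at most `p`. -/
def IsPiecewise {d : ℕ} (p : ℕ) (𝒯 : Geometry.SimplicialComplex ℝ (E d)) (v : E d → ℝ)
    (P : Set (E d) → MvPolynomial (Fin d) ℝ) : Prop :=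
  ∀ K ∈ cells 𝒯, (P K).totalDegree ≤ p ∧ ∀ x ∈ K, v x = pev (P K) x

lemma IsFEFunction.exists_isPiecewise {p : ℕ} {v : E d → ℝ} (hv : IsFEFunction p 𝒯 Ω v) :
    ∃ P, IsPiecewise p 𝒯 v P := by
  have h : ∀ K : Set (E d), ∃ P : MvPolynomial (Fin d) ℝ, K ∈ cells 𝒯 →
      P.totalDegree ≤ p ∧ ∀ x ∈ K, v x = pev P x := by
    intro K
    by_cases hK : K ∈ cells 𝒯
    · obtain ⟨P, hP⟩ := hv.2 K hK
      exact ⟨P, fun _ => hP⟩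
    · exact ⟨0, fun h => absurd h hK⟩
  choose P hP using h
  exact ⟨P, hP⟩

variable {p : ℕ} {v : E d → ℝ} {P : Set (E d) → MvPolynomial (Fin d) ℝ}

lemma IsPiecewise.hasFDerivWithinAt (hP : IsPiecewise p 𝒯 v P) {K : Set (E d)}
    (hK : K ∈ cells 𝒯) {y : E d} (hy : y ∈ K) :
    HasFDerivWithinAt v (InnerProductSpace.toDual ℝ (E d) (polyGrad (P K) y)) K y :=
  (hasGradientAt_pev (P K) y).hasFDerivAt.hasFDerivWithinAt.congr (hP K hK).2 ((hP K hK).2 y hy)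

/-- A convex set with nonempty interior has the unique differentiability property at its boundary
points too. So wherever `v` is differentiable, every cell containing the point determines the same
gradient. -/
lemma IsPiecewise.gradient_eq (hP : IsPiecewise p 𝒯 v P) {K : Set (E d)}
    (hK : K ∈ cells 𝒯) {y : E d} (hy : y ∈ K) (hv : DifferentiableAt ℝ v y) :
    gradient v y = polyGrad (P K) y := by
  have hu : UniqueDiffWithinAt ℝ K y :=
    uniqueDiffOn_convex (convex_of_mem_cells hK) (interior_nonempty_of_mem_cells hK) y hy
  have h := hu.eq hv.hasFDerivAt.hasFDerivWithinAt (hP.hasFDerivWithinAt hK hy)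
  rw [gradient, h, LinearIsometryEquiv.symm_apply_apply]

/-- The zero alternative is the default value of `gradient` at kinks. It is harmless, since upper
bounds by the polynomial piece survive. -/
lemma IsPiecewise.gradient_eq_or (hP : IsPiecewise p 𝒯 v P) {K : Set (E d)}
    (hK : K ∈ cells 𝒯) {y : E d} (hy : y ∈ K) :
    gradient v y = 0 ∨ gradient v y = polyGrad (P K) y := by
  by_cases hv : DifferentiableAt ℝ v y
  · exact Or.inr (hP.gradient_eq hK hy hv)
  · exact Or.inl (gradient_eq_zero_of_not_differentiableAt hv)

lemma IsPiecewise.norm_gradient_le (hP : IsPiecewise p 𝒯 v P) {K : Set (E d)}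
    (hK : K ∈ cells 𝒯) {y : E d} (hy : y ∈ K) :
    ‖gradient v y‖ ≤ ‖polyGrad (P K) y‖ := by
  rcases hP.gradient_eq_or hK hy with h | h <;> simp [h]

lemma IsPiecewise.gradient_eq_of_mem_interior (hP : IsPiecewise p 𝒯 v P) {K : Set (E d)}
    (hK : K ∈ cells 𝒯) {y : E d} (hy : y ∈ interior K) :
    gradient v y = polyGrad (P K) y := by
  refine hP.gradient_eq hK (interior_subset hy) ?_
  exact ((hP.hasFDerivWithinAt hK (interior_subset hy)).hasFDerivAt
    (mem_interior_iff_mem_nhds.1 hy)).differentiableAt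

/-- Near an interior point the finitely many cells cover a neighbourhood. If their pieces have the
same gradient there, the derivatives within the cells glue to a derivative within the union. -/
lemma IsPiecewise.differentiableAt (hP : IsPiecewise p 𝒯 v P) (hm : IsMeshOf 𝒯 Ω)
    (ho : IsOpen Ω) {y g : E d} (hy : y ∈ Ω)
    (hg : ∀ K ∈ cells 𝒯, y ∈ K → polyGrad (P K) y = g) : DifferentiableAt ℝ v y := by
  set L := InnerProductSpace.toDual ℝ (E d) g
  have h1 : ∀ K ∈ cells 𝒯, HasFDerivWithinAt v L K y := by
    intro K hK
    by_cases hyK : y ∈ K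
    · have := hP.hasFDerivWithinAt hK hyK
      rwa [hg K hK hyK] at this
    · refine HasFDerivWithinAt.of_notMem_closure ?_
      rwa [(isClosed_of_mem_cells hK).closure_eq]
  have h2 : ∀ F : Set (Set (E d)), F.Finite → F ⊆ cells 𝒯 →
      HasFDerivWithinAt v L (⋃ K ∈ F, K) y := by
    intro F hF
    induction F, hF using Set.Finite.induction_on with
    | empty => intro _; simp
    | insert _ _ ih =>
      intro hsub
      rw [Set.biUnion_insert]
      exact (h1 _ (hsub (Set.mem_insert _ _))).union
        (ih ((Set.subset_insert _ _).trans hsub))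
  have h3 := h2 _ hm.finite_cells subset_rfl
  refine (h3.hasFDerivAt ?_).differentiableAt
  refine Filter.mem_of_superset (ho.mem_nhds hy) fun z hz => ?_
  obtain ⟨K, hK, hzK⟩ := hm.exists_cell ho (subset_closure hz)
  exact Set.mem_biUnion hK hzK

/-! ### Limits of gradients along rays -/

lemma tendsto_ray (s m : E d) :
    Tendsto (fun ε : ℝ => s - ε • m) (𝓝[>] 0) (𝓝 s) := by
  have h : Continuous fun ε : ℝ => s - ε • m := by fun_prop
  have := h.tendsto 0
  simp only [zero_smul, sub_zero] at this
  exact this.mono_left nhdsWithin_le_nhds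

/-- If the ray returns to `K` at arbitrarily small parameters, then `s` is in `K` by closedness, and
convexity fills in the segment from `s` to any such point. -/
lemma ray_eventually_mem_or_notMem {K : Set (E d)} (hc : Convex ℝ K) (hcl : IsClosed K)
    (s m : E d) :
    (s ∈ K ∧ ∀ᶠ ε in 𝓝[>] (0 : ℝ), s - ε • m ∈ K) ∨ ∀ᶠ ε in 𝓝[>] (0 : ℝ), s - ε • m ∉ K := by
  by_cases h : ∀ᶠ ε in 𝓝[>] (0 : ℝ), s - ε • m ∉ K
  · exact Or.inr h
  left
  have hf : ∃ᶠ ε in 𝓝[>] (0 : ℝ), s - ε • m ∈ K := by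
    rwa [Filter.Frequently]
  have hs : s ∈ K := hcl.mem_of_frequently_of_tendsto hf (tendsto_ray s m)
  refine ⟨hs, ?_⟩
  obtain ⟨ε₀, h0, hε₀⟩ := (hf.and_eventually self_mem_nhdsWithin).exists
  filter_upwards [Ioo_mem_nhdsGT hε₀] with ε hε
  have h0' : (0 : ℝ) < ε₀ := hε₀
  have h1 := hc hs h0 (a := 1 - ε / ε₀) (b := ε / ε₀)
    (sub_nonneg.2 ((div_le_one h0').2 hε.2.le)) (div_nonneg hε.1.le h0'.le) (by ring)
  convert h1 using 1
  rw [smul_sub, smul_smul, div_mul_cancel₀ _ h0'.ne', sub_smul, one_smul]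
  abel

lemma analyticAt_polyGrad_line (P : MvPolynomial (Fin d) ℝ) (s m : E d) (ε : ℝ) :
    AnalyticAt ℝ (fun ε : ℝ => polyGrad P (s - ε • m)) ε := by
  have h : AnalyticAt ℝ (fun ε : ℝ => fun i => pev (MvPolynomial.pderiv i P) (s - ε • m)) ε :=
    AnalyticAt.pi fun i => analyticAt_pev_line _ s m ε
  exact ((PiLp.continuousLinearEquiv 2 ℝ (fun _ : Fin d => ℝ)).symm.toContinuousLinearMap.analyticAt
    _).comp h

/-- Along every ray that enters `Ω`, the gradient of a finite element function has a limit, which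
is zero or the limit of the gradient of one of the polynomial pieces. -/
lemma IsPiecewise.exists_tendsto_gradient (hP : IsPiecewise p 𝒯 v P) (hm : IsMeshOf 𝒯 Ω)
    (ho : IsOpen Ω) {s m : E d} (hs : ∀ᶠ ε in 𝓝[>] (0 : ℝ), s - ε • m ∈ Ω) :
    ∃ K ∈ cells 𝒯, s ∈ K ∧ ∃ L : E d, (L = 0 ∨ L = polyGrad (P K) s) ∧
      Tendsto (fun ε : ℝ => gradient v (s - ε • m)) (𝓝[>] 0) (𝓝 L) := by
  classical
  -- These are the cells that contain an initial piece of the ray. By the dichotomy for convex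
  -- cells, all other cells miss such a piece, so only `𝒦` matters near `s`.
  set 𝒦 := {K ∈ cells 𝒯 | ∀ᶠ ε in 𝓝[>] (0 : ℝ), s - ε • m ∈ K} with h𝒦
  have hfin : 𝒦.Finite := hm.finite_cells.subset (Set.sep_subset _ _)
  have hin : ∀ᶠ ε in 𝓝[>] (0 : ℝ), ∀ K ∈ 𝒦, s - ε • m ∈ K :=
    (Filter.eventually_all_finite hfin).2 fun K hK => hK.2
  have hout : ∀ᶠ ε in 𝓝[>] (0 : ℝ), ∀ K ∈ cells 𝒯, s - ε • m ∈ K → K ∈ 𝒦 := by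
    refine (Filter.eventually_all_finite hm.finite_cells).2 fun K hK => ?_
    rcases ray_eventually_mem_or_notMem (convex_of_mem_cells hK) (isClosed_of_mem_cells hK) s m
      with h | h
    · exact Eventually.of_forall fun _ _ => ⟨hK, h.2⟩
    · filter_upwards [h] with ε hε hε' using absurd hε' hε
  obtain ⟨K, hK⟩ : 𝒦.Nonempty := by
    obtain ⟨ε, h1, h2⟩ := (hout.and hs).exists
    obtain ⟨K, hK, hK'⟩ := hm.exists_cell ho (subset_closure h2)
    exact ⟨K, h1 K hK hK'⟩
  have hsK : s ∈ K := (isClosed_of_mem_cells hK.1).mem_of_tendsto (tendsto_ray s m) hK.2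
  refine ⟨K, hK.1, hsK, ?_⟩
  -- Either all pieces share their gradient along the ray, which makes `v` differentiable there, or
  -- by analyticity two of them differ at all small parameters. In the latter case `v` is nowhere
  -- differentiable near the start of the ray and `gradient v` takes its default value `0`.
  by_cases hall : ∀ K' ∈ 𝒦, ∀ᶠ ε in 𝓝[>] (0 : ℝ),
      polyGrad (P K') (s - ε • m) = polyGrad (P K) (s - ε • m)
  · refine ⟨_, Or.inr rfl, ?_⟩
    have hall' := (Filter.eventually_all_finite hfin).2 hall
    refine Tendsto.congr' ?_ (((continuous_polyGrad (P K)).tendsto s).comp (tendsto_ray s m))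
    filter_upwards [hall', hout, hin, hs] with ε h1 h2 h3 h4
    refine (hP.gradient_eq hK.1 (h3 K hK) ?_).symm
    exact hP.differentiableAt hm ho h4 fun K' hK' hy => h1 K' (h2 K' hK' hy)
  · refine ⟨0, Or.inl rfl, ?_⟩
    push Not at hall
    obtain ⟨K', hK', hne⟩ := hall
    have hne' : ∀ᶠ ε in 𝓝[>] (0 : ℝ),
        polyGrad (P K') (s - ε • m) ≠ polyGrad (P K) (s - ε • m) := by
      rcases (analyticAt_polyGrad_line (P K') s m 0).eventually_eq_or_eventually_ne
        (analyticAt_polyGrad_line (P K) s m 0) with h | h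
      · obtain ⟨ε, h1, h2⟩ := (hne.and_eventually (h.filter_mono nhdsWithin_le_nhds)).exists
        exact absurd h2 h1
      · exact h.filter_mono (nhdsWithin_mono _ fun x hx => ne_of_gt hx)
    refine Tendsto.congr' ?_ tendsto_const_nhds
    filter_upwards [hne', hin] with ε h1 h2
    refine (gradient_eq_zero_of_not_differentiableAt fun hd => h1 ?_).symm
    rw [← hP.gradient_eq hK.1 (h2 K hK) hd, ← hP.gradient_eq hK'.1 (h2 K' hK') hd]

end

section

/-! ### The cut geometry -/

/-- A domain `G ⊆ Ω₀` overlapping `Ω₀`, with meshes of `Ω₀` and of `G` of common size `h` and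
regularity constant `κ`. -/
structure IsCutSetting {d : ℕ} (κ h : ℝ) (Ω₀ G : Set (E d))
    (𝒯₀ 𝒯G : Geometry.SimplicialComplex ℝ (E d)) : Prop where
  d_pos : 0 < d
  one_le : 1 ≤ κ
  h_pos : 0 < h
  isOpen₀ : IsOpen Ω₀
  isBounded₀ : Bornology.IsBounded Ω₀
  isOpenG : IsOpen G
  subset : G ⊆ Ω₀
  null₀ : volume (frontier Ω₀) = 0
  nullG : volume (frontier G) = 0
  mesh₀ : IsMeshOf 𝒯₀ Ω₀
  meshG : IsMeshOf 𝒯G G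
  reg₀ : MeshReg κ h 𝒯₀
  regG : MeshReg κ h 𝒯G
  le_diam : ∀ K ∈ cells 𝒯₀, h ≤ κ * Metric.diam K

variable {d : ℕ} {κ h : ℝ} {Ω₀ G : Set (E d)} {𝒯₀ 𝒯G : Geometry.SimplicialComplex ℝ (E d)}

lemma Omega1_eq : Omega1 Ω₀ G = Ω₀ \ closure G := by
  rw [Omega1, closure_eq_self_union_frontier]

lemma Omega1_subset : Omega1 Ω₀ G ⊆ Ω₀ := Set.sdiff_subset

lemma disjoint_Omega1_Omega2 : Disjoint (Omega1 Ω₀ G) (Omega2 Ω₀ G) := by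
  rw [Set.disjoint_left]
  rintro x ⟨-, hx⟩ ⟨-, hx'⟩
  exact hx (Or.inl hx')

lemma isClosed_Gam : IsClosed (Gam Ω₀ G) := isClosed_frontier.inter isClosed_frontier

/-- A unit normal is unique. -/
lemma IsUnitNormal.unique {Ω₁ Ω₂ : Set (E d)} (hdisj : Disjoint Ω₁ Ω₂) {s ν ν' : E d}
    (h : IsUnitNormal Ω₁ Ω₂ s ν) (h' : IsUnitNormal Ω₁ Ω₂ s ν') : ν = ν' := by
  by_contra hne
  obtain ⟨h1, δ, hδ, hb⟩ := h
  obtain ⟨h1', δ', hδ', hb'⟩ := h'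
  have hlt : inner ℝ ν ν' < 1 := by
    rcases lt_or_eq_of_le (real_inner_le_norm ν ν') with h | h
    · simpa [h1, h1'] using h
    · exact absurd ((inner_eq_one_iff_of_norm_eq_one h1 h1').1 (by simpa [h1, h1'] using h)) hne
  -- Moving from `s` in the direction `ν' - ν` leads to the negative side for `ν` and the positive
  -- side for `ν'`, hence into both of the disjoint sets.
  have htend : Tendsto (fun ε : ℝ => s - ε • (ν - ν')) (𝓝[>] 0) (𝓝 s) := tendsto_ray s _
  obtain ⟨ε, hε1, hε2, hε⟩ := ((htend.eventually (Metric.ball_mem_nhds s hδ)).and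
    ((htend.eventually (Metric.ball_mem_nhds s hδ')).and self_mem_nhdsWithin)).exists
  have hε0 : (0 : ℝ) < ε := hε
  refine Set.disjoint_left.1 hdisj ((hb _ hε1).1 ?_) ((hb' _ hε2).2 ?_)
  · rw [sub_sub_cancel_left, inner_neg_left, inner_smul_left, inner_sub_left,
      real_inner_self_eq_norm_sq, h1, real_inner_comm]
    simp only [conj_trivial]
    nlinarith
  · rw [sub_sub_cancel_left, inner_neg_left, inner_smul_left, inner_sub_left,
      real_inner_self_eq_norm_sq, h1']
    simp only [conj_trivial]
    nlinarith

lemma unitNormal_spec (Ω₀ G : Set (E d)) (s : E d) :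
    unitNormal Ω₀ G s = 0 ∨
      IsUnitNormal (Omega1 Ω₀ G) (Omega2 Ω₀ G) s (unitNormal Ω₀ G s) := by
  unfold unitNormal
  split_ifs with h
  · exact Or.inr h.choose_spec
  · exact Or.inl rfl

lemma unitNormal_eq {s ν : E d} (h : IsUnitNormal (Omega1 Ω₀ G) (Omega2 Ω₀ G) s ν) :
    unitNormal Ω₀ G s = ν := by
  have h' : ∃ ν, IsUnitNormal (Omega1 Ω₀ G) (Omega2 Ω₀ G) s ν := ⟨ν, h⟩
  unfold unitNormal
  rw [dif_pos h']
  exact h'.choose_spec.unique disjoint_Omega1_Omega2 h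

lemma IsUnitNormal.eventually_left {Ω₁ Ω₂ : Set (E d)} {s ν : E d}
    (h : IsUnitNormal Ω₁ Ω₂ s ν) : ∀ᶠ ε in 𝓝[>] (0 : ℝ), s - ε • ν ∈ Ω₁ := by
  obtain ⟨h1, δ, hδ, hb⟩ := h
  filter_upwards [(tendsto_ray s ν).eventually (Metric.ball_mem_nhds s hδ), self_mem_nhdsWithin]
    with ε hε hε0
  have hε0' : (0 : ℝ) < ε := hε0
  refine (hb _ hε).1 ?_
  rw [sub_sub_cancel_left, inner_neg_left, inner_smul_left, real_inner_self_eq_norm_sq, h1]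
  simpa using hε0'

lemma IsUnitNormal.eventually_right {Ω₁ Ω₂ : Set (E d)} {s ν : E d}
    (h : IsUnitNormal Ω₁ Ω₂ s ν) : ∀ᶠ ε in 𝓝[>] (0 : ℝ), s - ε • (-ν) ∈ Ω₂ := by
  obtain ⟨h1, δ, hδ, hb⟩ := h
  filter_upwards [(tendsto_ray s (-ν)).eventually (Metric.ball_mem_nhds s hδ), self_mem_nhdsWithin]
    with ε hε hε0
  have hε0' : (0 : ℝ) < ε := hε0
  refine (hb _ hε).2 ?_
  rw [sub_sub_cancel_left, inner_neg_left, inner_smul_left, inner_neg_left,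
    real_inner_self_eq_norm_sq, h1]
  simpa using hε0'

lemma Gam_subset_closure : Gam Ω₀ G ⊆ closure Ω₀ := fun _ hs =>
  closure_mono Omega1_subset (frontier_subset_closure hs.1)

lemma norm_unitNormal_le (s : E d) : ‖unitNormal Ω₀ G s‖ ≤ 1 := by
  rcases unitNormal_spec Ω₀ G s with h | h
  · simp [h]
  · exact h.1.le

/-- Where no normal exists, the field is `0` and the ray is constant, so the limit is still the
point value. -/
lemma sideLim_left {φ : E d → ℝ} (hφ : ContinuousOn φ (closure Ω₀)) {s : E d}
    (hs : s ∈ Gam Ω₀ G) : sideLim φ (unitNormal Ω₀ G s) s = φ s := by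
  refine Tendsto.limUnder_eq ?_
  rcases unitNormal_spec Ω₀ G s with h | h
  · simp [h]
  · refine (hφ s (Gam_subset_closure hs)).tendsto.comp
      (tendsto_nhdsWithin_iff.2 ⟨tendsto_ray _ _, ?_⟩)
    filter_upwards [h.eventually_left] with ε hε using subset_closure (Omega1_subset hε)

namespace IsCutSetting

lemma κ_pos (H : IsCutSetting κ h Ω₀ G 𝒯₀ 𝒯G) : 0 < κ := zero_lt_one.trans_le H.one_le

lemma Omega2_eq (H : IsCutSetting κ h Ω₀ G 𝒯₀ 𝒯G) : Omega2 Ω₀ G = G := Set.inter_eq_right.2 H.subset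

lemma isOpen_Omega1 (H : IsCutSetting κ h Ω₀ G 𝒯₀ 𝒯G) : IsOpen (Omega1 Ω₀ G) := by
  rw [Omega1_eq]; exact H.isOpen₀.sdiff isClosed_closure

lemma isOpen_Omega2 (H : IsCutSetting κ h Ω₀ G 𝒯₀ 𝒯G) : IsOpen (Omega2 Ω₀ G) := by
  rw [H.Omega2_eq]; exact H.isOpenG

lemma Gam_subset_closureG (H : IsCutSetting κ h Ω₀ G 𝒯₀ 𝒯G) : Gam Ω₀ G ⊆ closure G := fun s hs => by
  have := frontier_subset_closure hs.2
  rwa [H.Omega2_eq] at this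

lemma isCompact_closure₀ (H : IsCutSetting κ h Ω₀ G 𝒯₀ 𝒯G)
    : IsCompact (closure Ω₀) := H.isBounded₀.isCompact_closure

lemma isCompact_closureG (H : IsCutSetting κ h Ω₀ G 𝒯₀ 𝒯G) : IsCompact (closure G) :=
  (H.isBounded₀.subset H.subset).isCompact_closure

lemma isCompact_Gam (H : IsCutSetting κ h Ω₀ G 𝒯₀ 𝒯G) : IsCompact (Gam Ω₀ G) :=
  H.isCompact_closure₀.of_isClosed_subset isClosed_Gam Gam_subset_closure

lemma notMem_Omega1 (H : IsCutSetting κ h Ω₀ G 𝒯₀ 𝒯G)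
    {s : E d} (hs : s ∈ Gam Ω₀ G) : s ∉ Omega1 Ω₀ G := by
  have := hs.1
  rw [H.isOpen_Omega1.frontier_eq] at this
  exact this.2

lemma notMem_Omega2 (H : IsCutSetting κ h Ω₀ G 𝒯₀ 𝒯G)
    {s : E d} (hs : s ∈ Gam Ω₀ G) : s ∉ Omega2 Ω₀ G := by
  have := hs.2
  rw [H.isOpen_Omega2.frontier_eq] at this
  exact this.2

/-- The interface does not meet the interior of the cells of the overlapping mesh. -/
lemma mem_frontier_of_mem_cell (H : IsCutSetting κ h Ω₀ G 𝒯₀ 𝒯G)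
    {K : Set (E d)} (hK : K ∈ cells 𝒯G) {s : E d}
    (hs : s ∈ Gam Ω₀ G) (hsK : s ∈ K) : s ∈ frontier K := by
  rw [(isClosed_of_mem_cells hK).frontier_eq]
  refine ⟨hsK, fun hint => ?_⟩
  have h1 : s ∈ closure (Omega1 Ω₀ G) := frontier_subset_closure hs.1
  obtain ⟨y, hyK, hy1⟩ := mem_closure_iff.1 h1 _ isOpen_interior hint
  rw [Omega1_eq] at hy1
  exact hy1.2 (H.meshG.cell_subset hK (interior_subset hyK))

/-! ### The unit normal on the interface -/

/-- The interface avoids both open sets `Ω₁` and `Ω₂`, so near `s` it lies in the hyperplane through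
`s` orthogonal to `ν`. The same half-space description then holds at nearby interface points. -/
lemma exists_nhds_unitNormal (H : IsCutSetting κ h Ω₀ G 𝒯₀ 𝒯G)
    {s ν : E d} (hν : IsUnitNormal (Omega1 Ω₀ G) (Omega2 Ω₀ G) s ν) :
    ∃ δ > 0, ∀ s' ∈ Gam Ω₀ G ∩ Metric.ball s δ,
      IsUnitNormal (Omega1 Ω₀ G) (Omega2 Ω₀ G) s' ν := by
  obtain ⟨h1, δ, hδ, hb⟩ := hν
  refine ⟨δ, hδ, fun s' hs' => ⟨h1, δ - dist s' s, by simpa using hs'.2, fun y hy => ?_⟩⟩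
  have h0 : inner ℝ (s' - s) ν = 0 := by
    rcases lt_trichotomy (inner ℝ (s' - s) ν) 0 with h | h | h
    · exact absurd ((hb s' hs'.2).1 h) (H.notMem_Omega1 hs'.1)
    · exact h
    · exact absurd ((hb s' hs'.2).2 h) (H.notMem_Omega2 hs'.1)
  have hy' : y ∈ Metric.ball s δ := by
    rw [Metric.mem_ball] at hy ⊢
    linarith [dist_triangle y s' s]
  have h2 : inner ℝ (y - s') ν = inner ℝ (y - s) ν := by
    rw [show y - s' = (y - s) - (s' - s) by abel, inner_sub_left, h0, sub_zero]
  rw [h2]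
  exact hb y hy'

/-- On the interface, the unit normal field is a Borel function. -/
lemma exists_measurable_unitNormal (H : IsCutSetting κ h Ω₀ G 𝒯₀ 𝒯G) :
    ∃ ν : E d → E d, Measurable ν ∧ ∀ s ∈ Gam Ω₀ G, ν s = unitNormal Ω₀ G s := by
  classical
  -- The points with a normal form a relatively open subset of the interface on which the normal is
  -- locally constant; elsewhere on the interface it is `0`.
  set R := {s ∈ Gam Ω₀ G | ∃ ν, IsUnitNormal (Omega1 Ω₀ G) (Omega2 Ω₀ G) s ν} with hR
  have hloc : ∀ s ∈ R, ∃ δ > 0, ∀ s' ∈ Gam Ω₀ G ∩ Metric.ball s δ,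
      s' ∈ R ∧ unitNormal Ω₀ G s' = unitNormal Ω₀ G s := by
    rintro s ⟨hs, ν, hν⟩
    obtain ⟨δ, hδ, h⟩ := H.exists_nhds_unitNormal hν
    exact ⟨δ, hδ, fun s' hs' => ⟨⟨hs'.1, ν, h s' hs'⟩,
      (unitNormal_eq (h s' hs')).trans (unitNormal_eq hν).symm⟩⟩
  choose! δ hδ hloc using hloc
  have hRm : MeasurableSet R := by
    have : R = Gam Ω₀ G ∩ ⋃ s ∈ R, Metric.ball s (δ s) := by
      ext s
      constructor
      · intro hs
        exact ⟨hs.1, Set.mem_biUnion hs (Metric.mem_ball_self (hδ s hs))⟩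
      · rintro ⟨hs, hs'⟩
        obtain ⟨s₀, hs₀, hb⟩ := Set.mem_iUnion₂.1 hs'
        exact (hloc s₀ hs₀ s ⟨hs, hb⟩).1
    rw [this]
    exact isClosed_Gam.measurableSet.inter
      (isOpen_biUnion fun s _ => Metric.isOpen_ball).measurableSet
  have hcont : ContinuousOn (unitNormal Ω₀ G) R := by
    intro s hs
    refine (continuousWithinAt_const (b := unitNormal Ω₀ G s)).congr_of_eventuallyEq ?_ rfl
    filter_upwards [self_mem_nhdsWithin, mem_nhdsWithin_of_mem_nhds
      (Metric.ball_mem_nhds s (hδ s hs))] with s' h1 h2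
    exact (hloc s hs s' ⟨h1.1, h2⟩).2
  refine ⟨R.piecewise (unitNormal Ω₀ G) 0, hcont.measurable_piecewise continuousOn_const hRm, ?_⟩
  intro s hs
  by_cases hsR : s ∈ R
  · rw [Set.piecewise_eq_of_mem _ _ _ hsR]
  · rw [Set.piecewise_eq_of_notMem _ _ _ hsR]
    rcases unitNormal_spec Ω₀ G s with h | h
    · exact h.symm
    · exact absurd ⟨hs, _, h⟩ hsR

/-! ### Traces on the interface -/

lemma sideLim_right (H : IsCutSetting κ h Ω₀ G 𝒯₀ 𝒯G)
    {φ : E d → ℝ} (hφ : ContinuousOn φ (closure G)) {s : E d}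
    (hs : s ∈ Gam Ω₀ G) : sideLim φ (-unitNormal Ω₀ G s) s = φ s := by
  refine Tendsto.limUnder_eq ?_
  rcases unitNormal_spec Ω₀ G s with h | h
  · simp [h]
  · refine (hφ s (H.Gam_subset_closureG hs)).tendsto.comp
      (tendsto_nhdsWithin_iff.2 ⟨tendsto_ray _ _, ?_⟩)
    filter_upwards [h.eventually_right] with ε hε using subset_closure hε.2

lemma jumpGam_eq (H : IsCutSetting κ h Ω₀ G 𝒯₀ 𝒯G)
    {v : Broken d} (h1 : ContinuousOn v.1 (closure Ω₀))
    (h2 : ContinuousOn v.2 (closure G)) {s : E d} (hs : s ∈ Gam Ω₀ G) :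
    jumpGam Ω₀ G v s = v.1 s - v.2 s := by
  rw [jumpGam, sideLim_left h1 hs, H.sideLim_right h2 hs]

/-- Convergence is recorded along with the bound: `sideLim` is a `limUnder`, which has no meaning
without it, and the measurability proof passes to this limit along a sequence. -/
lemma sideLim_gradient_left (H : IsCutSetting κ h Ω₀ G 𝒯₀ 𝒯G)
    {p : ℕ} {v : E d → ℝ} {P : Set (E d) → MvPolynomial (Fin d) ℝ}
    (hP : IsPiecewise p 𝒯₀ v P) {s : E d} (hν : unitNormal Ω₀ G s ≠ 0) :
    ∃ K ∈ cells 𝒯₀, s ∈ K ∧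
      ‖sideLim (gradient v) (unitNormal Ω₀ G s) s‖ ≤ ‖polyGrad (P K) s‖ ∧
      Tendsto (fun ε : ℝ => gradient v (s - ε • unitNormal Ω₀ G s)) (𝓝[>] 0)
        (𝓝 (sideLim (gradient v) (unitNormal Ω₀ G s) s)) := by
  have h := (unitNormal_spec Ω₀ G s).resolve_left hν
  obtain ⟨K, hK, hsK, L, hL, ht⟩ := hP.exists_tendsto_gradient H.mesh₀ H.isOpen₀
    (h.eventually_left.mono fun ε hε => Omega1_subset hε)
  have he : sideLim (gradient v) (unitNormal Ω₀ G s) s = L := ht.limUnder_eq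
  refine ⟨K, hK, hsK, ?_, he ▸ ht⟩
  rw [he]
  rcases hL with rfl | rfl <;> simp

lemma sideLim_gradient_right (H : IsCutSetting κ h Ω₀ G 𝒯₀ 𝒯G)
    {p : ℕ} {v : E d → ℝ} {P : Set (E d) → MvPolynomial (Fin d) ℝ}
    (hP : IsPiecewise p 𝒯G v P) {s : E d} (hν : unitNormal Ω₀ G s ≠ 0) :
    ∃ K ∈ cells 𝒯G, s ∈ K ∧
      ‖sideLim (gradient v) (-unitNormal Ω₀ G s) s‖ ≤ ‖polyGrad (P K) s‖ ∧
      Tendsto (fun ε : ℝ => gradient v (s - ε • -unitNormal Ω₀ G s)) (𝓝[>] 0)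
        (𝓝 (sideLim (gradient v) (-unitNormal Ω₀ G s) s)) := by
  have h := (unitNormal_spec Ω₀ G s).resolve_left hν
  obtain ⟨K, hK, hsK, L, hL, ht⟩ := hP.exists_tendsto_gradient H.meshG H.isOpenG
    (h.eventually_right.mono fun ε hε => hε.2)
  have he : sideLim (gradient v) (-unitNormal Ω₀ G s) s = L := ht.limUnder_eq
  refine ⟨K, hK, hsK, ?_, he ▸ ht⟩
  rw [he]
  rcases hL with rfl | rfl <;> simp

/-- Pointwise bound of the average of the normal derivatives by the polynomial pieces. -/
lemma abs_avgNormalDeriv_le (H : IsCutSetting κ h Ω₀ G 𝒯₀ 𝒯G)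
    {p : ℕ} {v : Broken d} {P₀ PG : Set (E d) → MvPolynomial (Fin d) ℝ}
    (hP₀ : IsPiecewise p 𝒯₀ v.1 P₀) (hPG : IsPiecewise p 𝒯G v.2 PG) {ω₁ ω₂ : ℝ}
    (hω₁ : ω₁ ∈ Set.Icc (0 : ℝ) 1) (hω₂ : ω₂ ∈ Set.Icc (0 : ℝ) 1) {s : E d} (hs : s ∈ Gam Ω₀ G) :
    ∃ K ∈ cells 𝒯₀, s ∈ K ∧ ∃ K' ∈ cells 𝒯G, s ∈ K' ∧
      |avgNormalDeriv ω₁ ω₂ Ω₀ G v s| ≤ ‖polyGrad (P₀ K) s‖ + ‖polyGrad (PG K') s‖ := by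
  by_cases hν : unitNormal Ω₀ G s = 0
  · obtain ⟨K, hK, hsK⟩ := H.mesh₀.exists_cell H.isOpen₀ (Gam_subset_closure hs)
    obtain ⟨K', hK', hsK'⟩ := H.meshG.exists_cell H.isOpenG (H.Gam_subset_closureG hs)
    refine ⟨K, hK, hsK, K', hK', hsK', ?_⟩
    simp only [avgNormalDeriv, hν, inner_zero_left, mul_zero, add_zero, abs_zero]
    positivity
  · obtain ⟨K, hK, hsK, h1, -⟩ := H.sideLim_gradient_left hP₀ hν
    obtain ⟨K', hK', hsK', h2, -⟩ := H.sideLim_gradient_right hPG hν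
    refine ⟨K, hK, hsK, K', hK', hsK', ?_⟩
    have key : ∀ ω ∈ Set.Icc (0 : ℝ) 1, ∀ g : E d, |ω * inner ℝ (unitNormal Ω₀ G s) g| ≤ ‖g‖ := by
      intro ω hω g
      rw [abs_mul, abs_of_nonneg hω.1]
      have h3 := abs_real_inner_le_norm (unitNormal Ω₀ G s) g
      have h4 := norm_unitNormal_le (Ω₀ := Ω₀) (G := G) s
      calc ω * |inner ℝ (unitNormal Ω₀ G s) g| ≤ 1 * (1 * ‖g‖) := by
            refine mul_le_mul hω.2 (h3.trans ?_) (abs_nonneg _) zero_le_one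
            exact mul_le_mul_of_nonneg_right h4 (norm_nonneg _)
        _ = ‖g‖ := by ring
    refine (abs_add_le _ _).trans (add_le_add ((key ω₁ hω₁ _).trans h1) ((key ω₂ hω₂ _).trans h2))

/-! ### The surface measure of the interface -/

/-- The interface has surface measure of order `h ^ (d - 1)` in a ball of radius of order `h`. -/
lemma surface_le (H : IsCutSetting κ h Ω₀ G 𝒯₀ 𝒯G)
    {S : Set (E d)} {x : E d} (hS : S ⊆ Metric.closedBall x (κ * h)) :
    surface d (S ∩ Gam Ω₀ G) ≤ ENNReal.ofReal
      (((κ + κ) * κ) ^ d * ((d + 1) * (κ ^ (d - 1) * (volume (Metric.ball (0 : E (d - 1)) 1)).toReal))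
        * h ^ (d - 1)) := by
  classical
  have hκ := H.κ_pos
  have hh := H.h_pos
  -- The overlapping mesh is used, since the interface runs along the boundaries of its cells while
  -- it crosses background cells arbitrarily.
  have hfin : {K ∈ cells 𝒯G | (K ∩ Metric.closedBall x (κ * h)).Nonempty}.Finite :=
    H.meshG.finite_cells.subset (Set.sep_subset _ _)
  set F := hfin.toFinset with hF
  have hFm : ∀ K ∈ F, K ∈ cells 𝒯G ∧ (K ∩ Metric.closedBall x (κ * h)).Nonempty := by
    intro K hK
    simpa [hF] using hK
  have hcard := H.regG.card_le hκ hh hκ.le x F (fun K hK => (hFm K hK).1) (fun K hK => (hFm K hK).2)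
  have hsub : S ∩ Gam Ω₀ G ⊆ ⋃ K ∈ F, frontier K := by
    rintro s ⟨hsS, hs⟩
    obtain ⟨K, hK, hsK⟩ := H.meshG.exists_cell H.isOpenG (H.Gam_subset_closureG hs)
    have : K ∈ F := by
      simp only [hF, Set.Finite.mem_toFinset, Set.mem_ofPred_eq]
      exact ⟨hK, s, hsK, hS hsS⟩
    exact Set.mem_biUnion (Finset.mem_coe.2 this) (H.mem_frontier_of_mem_cell hK hs hsK)
  refine (measure_mono hsub).trans ((measure_biUnion_finset_le _ _).trans ?_)
  have h1 : ∀ K ∈ F, surface d (frontier K) ≤ ENNReal.ofReal ((d + 1) * ((κ * h) ^ (d - 1) *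
      (volume (Metric.ball (0 : E (d - 1)) 1)).toReal)) := by
    intro K hK
    refine (surface_frontier_cell_le H.d_pos (hFm K hK).1 (H.regG.diam_le K (hFm K hK).1)).trans
      (le_of_eq ?_)
    rw [ENNReal.ofReal_mul (by positivity), ENNReal.ofReal_mul (by positivity),
      ENNReal.ofReal_toReal measure_ball_lt_top.ne]
    congr 1
    rw [ENNReal.ofReal_add (by positivity) zero_le_one]
    simp
  refine (Finset.sum_le_card_nsmul F _ _ h1).trans ?_
  rw [nsmul_eq_mul, ← ENNReal.ofReal_natCast, ← ENNReal.ofReal_mul (by positivity)]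
  refine ENNReal.ofReal_le_ofReal ?_
  rw [mul_pow]
  calc (F.card : ℝ) * ((d + 1) * (κ ^ (d - 1) * h ^ (d - 1) *
        (volume (Metric.ball (0 : E (d - 1)) 1)).toReal))
      ≤ ((κ + κ) * κ) ^ d * ((d + 1) * (κ ^ (d - 1) * h ^ (d - 1) *
        (volume (Metric.ball (0 : E (d - 1)) 1)).toReal)) :=
        mul_le_mul_of_nonneg_right hcard (by positivity)
    _ = _ := by ring

/-- The local bound holds on each of the finitely many background cells. Finiteness makes bounded
measurable functions on the interface integrable. -/
lemma surface_Gam_lt_top (H : IsCutSetting κ h Ω₀ G 𝒯₀ 𝒯G) : surface d (Gam Ω₀ G) < ⊤ := by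
  classical
  have hsub : Gam Ω₀ G ⊆ ⋃ K ∈ cells 𝒯₀, (K ∩ Gam Ω₀ G) := by
    intro s hs
    obtain ⟨K, hK, hsK⟩ := H.mesh₀.exists_cell H.isOpen₀ (Gam_subset_closure hs)
    exact Set.mem_biUnion hK ⟨hsK, hs⟩
  refine (measure_mono hsub).trans_lt (measure_biUnion_lt_top H.mesh₀.finite_cells fun K hK => ?_)
  obtain ⟨x, hx⟩ := (interior_nonempty_of_mem_cells hK)
  refine (H.surface_le (x := x) (S := K) fun y hy => ?_).trans_lt ENNReal.ofReal_lt_top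
  exact (Metric.dist_le_diam_of_mem (isCompact_of_mem_cells hK).isBounded hy
    (interior_subset hx)).trans (H.reg₀.diam_le K hK)

end IsCutSetting

end

section

variable {d : ℕ} {κ h : ℝ} {Ω₀ G Ω : Set (E d)} {𝒯₀ 𝒯G 𝒯 : Geometry.SimplicialComplex ℝ (E d)}
  {p : ℕ}

/-! ### Measurability and integrability -/

lemma measurable_gradient (v : E d → ℝ) : Measurable (gradient v) :=
  (InnerProductSpace.toDual ℝ (E d)).symm.continuous.measurable.comp (measurable_fderiv ℝ v)

lemma IsMeshOf.exists_bound_polyGrad (hm : IsMeshOf 𝒯 Ω)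
    (P : Set (E d) → MvPolynomial (Fin d) ℝ) :
    ∃ M : ℝ, 0 ≤ M ∧ ∀ K ∈ cells 𝒯, ∀ y ∈ K, ‖polyGrad (P K) y‖ ≤ M := by
  have h : ∀ K ∈ cells 𝒯, ∃ M : ℝ, ∀ y ∈ K, ‖polyGrad (P K) y‖ ≤ M := fun K hK =>
    (isCompact_of_mem_cells hK).exists_bound_of_continuousOn (continuous_polyGrad _).continuousOn
  choose! M hM using h
  refine ⟨∑ K ∈ hm.finite_cells.toFinset, |M K|, Finset.sum_nonneg fun _ _ => abs_nonneg _,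
    fun K hK y hy => ?_⟩
  refine ((hM K hK y hy).trans (le_abs_self _)).trans ?_
  exact Finset.single_le_sum (f := fun K => |M K|) (fun _ _ => abs_nonneg _)
    (hm.finite_cells.mem_toFinset.2 hK)

lemma IsPiecewise.norm_gradient_le_of_bound {v : E d → ℝ} {P : Set (E d) → MvPolynomial (Fin d) ℝ}
    (hP : IsPiecewise p 𝒯 v P) (hm : IsMeshOf 𝒯 Ω) (ho : IsOpen Ω) {M : ℝ}
    (hM : ∀ K ∈ cells 𝒯, ∀ y ∈ K, ‖polyGrad (P K) y‖ ≤ M) {y : E d} (hy : y ∈ closure Ω) :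
    ‖gradient v y‖ ≤ M := by
  obtain ⟨K, hK, hyK⟩ := hm.exists_cell ho hy
  exact (hP.norm_gradient_le hK hyK).trans (hM K hK y hyK)

lemma integrableOn_of_bound {X : Type*} [MeasurableSpace X] {μ : Measure X} {S : Set X}
    (hS : MeasurableSet S) (hμ : μ S < ⊤) {φ : X → ℝ} (hφ : AEStronglyMeasurable φ (μ.restrict S))
    {M : ℝ} (hM : ∀ x ∈ S, |φ x| ≤ M) : IntegrableOn φ S μ :=
  IntegrableOn.of_bound hμ hφ M ((ae_restrict_iff' hS).2 (ae_of_all _ hM))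

lemma IsPiecewise.integrableOn_gradient_sq {v : E d → ℝ} {P : Set (E d) → MvPolynomial (Fin d) ℝ}
    (hP : IsPiecewise p 𝒯 v P) (hm : IsMeshOf 𝒯 Ω) (ho : IsOpen Ω) (hc : IsCompact (closure Ω)) :
    IntegrableOn (fun x => ‖gradient v x‖ ^ 2) (closure Ω) := by
  obtain ⟨M, hM0, hM⟩ := hm.exists_bound_polyGrad P
  refine integrableOn_of_bound (M := M ^ 2) isClosed_closure.measurableSet hc.measure_lt_top
    ((measurable_gradient v).norm.pow_const 2).aestronglyMeasurable fun x hx => ?_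
  rw [abs_of_nonneg (by positivity)]
  exact pow_le_pow_left₀ (norm_nonneg _) (hP.norm_gradient_le_of_bound hm ho hM hx) 2

/-- The inverse estimate on a cell. -/
lemma IsPiecewise.polyGrad_sq_le {v : E d → ℝ} {P : Set (E d) → MvPolynomial (Fin d) ℝ}
    (hP : IsPiecewise p 𝒯 v P) (hr : MeshReg κ h 𝒯) (hκ : 0 < κ) (hh : 0 < h) {C : ℝ} (hC : 0 < C)
    (hinv : ∀ P : MvPolynomial (Fin d) ℝ, P.totalDegree ≤ p →
      ∀ (c : E d) (r : ℝ), 0 < r → ∀ x ∈ Metric.closedBall c (κ ^ 2 * r),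
        ‖polyGrad P x‖ ^ 2 ≤ C / r ^ d * ∫ x in Metric.ball c r, ‖polyGrad P x‖ ^ 2)
    {K : Set (E d)} (hK : K ∈ cells 𝒯) {x : E d} (hx : x ∈ K) :
    ‖polyGrad (P K) x‖ ^ 2 ≤ C * κ ^ d / h ^ d * ∫ x in interior K, ‖gradient v x‖ ^ 2 := by
  obtain ⟨c, hc⟩ := hr.ball K hK
  have hr0 : 0 < h / κ := by positivity
  -- The diameter bound `κ h` equals `κ ^ 2` times the radius `h / κ` of the inscribed ball, which
  -- explains the dilation factor in `hinv`.
  have hxc : x ∈ Metric.closedBall c (κ ^ 2 * (h / κ)) := by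
    have h1 := Metric.dist_le_diam_of_mem (isCompact_of_mem_cells hK).isBounded hx
      (hc (Metric.mem_closedBall_self hr0.le))
    have h2 := hr.diam_le K hK
    rw [Metric.mem_closedBall]
    refine (h1.trans h2).trans (le_of_eq ?_)
    field_simp
  refine (hinv (P K) (hP K hK).1 c (h / κ) hr0 x hxc).trans ?_
  rw [div_pow, div_div_eq_mul_div]
  refine mul_le_mul_of_nonneg_left ?_ (by positivity)
  have hsub : Metric.ball c (h / κ) ⊆ interior K :=
    interior_maximal (Metric.ball_subset_closedBall.trans hc) Metric.isOpen_ball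
  have hcongr : ∫ x in interior K, ‖gradient v x‖ ^ 2 = ∫ x in interior K, ‖polyGrad (P K) x‖ ^ 2 :=
    setIntegral_congr_fun isOpen_interior.measurableSet fun y hy => by
      simp only [hP.gradient_eq_of_mem_interior hK hy]
  rw [hcongr]
  refine setIntegral_mono_set ?_ (ae_of_all _ fun y => by positivity) hsub.eventuallyLE
  exact (((continuous_polyGrad _).norm.pow 2).continuousOn.integrableOn_compact
    (isCompact_of_mem_cells hK)).mono_set interior_subset

/-! ### The size function -/

/-- The cells of a mesh that meet a given set. -/
def cutFinset (hm : IsMeshOf 𝒯 Ω) (S : Set (E d)) : Finset (Set (E d)) :=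
  (hm.finite_cells.subset (Set.sep_subset _ fun K => (K ∩ S).Nonempty)).toFinset

lemma mem_cutFinset {hm : IsMeshOf 𝒯 Ω} {S K : Set (E d)} :
    K ∈ cutFinset hm S ↔ K ∈ cells 𝒯 ∧ (K ∩ S).Nonempty := by
  simp [cutFinset]

lemma le_localSize (hm : IsMeshOf 𝒯 Ω) {K : Set (E d)} (hK : K ∈ cells 𝒯) {x : E d} (hx : x ∈ K) :
    Metric.diam K ≤ localSize 𝒯 x := by
  refine le_csSup ?_ ⟨K, hK, hx, rfl⟩
  refine ((hm.finite_cells.image Metric.diam).subset ?_).bddAbove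
  rintro r ⟨K, hK, -, rfl⟩
  exact ⟨K, hK, rfl⟩

lemma localSize_le (hm : IsMeshOf 𝒯 Ω) (ho : IsOpen Ω) {x : E d} (hx : x ∈ closure Ω) {a : ℝ}
    (ha : ∀ K ∈ cells 𝒯, x ∈ K → Metric.diam K ≤ a) : localSize 𝒯 x ≤ a := by
  obtain ⟨K, hK, hxK⟩ := hm.exists_cell ho hx
  refine csSup_le ⟨_, K, hK, hxK, rfl⟩ ?_
  rintro r ⟨K, hK, hxK, rfl⟩
  exact ha K hK hxK

/-- On the closure of `Ω` the local size is a maximum of finitely many functions `diam K` times the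
indicator of `K`; the zero values outside `K` do not matter, since diameters are nonnegative. -/
lemma exists_measurable_localSize (hm : IsMeshOf 𝒯 Ω) (ho : IsOpen Ω) :
    ∃ f : E d → ℝ, Measurable f ∧ ∀ x ∈ closure Ω, localSize 𝒯 x = f x := by
  classical
  by_cases hne : (hm.finite_cells.toFinset).Nonempty
  · refine ⟨fun x => hm.finite_cells.toFinset.sup' hne
      fun K => K.indicator (fun _ => Metric.diam K) x, ?_, fun x hx => le_antisymm ?_ ?_⟩
    · have := Finset.measurable_sup' hne
        (f := fun (K : Set (E d)) (x : E d) => K.indicator (fun _ => Metric.diam K) x)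
        fun K hK => measurable_const.indicator
          (isClosed_of_mem_cells (hm.finite_cells.mem_toFinset.1 hK)).measurableSet
      convert this using 1
      ext x
      simp
    · refine localSize_le hm ho hx fun K hK hxK => ?_
      refine le_trans (le_of_eq ?_) (Finset.le_sup' _ (hm.finite_cells.mem_toFinset.2 hK))
      rw [Set.indicator_of_mem hxK]
    · refine Finset.sup'_le _ _ fun K hK => ?_
      have hK' := hm.finite_cells.mem_toFinset.1 hK
      by_cases hxK : x ∈ K
      · rw [Set.indicator_of_mem hxK]
        exact le_localSize hm hK' hxK
      · rw [Set.indicator_of_notMem hxK]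
        obtain ⟨K, hK, hxK⟩ := hm.exists_cell ho hx
        exact Metric.diam_nonneg.trans (le_localSize hm hK hxK)
  · refine ⟨0, measurable_const, fun x hx => ?_⟩
    obtain ⟨K, hK, -⟩ := hm.exists_cell ho hx
    exact absurd ⟨K, hm.finite_cells.mem_toFinset.2 hK⟩ hne

namespace IsCutSetting

lemma le_localSize (H : IsCutSetting κ h Ω₀ G 𝒯₀ 𝒯G)
    {s : E d} (hs : s ∈ closure Ω₀) : h / κ ≤ localSize 𝒯₀ s := by
  obtain ⟨K, hK, hsK⟩ := H.mesh₀.exists_cell H.isOpen₀ hs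
  refine le_trans ?_ (OverlappingCutFEM.le_localSize H.mesh₀ hK hsK)
  rw [div_le_iff₀ H.κ_pos, mul_comm]
  exact H.le_diam K hK

lemma localSize_le (H : IsCutSetting κ h Ω₀ G 𝒯₀ 𝒯G)
    {s : E d} (hs : s ∈ closure Ω₀) : localSize 𝒯₀ s ≤ κ * h :=
  OverlappingCutFEM.localSize_le H.mesh₀ H.isOpen₀ hs fun K hK _ => H.reg₀.diam_le K hK

lemma isFiniteMeasure_surface (H : IsCutSetting κ h Ω₀ G 𝒯₀ 𝒯G)
    : IsFiniteMeasure ((surface d).restrict (Gam Ω₀ G)) :=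
  ⟨by rw [Measure.restrict_apply_univ]; exact H.surface_Gam_lt_top⟩

/-- Joint measurability of the average of the normal derivatives for a parametrized family. -/
lemma measurable_avgNormalDeriv (H : IsCutSetting κ h Ω₀ G 𝒯₀ 𝒯G)
    {α : Type*} [MeasurableSpace α] (v : α → Broken d)
    {P₀ PG : α → Set (E d) → MvPolynomial (Fin d) ℝ}
    (hP₀ : ∀ a, IsPiecewise p 𝒯₀ (v a).1 (P₀ a)) (hPG : ∀ a, IsPiecewise p 𝒯G (v a).2 (PG a))
    (h1 : Measurable fun z : α × E d => gradient (v z.1).1 z.2)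
    (h2 : Measurable fun z : α × E d => gradient (v z.1).2 z.2) (ω₁ ω₂ : ℝ) :
    Measurable fun z : α × E d =>
      (Gam Ω₀ G).indicator (avgNormalDeriv ω₁ ω₂ Ω₀ G (v z.1)) z.2 := by
  classical
  obtain ⟨ν, hν, hνeq⟩ := H.exists_measurable_unitNormal
  set S : Set (E d) := {s ∈ Gam Ω₀ G | ν s ≠ 0}
  have hS : MeasurableSet S :=
    isClosed_Gam.measurableSet.inter (hν (measurableSet_singleton 0).compl)
  -- The side limits exist wherever the normal is nonzero, so they can be taken along `1 / (k + 1)`.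
  -- This exhibits the average as a pointwise limit of measurable functions.
  let ε : ℕ → ℝ := fun k => 1 / ((k : ℝ) + 1)
  have hε : Tendsto ε atTop (𝓝[>] 0) :=
    tendsto_nhdsWithin_iff.2 ⟨tendsto_one_div_add_atTop_nhds_zero_nat,
      Eventually.of_forall fun k => by simp only [ε, Set.mem_Ioi]; positivity⟩
  let F : ℕ → α × E d → ℝ := fun k z => S.indicator (fun s =>
    ω₁ * inner ℝ (ν s) (gradient (v z.1).1 (s - ε k • ν s)) +
      ω₂ * inner ℝ (ν s) (gradient (v z.1).2 (s - ε k • -ν s))) z.2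
  refine measurable_of_tendsto_metrizable (f := F) (fun k => ?_) ?_
  · have hm : Measurable fun z : α × E d =>
        ω₁ * inner ℝ (ν z.2) (gradient (v z.1).1 (z.2 - ε k • ν z.2)) +
          ω₂ * inner ℝ (ν z.2) (gradient (v z.1).2 (z.2 - ε k • -ν z.2)) := by
      have hν2 : Measurable fun z : α × E d => ν z.2 := hν.comp measurable_snd
      have e1 : Measurable fun z : α × E d => (z.1, z.2 - ε k • ν z.2) :=
        by fun_prop
      have e2 : Measurable fun z : α × E d => (z.1, z.2 - ε k • -ν z.2) :=
        by fun_prop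
      exact ((hν2.inner (h1.comp e1)).const_mul _).add ((hν2.inner (h2.comp e2)).const_mul _)
    have := hm.indicator (measurable_snd hS)
    convert this using 1
    ext z
    simp only [F, Set.indicator_apply, Set.mem_preimage]
  · rw [tendsto_pi_nhds]
    rintro ⟨a, s⟩
    by_cases hs : s ∈ Gam Ω₀ G
    · rw [Set.indicator_of_mem hs]
      by_cases hν0 : ν s = 0
      · have hsS : s ∉ S := fun h => h.2 hν0
        have hz : avgNormalDeriv ω₁ ω₂ Ω₀ G (v a) s = 0 := by
          simp [avgNormalDeriv, ← hνeq s hs, hν0]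
        simp only [F, Set.indicator_of_notMem hsS, hz]
        exact tendsto_const_nhds
      · have hsS : s ∈ S := ⟨hs, hν0⟩
        have hν0' : unitNormal Ω₀ G s ≠ 0 := by rwa [← hνeq s hs]
        simp only [F, Set.indicator_of_mem hsS, avgNormalDeriv, hνeq s hs]
        obtain ⟨-, -, -, -, t1⟩ := H.sideLim_gradient_left (hP₀ a) hν0'
        obtain ⟨-, -, -, -, t2⟩ := H.sideLim_gradient_right (hPG a) hν0'
        exact (((tendsto_const_nhds.inner (t1.comp hε)).const_mul _).add
          ((tendsto_const_nhds.inner (t2.comp hε)).const_mul _))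
    · have hsS : s ∉ S := fun h => hs h.1
      simp only [F, Set.indicator_of_notMem hsS, Set.indicator_of_notMem hs]
      exact tendsto_const_nhds

lemma aestronglyMeasurable_avgNormalDeriv (H : IsCutSetting κ h Ω₀ G 𝒯₀ 𝒯G) {v : Broken d}
    {P₀ PG : Set (E d) → MvPolynomial (Fin d) ℝ}
    (hP₀ : IsPiecewise p 𝒯₀ v.1 P₀) (hPG : IsPiecewise p 𝒯G v.2 PG) (ω₁ ω₂ : ℝ) :
    AEStronglyMeasurable (avgNormalDeriv ω₁ ω₂ Ω₀ G v) ((surface d).restrict (Gam Ω₀ G)) := by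
  have hm := H.measurable_avgNormalDeriv (α := Unit) (fun _ => v) (fun _ => hP₀) (fun _ => hPG)
    ((measurable_gradient _).comp measurable_snd) ((measurable_gradient _).comp measurable_snd)
    ω₁ ω₂
  have hm2 : Measurable ((Gam Ω₀ G).indicator (avgNormalDeriv ω₁ ω₂ Ω₀ G v)) :=
    hm.comp (measurable_prodMk_left (x := ()))
  refine hm2.aestronglyMeasurable.congr ?_
  exact indicator_ae_eq_restrict isClosed_Gam.measurableSet

lemma abs_avgNormalDeriv_le_of_bound (H : IsCutSetting κ h Ω₀ G 𝒯₀ 𝒯G) {v : Broken d}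
    {P₀ PG : Set (E d) → MvPolynomial (Fin d) ℝ}
    (hP₀ : IsPiecewise p 𝒯₀ v.1 P₀) (hPG : IsPiecewise p 𝒯G v.2 PG) {ω₁ ω₂ : ℝ}
    (hω₁ : ω₁ ∈ Set.Icc (0 : ℝ) 1) (hω₂ : ω₂ ∈ Set.Icc (0 : ℝ) 1) {M₀ MG : ℝ}
    (hM₀ : ∀ K ∈ cells 𝒯₀, ∀ y ∈ K, ‖polyGrad (P₀ K) y‖ ≤ M₀)
    (hMG : ∀ K ∈ cells 𝒯G, ∀ y ∈ K, ‖polyGrad (PG K) y‖ ≤ MG) {s : E d} (hs : s ∈ Gam Ω₀ G) :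
    |avgNormalDeriv ω₁ ω₂ Ω₀ G v s| ≤ M₀ + MG := by
  obtain ⟨K, hK, hsK, K', hK', hsK', hle⟩ := H.abs_avgNormalDeriv_le hP₀ hPG hω₁ hω₂ hs
  exact hle.trans (add_le_add (hM₀ K hK s hsK) (hMG K' hK' s hsK'))

/-- Overlaps of cells are bounded. -/
lemma sum_setIntegral_le (H : IsCutSetting κ h Ω₀ G 𝒯₀ 𝒯G)
    {φ : E d → ℝ} (hφ : IntegrableOn φ (Gam Ω₀ G) (surface d))
    (h0 : ∀ s ∈ Gam Ω₀ G, 0 ≤ φ s) :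
    ∑ K ∈ cutFinset H.mesh₀ (Gam Ω₀ G), ∫ s in K ∩ Gam Ω₀ G, φ s ∂(surface d) ≤
      (κ * κ) ^ d * ∫ s in Gam Ω₀ G, φ s ∂(surface d) := by
  classical
  set F := cutFinset H.mesh₀ (Gam Ω₀ G)
  have hKm : ∀ K ∈ F, MeasurableSet K := fun K hK =>
    (isClosed_of_mem_cells (mem_cutFinset.1 hK).1).measurableSet
  have h1 : ∀ K ∈ F, ∫ s in K ∩ Gam Ω₀ G, φ s ∂(surface d) =
      ∫ s in Gam Ω₀ G, K.indicator φ s ∂(surface d) := fun K hK => by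
    rw [setIntegral_indicator (hKm K hK), Set.inter_comm]
  rw [Finset.sum_congr rfl h1, ← integral_finsetSum _ fun K hK => hφ.indicator (hKm K hK),
    ← integral_const_mul]
  refine setIntegral_mono_on (integrable_finsetSum _ fun K hK => hφ.indicator (hKm K hK))
    (hφ.const_mul _) isClosed_Gam.measurableSet fun s hs => ?_
  have h2 : ∑ K ∈ F, K.indicator φ s = ((F.filter fun K => s ∈ K).card : ℝ) * φ s := by
    rw [← nsmul_eq_mul, ← Finset.sum_const, Finset.sum_filter]
    exact Finset.sum_congr rfl fun K _ => by simp [Set.indicator_apply]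
  rw [h2]
  refine mul_le_mul_of_nonneg_right ?_ (h0 s hs)
  -- Packing with `R = 0`: a point lies in at most `(κ * κ) ^ d` cells.
  have := H.reg₀.card_le H.κ_pos H.h_pos le_rfl s (F.filter fun K => s ∈ K)
    (fun K hK => (mem_cutFinset.1 (Finset.mem_filter.1 hK).1).1)
    (fun K hK => ⟨s, (Finset.mem_filter.1 hK).2, by simp⟩)
  simpa using this

end IsCutSetting

end

section

variable {d : ℕ} {κ h : ℝ} {Ω₀ G Ω : Set (E d)} {𝒯₀ 𝒯G 𝒯 : Geometry.SimplicialComplex ℝ (E d)}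
  {p : ℕ}

/-! ### Coercivity -/

/-- The constant that bounds the surface measure of the part of the interface in a cell. -/
def surfConst (d : ℕ) (κ : ℝ) : ℝ :=
  ((κ + κ) * κ) ^ d * ((d + 1) * (κ ^ (d - 1) * (volume (Metric.ball (0 : E (d - 1)) 1)).toReal))

lemma surfConst_nonneg (hκ : 0 ≤ κ) : 0 ≤ surfConst d κ := by
  unfold surfConst; positivity

/-- The part of the squared energy norm that consists of integrals over the domains. -/
def bulkSq {d : ℕ} (Ω₀ G : Set (E d)) (𝒯₀ : Geometry.SimplicialComplex ℝ (E d)) (v : Broken d) : ℝ :=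
  (∫ x in Omega1 Ω₀ G, ‖gradient v.1 x‖ ^ 2) + (∫ x in Omega2 Ω₀ G, ‖gradient v.2 x‖ ^ 2) +
    ∫ x in OmegaO Ω₀ G 𝒯₀, ‖jumpGrad v x‖ ^ 2

lemma bulkSq_nonneg (v : Broken d) : 0 ≤ bulkSq Ω₀ G 𝒯₀ v := by
  unfold bulkSq; positivity

lemma sum_integral_interior_eq (hm : IsMeshOf 𝒯 Ω) {F : Finset (Set (E d))}
    (hF : ∀ K ∈ F, K ∈ cells 𝒯) {φ : E d → ℝ} (hφ : IntegrableOn φ (closure Ω)) :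
    ∑ K ∈ F, ∫ x in interior K, φ x = ∫ x in ⋃ K ∈ F, interior K, φ x := by
  rw [integral_biUnion_finset F (fun K _ => isOpen_interior.measurableSet)]
  · intro K hK K' hK' hne
    exact disjoint_interior_of_mem_cells (hF K hK) (hF K' hK') hne
  · exact fun K hK => hφ.mono_set (interior_subset.trans (hm.cell_subset (hF K hK)))

lemma OmegaO_subset : OmegaO Ω₀ G 𝒯₀ ⊆ Omega2 Ω₀ G :=
  Set.iUnion₂_subset fun _ _ => Set.inter_subset_right

namespace IsCutSetting

lemma measurableSet_OmegaO (H : IsCutSetting κ h Ω₀ G 𝒯₀ 𝒯G) : MeasurableSet (OmegaO Ω₀ G 𝒯₀) := by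
  refine Set.Finite.measurableSet_biUnion (H.mesh₀.finite_cells.subset (Set.sep_subset _ _))
    fun K hK => ?_
  exact (isClosed_of_mem_cells hK.1).measurableSet.inter H.isOpen_Omega2.measurableSet

/-- The gradients on the cut background cells are controlled by the bulk terms. -/
lemma sum_integral_cut₀_le (H : IsCutSetting κ h Ω₀ G 𝒯₀ 𝒯G)
    {v : Broken d} {P₀ PG : Set (E d) → MvPolynomial (Fin d) ℝ}
    (hP₀ : IsPiecewise p 𝒯₀ v.1 P₀) (hPG : IsPiecewise p 𝒯G v.2 PG) :
    ∑ K ∈ cutFinset H.mesh₀ (Gam Ω₀ G), ∫ x in interior K, ‖gradient v.1 x‖ ^ 2 ≤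
      2 * bulkSq Ω₀ G 𝒯₀ v := by
  have hi1 := hP₀.integrableOn_gradient_sq H.mesh₀ H.isOpen₀ H.isCompact_closure₀
  have hi2 := hPG.integrableOn_gradient_sq H.meshG H.isOpenG H.isCompact_closureG
  have hOG : OmegaO Ω₀ G 𝒯₀ ⊆ G := OmegaO_subset.trans H.Omega2_eq.le
  have hO₀ : OmegaO Ω₀ G 𝒯₀ ⊆ Ω₀ := hOG.trans H.subset
  have hOm := H.measurableSet_OmegaO
  rw [sum_integral_interior_eq H.mesh₀ (fun K hK => (mem_cutFinset.1 hK).1) hi1]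
  -- Up to the null boundaries, a point of a cut background cell lies in `Ω₁` or in `G`; in the
  -- second case it is in `Ω_O` by definition.
  have hsub : (⋃ K ∈ cutFinset H.mesh₀ (Gam Ω₀ G), interior K : Set (E d)) ≤ᵐ[volume]
      (Omega1 Ω₀ G ∪ OmegaO Ω₀ G 𝒯₀ : Set (E d)) := by
    have hnull : volume (frontier Ω₀ ∪ frontier G) = 0 := measure_union_null H.null₀ H.nullG
    filter_upwards [measure_eq_zero_iff_ae_notMem.1 hnull] with x hx hxU
    obtain ⟨K, hK, hxK⟩ := Set.mem_iUnion₂.1 hxU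
    have hK' := mem_cutFinset.1 hK
    have hx0 : x ∈ Ω₀ := by
      by_contra hn
      refine hx (Or.inl ?_)
      rw [H.isOpen₀.frontier_eq]
      exact ⟨H.mesh₀.cell_subset hK'.1 (interior_subset hxK), hn⟩
    by_cases hxG : x ∈ G
    · exact Or.inr (Set.mem_biUnion (show K ∈ cutCells Ω₀ G 𝒯₀ from hK')
        ⟨interior_subset hxK, hx0, hxG⟩)
    · exact Or.inl ⟨hx0, fun h => h.elim hxG fun h => hx (Or.inr h)⟩
  have h1 : ∫ x in ⋃ K ∈ cutFinset H.mesh₀ (Gam Ω₀ G), interior K, ‖gradient v.1 x‖ ^ 2 ≤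
      ∫ x in Omega1 Ω₀ G ∪ OmegaO Ω₀ G 𝒯₀, ‖gradient v.1 x‖ ^ 2 :=
    setIntegral_mono_set
      (hi1.mono_set (Set.union_subset (Omega1_subset.trans subset_closure)
        (hO₀.trans subset_closure)))
      (ae_of_all _ fun x => by positivity) hsub
  rw [setIntegral_union (disjoint_Omega1_Omega2.mono_right OmegaO_subset) hOm
    (hi1.mono_set (Omega1_subset.trans subset_closure))
    (hi1.mono_set (hO₀.trans subset_closure))] at h1
  have hi1O : IntegrableOn (fun x => ‖gradient v.1 x‖ ^ 2) (OmegaO Ω₀ G 𝒯₀) :=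
    hi1.mono_set (hO₀.trans subset_closure)
  have hi2O : IntegrableOn (fun x => ‖gradient v.2 x‖ ^ 2) (OmegaO Ω₀ G 𝒯₀) :=
    hi2.mono_set (hOG.trans subset_closure)
  -- On `Ω_O` the gradient of `v₀` is the jump plus the gradient of `v_G`. The stabilisation term of
  -- the form exists for this step.
  have hpt : ∀ a b : E d, ‖a‖ ^ 2 ≤ 2 * ‖a - b‖ ^ 2 + 2 * ‖b‖ ^ 2 := by
    intro a b
    have h3 := norm_add_le (a - b) b
    rw [sub_add_cancel] at h3
    nlinarith [sq_nonneg (‖a - b‖ - ‖b‖), norm_nonneg a, norm_nonneg (a - b), norm_nonneg b]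
  have hiJ : IntegrableOn (fun x => ‖jumpGrad v x‖ ^ 2) (OmegaO Ω₀ G 𝒯₀) := by
    refine Integrable.mono' ((hi1O.const_mul 2).add (hi2O.const_mul 2))
      ((((measurable_gradient v.1).sub (measurable_gradient v.2)).norm.pow_const
        2).aestronglyMeasurable) (ae_of_all _ fun x => ?_)
    rw [Real.norm_of_nonneg (by positivity)]
    have h3 := norm_sub_le (gradient v.1 x) (gradient v.2 x)
    simp only [Pi.add_apply, jumpGrad]
    nlinarith [sq_nonneg (‖gradient v.1 x‖ - ‖gradient v.2 x‖), norm_nonneg (gradient v.1 x),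
      norm_nonneg (gradient v.2 x), norm_nonneg (gradient v.1 x - gradient v.2 x)]
  have h2 : ∫ x in OmegaO Ω₀ G 𝒯₀, ‖gradient v.1 x‖ ^ 2 ≤
      2 * (∫ x in OmegaO Ω₀ G 𝒯₀, ‖jumpGrad v x‖ ^ 2) +
        2 * ∫ x in OmegaO Ω₀ G 𝒯₀, ‖gradient v.2 x‖ ^ 2 := by
    rw [← integral_const_mul, ← integral_const_mul,
      ← integral_add (hiJ.const_mul 2) (hi2O.const_mul 2)]
    exact setIntegral_mono hi1O ((hiJ.const_mul 2).add (hi2O.const_mul 2)) fun x => hpt _ _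
  have h3 : ∫ x in OmegaO Ω₀ G 𝒯₀, ‖gradient v.2 x‖ ^ 2 ≤
      ∫ x in Omega2 Ω₀ G, ‖gradient v.2 x‖ ^ 2 :=
    setIntegral_mono_set (hi2.mono_set (H.Omega2_eq.le.trans subset_closure))
      (ae_of_all _ fun x => by positivity) OmegaO_subset.eventuallyLE
  have h4 : 0 ≤ ∫ x in Omega1 Ω₀ G, ‖gradient v.1 x‖ ^ 2 := by positivity
  unfold bulkSq
  linarith

/-- The gradients on the cut cells of the overlapping mesh are controlled by the bulk terms. -/
lemma sum_integral_cutG_le (H : IsCutSetting κ h Ω₀ G 𝒯₀ 𝒯G)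
    {v : Broken d} {PG : Set (E d) → MvPolynomial (Fin d) ℝ}
    (hPG : IsPiecewise p 𝒯G v.2 PG) :
    ∑ K ∈ cutFinset H.meshG (Gam Ω₀ G), ∫ x in interior K, ‖gradient v.2 x‖ ^ 2 ≤
      bulkSq Ω₀ G 𝒯₀ v := by
  have hi2 := hPG.integrableOn_gradient_sq H.meshG H.isOpenG H.isCompact_closureG
  rw [sum_integral_interior_eq H.meshG (fun K hK => (mem_cutFinset.1 hK).1) hi2]
  -- No stabilisation is needed here, since cells of the overlapping mesh lie in the closure of `G`.
  have hsub : (⋃ K ∈ cutFinset H.meshG (Gam Ω₀ G), interior K : Set (E d)) ≤ᵐ[volume]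
      (Omega2 Ω₀ G : Set (E d)) := by
    filter_upwards [measure_eq_zero_iff_ae_notMem.1 H.nullG] with x hx hxU
    obtain ⟨K, hK, hxK⟩ := Set.mem_iUnion₂.1 hxU
    have hK' := mem_cutFinset.1 hK
    change x ∈ Omega2 Ω₀ G
    rw [H.Omega2_eq]
    by_contra hn
    refine hx ?_
    rw [H.isOpenG.frontier_eq]
    exact ⟨H.meshG.cell_subset hK'.1 (interior_subset hxK), hn⟩
  have h1 := setIntegral_mono_set (hi2.mono_set (H.Omega2_eq.le.trans subset_closure))
    (ae_of_all _ fun x => by positivity) hsub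
  have h2 : 0 ≤ ∫ x in Omega1 Ω₀ G, ‖gradient v.1 x‖ ^ 2 := by positivity
  have h3 : 0 ≤ ∫ x in OmegaO Ω₀ G 𝒯₀, ‖jumpGrad v x‖ ^ 2 := by positivity
  unfold bulkSq
  linarith

lemma surface_cell_le (H : IsCutSetting κ h Ω₀ G 𝒯₀ 𝒯G)
    {K : Set (E d)} {x : E d} (hx : x ∈ K) (hK : IsCompact K)
    (hd : Metric.diam K ≤ κ * h) :
    (surface d).real (K ∩ Gam Ω₀ G) ≤ surfConst d κ * h ^ (d - 1) := by
  have h0 : 0 ≤ surfConst d κ * h ^ (d - 1) :=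
    mul_nonneg (surfConst_nonneg H.κ_pos.le) (pow_nonneg H.h_pos.le _)
  refine ENNReal.toReal_le_of_le_ofReal h0 ?_
  exact H.surface_le (x := x) fun y hy => (Metric.dist_le_diam_of_mem hK.isBounded hy hx).trans hd

/-- Trace inequality: the average of the normal derivatives is controlled by the bulk terms. -/
lemma integral_avgNormalDeriv_sq_le (H : IsCutSetting κ h Ω₀ G 𝒯₀ 𝒯G)
    {v : Broken d} {P₀ PG : Set (E d) → MvPolynomial (Fin d) ℝ}
    (hP₀ : IsPiecewise p 𝒯₀ v.1 P₀) (hPG : IsPiecewise p 𝒯G v.2 PG) {ω₁ ω₂ : ℝ}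
    (hω₁ : ω₁ ∈ Set.Icc (0 : ℝ) 1) (hω₂ : ω₂ ∈ Set.Icc (0 : ℝ) 1) {C : ℝ} (hC : 0 < C)
    (hinv : ∀ P : MvPolynomial (Fin d) ℝ, P.totalDegree ≤ p →
      ∀ (c : E d) (r : ℝ), 0 < r → ∀ x ∈ Metric.closedBall c (κ ^ 2 * r),
        ‖polyGrad P x‖ ^ 2 ≤ C / r ^ d * ∫ x in Metric.ball c r, ‖polyGrad P x‖ ^ 2) :
    h * ∫ s in Gam Ω₀ G, avgNormalDeriv ω₁ ω₂ Ω₀ G v s ^ 2 ∂(surface d) ≤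
      6 * C * κ ^ d * surfConst d κ * bulkSq Ω₀ G 𝒯₀ v := by
  classical
  have hκ := H.κ_pos
  have hh := H.h_pos
  set F₀ := cutFinset H.mesh₀ (Gam Ω₀ G)
  set FG := cutFinset H.meshG (Gam Ω₀ G)
  set A : ℝ := C * κ ^ d / h ^ d with hA
  have hA0 : 0 ≤ A := by positivity
  set I₀ : Set (E d) → ℝ := fun K => ∫ x in interior K, ‖gradient v.1 x‖ ^ 2
  set IG : Set (E d) → ℝ := fun K => ∫ x in interior K, ‖gradient v.2 x‖ ^ 2
  have hI₀ : ∀ K, 0 ≤ I₀ K := fun K => by simp only [I₀]; positivity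
  have hIG : ∀ K, 0 ≤ IG K := fun K => by simp only [IG]; positivity
  -- The cells that bound the average vary with `s`. Summing over all cells that meet the interface
  -- gives a majorant, constant on each cell, without a measurable choice of cell.
  let Φ : E d → ℝ := fun s => 2 * (∑ K ∈ F₀, K.indicator (fun _ => A * I₀ K) s) +
    2 * ∑ K ∈ FG, K.indicator (fun _ => A * IG K) s
  have hpt : ∀ s ∈ Gam Ω₀ G, avgNormalDeriv ω₁ ω₂ Ω₀ G v s ^ 2 ≤ Φ s := by
    intro s hs
    obtain ⟨K, hK, hsK, K', hK', hsK', hle⟩ := H.abs_avgNormalDeriv_le hP₀ hPG hω₁ hω₂ hs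
    have b1 := hP₀.polyGrad_sq_le H.reg₀ hκ hh hC hinv hK hsK
    have b2 := hPG.polyGrad_sq_le H.regG hκ hh hC hinv hK' hsK'
    have c1 : A * I₀ K ≤ ∑ K ∈ F₀, K.indicator (fun _ => A * I₀ K) s := by
      refine le_trans (le_of_eq ?_) (Finset.single_le_sum
        (f := fun K => K.indicator (fun _ => A * I₀ K) s)
        (fun K _ => Set.indicator_nonneg (fun _ _ => mul_nonneg hA0 (hI₀ K)) s)
        (mem_cutFinset.2 ⟨hK, s, hsK, hs⟩))
      rw [Set.indicator_of_mem hsK]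
    have c2 : A * IG K' ≤ ∑ K ∈ FG, K.indicator (fun _ => A * IG K) s := by
      refine le_trans (le_of_eq ?_) (Finset.single_le_sum
        (f := fun K => K.indicator (fun _ => A * IG K) s)
        (fun K _ => Set.indicator_nonneg (fun _ _ => mul_nonneg hA0 (hIG K)) s)
        (mem_cutFinset.2 ⟨hK', s, hsK', hs⟩))
      rw [Set.indicator_of_mem hsK']
    have hsq : avgNormalDeriv ω₁ ω₂ Ω₀ G v s ^ 2 ≤
        2 * ‖polyGrad (P₀ K) s‖ ^ 2 + 2 * ‖polyGrad (PG K') s‖ ^ 2 := by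
      rw [← sq_abs]
      nlinarith [sq_nonneg (‖polyGrad (P₀ K) s‖ - ‖polyGrad (PG K') s‖),
        abs_nonneg (avgNormalDeriv ω₁ ω₂ Ω₀ G v s), norm_nonneg (polyGrad (P₀ K) s),
        norm_nonneg (polyGrad (PG K') s)]
    simp only [Φ]
    linarith
  have := H.isFiniteMeasure_surface
  have hm₀ : ∀ K ∈ F₀, MeasurableSet K := fun K hK =>
    (isClosed_of_mem_cells (mem_cutFinset.1 hK).1).measurableSet
  have hmG : ∀ K ∈ FG, MeasurableSet K := fun K hK =>
    (isClosed_of_mem_cells (mem_cutFinset.1 hK).1).measurableSet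
  have hint : ∀ F : Finset (Set (E d)), (∀ K ∈ F, MeasurableSet K) → ∀ a : Set (E d) → ℝ,
      Integrable (fun s => ∑ K ∈ F, K.indicator (fun _ => a K) s)
        ((surface d).restrict (Gam Ω₀ G)) := fun F hF a =>
    integrable_finsetSum _ fun K hK => (integrable_const _).indicator (hF K hK)
  have hval : ∀ F : Finset (Set (E d)), (∀ K ∈ F, MeasurableSet K) → ∀ a : Set (E d) → ℝ,
      ∫ s in Gam Ω₀ G, ∑ K ∈ F, K.indicator (fun _ => a K) s ∂(surface d) =
        ∑ K ∈ F, (surface d).real (K ∩ Gam Ω₀ G) * a K := fun F hF a => by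
    rw [integral_finsetSum _ fun K hK => (integrable_const _).indicator (hF K hK)]
    refine Finset.sum_congr rfl fun K hK => ?_
    rw [integral_indicator_const _ (hF K hK), measureReal_restrict_apply (hF K hK), smul_eq_mul]
  have hmono : ∫ s in Gam Ω₀ G, avgNormalDeriv ω₁ ω₂ Ω₀ G v s ^ 2 ∂(surface d) ≤
      ∫ s in Gam Ω₀ G, Φ s ∂(surface d) :=
    integral_mono_of_nonneg (ae_of_all _ fun s => sq_nonneg _)
      (((hint F₀ hm₀ _).const_mul 2).add ((hint FG hmG _).const_mul 2))
      ((ae_restrict_iff' isClosed_Gam.measurableSet).2 (ae_of_all _ hpt))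
  simp only [Φ] at hmono
  rw [integral_add ((hint F₀ hm₀ _).const_mul 2) ((hint FG hmG _).const_mul 2), integral_const_mul,
    integral_const_mul, hval F₀ hm₀, hval FG hmG] at hmono
  have hS0 := surfConst_nonneg (d := d) hκ.le
  -- Powers of `h` cancel: the weight `h`, the surface measure `h ^ (d - 1)` and the inverse
  -- estimate `h ^ (-d)`.
  have hAh : h * (surfConst d κ * h ^ (d - 1)) * A = C * κ ^ d * surfConst d κ := by
    have : h ^ d = h * h ^ (d - 1) := by
      rw [← pow_succ', Nat.sub_add_cancel H.d_pos]
    rw [hA, this]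
    field_simp
  have hb₀ : h * ∑ K ∈ F₀, (surface d).real (K ∩ Gam Ω₀ G) * (A * I₀ K) ≤
      C * κ ^ d * surfConst d κ * ∑ K ∈ F₀, I₀ K := by
    rw [Finset.mul_sum, Finset.mul_sum]
    refine Finset.sum_le_sum fun K hK => ?_
    obtain ⟨hK', s, hsK, -⟩ := mem_cutFinset.1 hK
    have := H.surface_cell_le hsK (isCompact_of_mem_cells hK') (H.reg₀.diam_le K hK')
    calc h * ((surface d).real (K ∩ Gam Ω₀ G) * (A * I₀ K))
        ≤ h * (surfConst d κ * h ^ (d - 1) * (A * I₀ K)) := by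
          refine mul_le_mul_of_nonneg_left ?_ hh.le
          exact mul_le_mul_of_nonneg_right this (mul_nonneg hA0 (hI₀ K))
      _ = h * (surfConst d κ * h ^ (d - 1)) * A * I₀ K := by ring
      _ = _ := by rw [hAh]
  have hbG : h * ∑ K ∈ FG, (surface d).real (K ∩ Gam Ω₀ G) * (A * IG K) ≤
      C * κ ^ d * surfConst d κ * ∑ K ∈ FG, IG K := by
    rw [Finset.mul_sum, Finset.mul_sum]
    refine Finset.sum_le_sum fun K hK => ?_
    obtain ⟨hK', s, hsK, -⟩ := mem_cutFinset.1 hK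
    have := H.surface_cell_le hsK (isCompact_of_mem_cells hK') (H.regG.diam_le K hK')
    calc h * ((surface d).real (K ∩ Gam Ω₀ G) * (A * IG K))
        ≤ h * (surfConst d κ * h ^ (d - 1) * (A * IG K)) := by
          refine mul_le_mul_of_nonneg_left ?_ hh.le
          exact mul_le_mul_of_nonneg_right this (mul_nonneg hA0 (hIG K))
      _ = h * (surfConst d κ * h ^ (d - 1)) * A * IG K := by ring
      _ = _ := by rw [hAh]
  have hc0 : 0 ≤ C * κ ^ d * surfConst d κ := by positivity
  -- The constant is `6 = 2 * 2 + 2 * 1`: a factor `2` from squaring a sum of two terms, then `2`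
  -- and `1` from the background and overlapping cells.
  have e₀ := mul_le_mul_of_nonneg_left (H.sum_integral_cut₀_le hP₀ hPG) hc0
  have eG := mul_le_mul_of_nonneg_left (H.sum_integral_cutG_le (v := v) hPG) hc0
  have := mul_le_mul_of_nonneg_left hmono hh.le
  nlinarith

end IsCutSetting

end

/-! ### Comparison of norms, and absorption of the consistency terms -/

section

variable {d : ℕ} {κ h : ℝ} {Ω₀ G Ω : Set (E d)} {𝒯₀ 𝒯G 𝒯 : Geometry.SimplicialComplex ℝ (E d)}
  {p : ℕ}

lemma energySq_nonneg (ω₁ ω₂ : ℝ) (v : Broken d) : 0 ≤ energySq ω₁ ω₂ Ω₀ G 𝒯₀ v := by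
  have h1 : 0 ≤ normSqNegHalf Ω₀ G 𝒯₀ (avgNormalDeriv ω₁ ω₂ Ω₀ G v) :=
    finsum_nonneg fun K => finsum_nonneg fun _ => mul_nonneg Metric.diam_nonneg (by positivity)
  have h2 : 0 ≤ normSqHalf Ω₀ G 𝒯₀ (jumpGam Ω₀ G v) :=
    finsum_nonneg fun K => finsum_nonneg fun _ =>
      mul_nonneg (inv_nonneg.2 Metric.diam_nonneg) (by positivity)
  unfold energySq
  positivity

namespace IsCutSetting

lemma finsum_cutCells (H : IsCutSetting κ h Ω₀ G 𝒯₀ 𝒯G) (f : Set (E d) → ℝ) :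
    ∑ᶠ K ∈ cutCells Ω₀ G 𝒯₀, f K = ∑ K ∈ cutFinset H.mesh₀ (Gam Ω₀ G), f K :=
  finsum_mem_eq_finite_toFinset_sum f
    (H.mesh₀.finite_cells.subset (Set.sep_subset _ fun K => (K ∩ Gam Ω₀ G).Nonempty))

/-- Cells may overlap on the interface, which costs `(κ * κ) ^ d`; replacing diameters by `h` costs
`κ`. -/
lemma normSqNegHalf_le (H : IsCutSetting κ h Ω₀ G 𝒯₀ 𝒯G) {φ : E d → ℝ}
    (hφ : IntegrableOn (fun s => φ s ^ 2) (Gam Ω₀ G) (surface d)) :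
    normSqNegHalf Ω₀ G 𝒯₀ φ ≤
      κ * (κ * κ) ^ d * (h * ∫ s in Gam Ω₀ G, φ s ^ 2 ∂(surface d)) := by
  have hκ := H.κ_pos
  have hh := H.h_pos
  rw [normSqNegHalf, H.finsum_cutCells]
  calc _ ≤ ∑ K ∈ cutFinset H.mesh₀ (Gam Ω₀ G), κ * h * ∫ s in K ∩ Gam Ω₀ G, φ s ^ 2 ∂(surface d) :=
        Finset.sum_le_sum fun K hK => mul_le_mul_of_nonneg_right
          (H.reg₀.diam_le K (mem_cutFinset.1 hK).1) (by positivity)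
    _ ≤ κ * h * ((κ * κ) ^ d * ∫ s in Gam Ω₀ G, φ s ^ 2 ∂(surface d)) := by
        rw [← Finset.mul_sum]
        exact mul_le_mul_of_nonneg_left (H.sum_setIntegral_le hφ fun s _ => sq_nonneg _)
          (by positivity)
    _ = _ := by ring

lemma normSqHalf_le (H : IsCutSetting κ h Ω₀ G 𝒯₀ 𝒯G) {φ : E d → ℝ}
    (hφ : IntegrableOn (fun s => φ s ^ 2) (Gam Ω₀ G) (surface d)) :
    normSqHalf Ω₀ G 𝒯₀ φ ≤
      κ * (κ * κ) ^ d * (h⁻¹ * ∫ s in Gam Ω₀ G, φ s ^ 2 ∂(surface d)) := by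
  have hκ := H.κ_pos
  have hh := H.h_pos
  rw [normSqHalf, H.finsum_cutCells]
  calc _ ≤ ∑ K ∈ cutFinset H.mesh₀ (Gam Ω₀ G), κ * h⁻¹ *
          ∫ s in K ∩ Gam Ω₀ G, φ s ^ 2 ∂(surface d) := by
        refine Finset.sum_le_sum fun K hK => mul_le_mul_of_nonneg_right ?_ (by positivity)
        have h1 := H.le_diam K (mem_cutFinset.1 hK).1
        have hd : 0 < Metric.diam K := by
          by_contra! hn
          nlinarith
        rw [inv_le_iff_one_le_mul₀ hd, mul_assoc, mul_comm h⁻¹, ← mul_assoc, ← div_eq_mul_inv,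
          one_le_div hh]
        exact h1
    _ ≤ κ * h⁻¹ * ((κ * κ) ^ d * ∫ s in Gam Ω₀ G, φ s ^ 2 ∂(surface d)) := by
        rw [← Finset.mul_sum]
        exact mul_le_mul_of_nonneg_left (H.sum_setIntegral_le hφ fun s _ => sq_nonneg _)
          (by positivity)
    _ = _ := by ring

lemma integrableOn_penalty (H : IsCutSetting κ h Ω₀ G 𝒯₀ 𝒯G) {J : E d → ℝ} (γ : ℝ) (hγ : 0 ≤ γ)
    (hJ : AEStronglyMeasurable J ((surface d).restrict (Gam Ω₀ G))) {M : ℝ}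
    (hM : ∀ s ∈ Gam Ω₀ G, |J s| ≤ M) :
    IntegrableOn (fun s => γ * (localSize 𝒯₀ s)⁻¹ * J s * J s) (Gam Ω₀ G) (surface d) := by
  obtain ⟨f, hf, hfeq⟩ := exists_measurable_localSize H.mesh₀ H.isOpen₀
  have hls : AEStronglyMeasurable (localSize 𝒯₀) ((surface d).restrict (Gam Ω₀ G)) := by
    refine hf.aestronglyMeasurable.congr
      ((ae_restrict_iff' isClosed_Gam.measurableSet).2 (ae_of_all _ fun s hs => ?_))
    exact (hfeq s (Gam_subset_closure hs)).symm
  have hκ := H.κ_pos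
  have hh := H.h_pos
  refine integrableOn_of_bound (M := γ * (h / κ)⁻¹ * (M * M)) isClosed_Gam.measurableSet
    H.surface_Gam_lt_top (((hls.aemeasurable.inv.const_mul γ).mul hJ.aemeasurable).mul
      hJ.aemeasurable).aestronglyMeasurable fun s hs => ?_
  have h1 := H.le_localSize (Gam_subset_closure hs)
  have h2 : 0 < h / κ := by positivity
  have h3 : (localSize 𝒯₀ s)⁻¹ ≤ (h / κ)⁻¹ := inv_anti₀ h2 h1
  have h4 : 0 ≤ (localSize 𝒯₀ s)⁻¹ := inv_nonneg.2 (h2.le.trans h1)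
  rw [mul_assoc, abs_mul, abs_of_nonneg (mul_nonneg hγ h4), abs_mul]
  have h5 := hM s hs
  exact mul_le_mul (mul_le_mul_of_nonneg_left h3 hγ)
    (mul_le_mul h5 h5 (abs_nonneg _) ((abs_nonneg _).trans h5)) (by positivity) (by positivity)

/-- Coercivity of the form in terms of the trace constant `c`. -/
lemma energySq_le_formA (H : IsCutSetting κ h Ω₀ G 𝒯₀ 𝒯G)
    {v : Broken d} (hv₁ : IsFEFunction p 𝒯₀ Ω₀ v.1)
    (hv₂ : IsFEFunction p 𝒯G G v.2) {ω₁ ω₂ γ c : ℝ}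
    (hω₁ : ω₁ ∈ Set.Icc (0 : ℝ) 1) (hω₂ : ω₂ ∈ Set.Icc (0 : ℝ) 1) (hc : 0 < c)
    (htr : h * ∫ s in Gam Ω₀ G, avgNormalDeriv ω₁ ω₂ Ω₀ G v s ^ 2 ∂(surface d) ≤
      c * bulkSq Ω₀ G 𝒯₀ v) (hγ : κ * (2 * c + 1) ≤ γ) :
    energySq ω₁ ω₂ Ω₀ G 𝒯₀ v ≤
      (2 + 2 * (κ * (κ * κ) ^ d * c) + κ * (κ * κ) ^ d) * formA ω₁ ω₂ γ Ω₀ G 𝒯₀ v v := by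
  have hκ := H.κ_pos
  have hh := H.h_pos
  have hγ0 : 0 ≤ γ := le_trans (by positivity) hγ
  obtain ⟨P₀, hP₀⟩ := hv₁.exists_isPiecewise
  obtain ⟨PG, hPG⟩ := hv₂.exists_isPiecewise
  obtain ⟨M₀, hM₀, hM₀'⟩ := H.mesh₀.exists_bound_polyGrad P₀
  obtain ⟨MG, hMG, hMG'⟩ := H.meshG.exists_bound_polyGrad PG
  set D : E d → ℝ := avgNormalDeriv ω₁ ω₂ Ω₀ G v
  set J : E d → ℝ := jumpGam Ω₀ G v
  have hΓm : MeasurableSet (Gam Ω₀ G) := isClosed_Gam.measurableSet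
  have hDm : AEStronglyMeasurable D ((surface d).restrict (Gam Ω₀ G)) :=
    H.aestronglyMeasurable_avgNormalDeriv hP₀ hPG ω₁ ω₂
  have hDb : ∀ s ∈ Gam Ω₀ G, |D s| ≤ M₀ + MG := fun s hs =>
    H.abs_avgNormalDeriv_le_of_bound hP₀ hPG hω₁ hω₂ hM₀' hMG' hs
  have hJc : ContinuousOn J (Gam Ω₀ G) := by
    refine ContinuousOn.congr (f := fun s => v.1 s - v.2 s) ?_ fun s hs =>
      H.jumpGam_eq hv₁.1 hv₂.1 hs
    exact (hv₁.1.mono Gam_subset_closure).sub (hv₂.1.mono H.Gam_subset_closureG)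
  have hJm : AEStronglyMeasurable J ((surface d).restrict (Gam Ω₀ G)) :=
    hJc.aestronglyMeasurable hΓm
  obtain ⟨MJ, hMJ⟩ := H.isCompact_Gam.exists_bound_of_continuousOn hJc
  have hprod : ∀ f g : E d → ℝ, AEStronglyMeasurable f ((surface d).restrict (Gam Ω₀ G)) →
      AEStronglyMeasurable g ((surface d).restrict (Gam Ω₀ G)) →
      ∀ a b : ℝ, (∀ s ∈ Gam Ω₀ G, |f s| ≤ a) → (∀ s ∈ Gam Ω₀ G, |g s| ≤ b) →
      IntegrableOn (fun s => f s * g s) (Gam Ω₀ G) (surface d) := fun f g hf hg a b ha hb =>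
    integrableOn_of_bound (M := a * b) hΓm H.surface_Gam_lt_top (hf.mul hg) fun s hs => by
      rw [abs_mul]
      exact mul_le_mul (ha s hs) (hb s hs) (abs_nonneg _) ((abs_nonneg _).trans (ha s hs))
  have hDD : IntegrableOn (fun s => D s ^ 2) (Gam Ω₀ G) (surface d) := by
    simpa only [sq] using hprod D D hDm hDm _ _ hDb hDb
  have hJJ : IntegrableOn (fun s => J s ^ 2) (Gam Ω₀ G) (surface d) := by
    simpa only [sq] using hprod J J hJm hJm _ _ hMJ hMJ
  have hDJ : IntegrableOn (fun s => D s * J s) (Gam Ω₀ G) (surface d) :=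
    hprod D J hDm hJm _ _ hDb hMJ
  set BD := ∫ s in Gam Ω₀ G, D s ^ 2 ∂(surface d)
  set BJ := ∫ s in Gam Ω₀ G, J s ^ 2 ∂(surface d)
  have hBJ : 0 ≤ BJ := by positivity
  have hX := bulkSq_nonneg (Ω₀ := Ω₀) (G := G) (𝒯₀ := 𝒯₀) v
  set X := bulkSq Ω₀ G 𝒯₀ v with hXdef
  -- Young's inequality with weight `h / (2 * c)`: by the trace bound the first term is at most half
  -- of the volume terms `X`.
  have hcross : 2 * ∫ s in Gam Ω₀ G, D s * J s ∂(surface d) ≤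
      h / (2 * c) * BD + 2 * c / h * BJ := by
    rw [← integral_const_mul, ← integral_const_mul, ← integral_const_mul,
      ← integral_add (hDD.const_mul _) (hJJ.const_mul _)]
    refine setIntegral_mono (hDJ.const_mul 2) ((hDD.const_mul _).add (hJJ.const_mul _)) fun s => ?_
    have h1 : 0 ≤ (h / (2 * c)) * (D s - 2 * c / h * J s) ^ 2 := by positivity
    have h2 : (h / (2 * c)) * (D s - 2 * c / h * J s) ^ 2 =
        h / (2 * c) * D s ^ 2 + 2 * c / h * J s ^ 2 - 2 * (D s * J s) := by
      field_simp
      ring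
    simp only
    linarith
  have hpen : γ / (κ * h) * BJ ≤
      ∫ s in Gam Ω₀ G, γ * (localSize 𝒯₀ s)⁻¹ * J s * J s ∂(surface d) := by
    rw [← integral_const_mul]
    refine setIntegral_mono_on (hJJ.const_mul _) (H.integrableOn_penalty γ hγ0 hJm hMJ) hΓm
      fun s hs => ?_
    have h1 := H.localSize_le (Gam_subset_closure hs)
    have h2 : 0 < localSize 𝒯₀ s :=
      lt_of_lt_of_le (by positivity) (H.le_localSize (Gam_subset_closure hs))
    have h3 : (κ * h)⁻¹ ≤ (localSize 𝒯₀ s)⁻¹ := inv_anti₀ h2 h1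
    rw [div_eq_mul_inv, sq, mul_assoc (γ * (localSize 𝒯₀ s)⁻¹)]
    exact mul_le_mul_of_nonneg_right (mul_le_mul_of_nonneg_left h3 hγ0) (mul_self_nonneg _)
  have hform : formA ω₁ ω₂ γ Ω₀ G 𝒯₀ v v = X - 2 * (∫ s in Gam Ω₀ G, D s * J s ∂(surface d)) +
      ∫ s in Gam Ω₀ G, γ * (localSize 𝒯₀ s)⁻¹ * J s * J s ∂(surface d) := by
    simp only [formA, hXdef, bulkSq, real_inner_self_eq_norm_sq, D, J]
    ring
  -- Of the penalty `(2 * c + 1) / h`, the part `2 * c / h` pays for Young's inequality and the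
  -- remaining `1 / h` controls the jump in the energy norm.
  have hgam : (2 * c + 1) / h * BJ ≤ γ / (κ * h) * BJ := by
    refine mul_le_mul_of_nonneg_right ?_ hBJ
    rw [div_le_div_iff₀ hh (by positivity)]
    nlinarith
  have hhalf : h / (2 * c) * BD ≤ X / 2 := by
    have : h / (2 * c) * BD = (h * BD) / (2 * c) := by ring
    rw [this, div_le_iff₀ (by positivity)]
    linarith
  have hlow : X / 2 + h⁻¹ * BJ ≤ formA ω₁ ω₂ γ Ω₀ G 𝒯₀ v v := by
    rw [hform]
    have : (2 * c + 1) / h * BJ = 2 * c / h * BJ + h⁻¹ * BJ := by ring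
    linarith
  have hN : 0 ≤ κ * (κ * κ) ^ d := by positivity
  have e1 := H.normSqNegHalf_le hDD
  have e2 := H.normSqHalf_le hJJ
  have e3 := mul_le_mul_of_nonneg_left htr hN
  have hup : energySq ω₁ ω₂ Ω₀ G 𝒯₀ v ≤
      X + κ * (κ * κ) ^ d * (c * X) + κ * (κ * κ) ^ d * (h⁻¹ * BJ) := by
    have : energySq ω₁ ω₂ Ω₀ G 𝒯₀ v = X + normSqNegHalf Ω₀ G 𝒯₀ D + normSqHalf Ω₀ G 𝒯₀ J := by
      simp only [energySq, hXdef, bulkSq, D, J]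
      ring
    rw [this]
    linarith
  have hJ0 : 0 ≤ h⁻¹ * BJ := by positivity
  have f1 : X ≤ 2 * formA ω₁ ω₂ γ Ω₀ G 𝒯₀ v v := by linarith
  have f2 : h⁻¹ * BJ ≤ formA ω₁ ω₂ γ Ω₀ G 𝒯₀ v v := by linarith
  have f3 : κ * (κ * κ) ^ d * (c * X) ≤
      κ * (κ * κ) ^ d * (c * (2 * formA ω₁ ω₂ γ Ω₀ G 𝒯₀ v v)) := by gcongr
  have f4 := mul_le_mul_of_nonneg_left f2 hN
  linarith

end IsCutSetting

/-- Coercivity of the form, with constants that depend only on the dimension, the polynomial degree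
and the mesh regularity. -/
lemma exists_coercivity (d p : ℕ) {κ : ℝ} (hκ : 0 < κ) :
    ∃ γ₀ C : ℝ, 0 < γ₀ ∧ 0 < C ∧ ∀ (h : ℝ) (Ω₀ G : Set (E d))
      (𝒯₀ 𝒯G : Geometry.SimplicialComplex ℝ (E d)), IsCutSetting κ h Ω₀ G 𝒯₀ 𝒯G →
      ∀ v : Broken d, IsFEFunction p 𝒯₀ Ω₀ v.1 → IsFEFunction p 𝒯G G v.2 →
      ∀ ω₁ ω₂ γ : ℝ, ω₁ ∈ Set.Icc (0 : ℝ) 1 → ω₂ ∈ Set.Icc (0 : ℝ) 1 → γ₀ ≤ γ →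
        energySq ω₁ ω₂ Ω₀ G 𝒯₀ v ≤ C * formA ω₁ ω₂ γ Ω₀ G 𝒯₀ v v := by
  -- The dilation `κ ^ 2` is the ratio of the diameter bound `κ h` to the inscribed radius `h / κ`.
  obtain ⟨A, hA, hinv⟩ := exists_sup_grad_le_L2_ball d p (κ ^ 2)
  have hS := surfConst_nonneg (d := d) hκ.le
  -- Adding `1` makes `c` positive without a lower bound on `surfConst`, as the division in Young's
  -- inequality requires.
  set c := 6 * A * κ ^ d * surfConst d κ + 1 with hc
  have hc0 : 0 < c := by positivity
  refine ⟨κ * (2 * c + 1), 2 + 2 * (κ * (κ * κ) ^ d * c) + κ * (κ * κ) ^ d, by positivity,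
    by positivity, ?_⟩
  intro h Ω₀ G 𝒯₀ 𝒯G H v hv₁ hv₂ ω₁ ω₂ γ hω₁ hω₂ hγ
  refine H.energySq_le_formA hv₁ hv₂ hω₁ hω₂ hc0 ?_ hγ
  obtain ⟨P₀, hP₀⟩ := hv₁.exists_isPiecewise
  obtain ⟨PG, hPG⟩ := hv₂.exists_isPiecewise
  refine (H.integral_avgNormalDeriv_sq_le hP₀ hPG hω₁ hω₂ hA hinv).trans ?_
  have hX := bulkSq_nonneg (Ω₀ := Ω₀) (G := G) (𝒯₀ := 𝒯₀) v
  rw [hc, add_mul, one_mul]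
  linarith

end

section

variable {d : ℕ} {κ h : ℝ} {Ω₀ G Ω : Set (E d)} {𝒯₀ 𝒯G 𝒯 : Geometry.SimplicialComplex ℝ (E d)}
  {p : ℕ}

/-! ### Finite element functions depending on time -/

lemma polyGrad_sum {ι : Type*} [Fintype ι] (a : ι → ℝ) (P : ι → MvPolynomial (Fin d) ℝ) (x : E d) :
    polyGrad (∑ j, MvPolynomial.C (a j) * P j) x = ∑ j, a j • polyGrad (P j) x := by
  ext i
  simp only [polyGrad_apply, map_sum, MvPolynomial.pderiv_C_mul, map_mul, MvPolynomial.eval_C,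
    WithLp.ofLp_sum, Finset.sum_apply, PiLp.smul_apply, smul_eq_mul]

lemma IsPiecewise.sum {ι : Type*} [Fintype ι] {c : ι → E d → ℝ}
    {P : ι → Set (E d) → MvPolynomial (Fin d) ℝ} (hP : ∀ j, IsPiecewise p 𝒯 (c j) (P j))
    (a : ι → ℝ) :
    IsPiecewise p 𝒯 (fun x => ∑ j, a j * c j x) fun K => ∑ j, MvPolynomial.C (a j) * P j K := by
  refine fun K hK => ⟨MvPolynomial.totalDegree_finsetSum_le fun j _ => ?_, fun x hx => ?_⟩
  · refine (MvPolynomial.totalDegree_mul _ _).trans ?_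
    rw [MvPolynomial.totalDegree_C, zero_add]
    exact (hP j K hK).1
  · simp only [map_sum, map_mul, MvPolynomial.eval_C]
    exact Finset.sum_congr rfl fun j _ => by rw [(hP j K hK).2 x hx]

lemma IsFEFunction.congr {v w : E d → ℝ} (hv : IsFEFunction p 𝒯 Ω v) (hm : IsMeshOf 𝒯 Ω)
    (heq : ∀ x ∈ closure Ω, w x = v x) : IsFEFunction p 𝒯 Ω w :=
  ⟨hv.1.congr heq, fun K hK => by
    obtain ⟨P, hP, h⟩ := hv.2 K hK
    exact ⟨P, hP, fun x hx => (heq x (hm.cell_subset hK hx)).trans (h x hx)⟩⟩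

lemma IsFEFunction.sum {ι : Type*} [Fintype ι] {c : ι → E d → ℝ}
    (hc : ∀ j, IsFEFunction p 𝒯 Ω (c j)) (a : ι → ℝ) :
    IsFEFunction p 𝒯 Ω fun x => ∑ j, a j * c j x := by
  refine ⟨continuousOn_finsetSum _ fun j _ => continuousOn_const.mul (hc j).1, fun K hK => ?_⟩
  choose P hP using fun j => (hc j).exists_isPiecewise
  exact ⟨_, (IsPiecewise.sum hP a) K hK⟩

/-- Values off the closure of the domain are arbitrary. Joint measurability of the gradient in time
and space is obtained for globally continuous functions, so the coefficients are first replaced by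
Tietze extensions. -/
lemma exists_continuous_extension {v : E d → ℝ} {S : Set (E d)} (hS : IsClosed S)
    (hv : ContinuousOn v S) : ∃ w : E d → ℝ, Continuous w ∧ ∀ x ∈ S, w x = v x := by
  obtain ⟨g, hg⟩ := ContinuousMap.exists_restrict_eq hS ⟨S.domRestrict v, hv.domRestrict⟩
  exact ⟨g, g.continuous, fun x hx => congrArg (fun f : C(S, ℝ) => f ⟨x, hx⟩) hg⟩

lemma measurable_gradient_with_param {f : ℝ → E d → ℝ} (hf : Continuous f.uncurry) :
    Measurable fun z : ℝ × E d => gradient (f z.1) z.2 :=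
  (InnerProductSpace.toDual ℝ (E d)).symm.continuous.measurable.comp
    (measurable_fderiv_with_param ℝ hf)

/-- Time integrability of a spatial integral of a bounded function. -/
lemma integrableOn_setIntegral {X : Type*} [MeasurableSpace X] {μ : Measure X} {S : Set X}
    (hS : MeasurableSet S) (hμ : μ S < ⊤) {f : ℝ × X → ℝ} (hf : Measurable f) {a b M : ℝ}
    {g : ℝ → X → ℝ} (hg : ∀ τ ∈ Set.Ioc a b, ∀ x ∈ S, g τ x = f (τ, x))
    (hM : ∀ τ ∈ Set.Ioc a b, ∀ x ∈ S, |g τ x| ≤ M) :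
    IntegrableOn (fun τ => ∫ x in S, g τ x ∂μ) (Set.Ioc a b) := by
  have : IsFiniteMeasure (μ.restrict S) := ⟨by rwa [Measure.restrict_apply_univ]⟩
  have hsm : StronglyMeasurable fun τ => ∫ x in S, f (τ, x) ∂μ :=
    hf.stronglyMeasurable.integral_prod_right'
  refine integrableOn_of_bound (M := M * μ.real S) measurableSet_Ioc measure_Ioc_lt_top
    (hsm.aestronglyMeasurable.congr ((ae_restrict_iff' measurableSet_Ioc).2
      (ae_of_all _ fun τ hτ => ?_))) fun τ hτ => ?_
  · exact (setIntegral_congr_fun hS (hg τ hτ)).symm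
  · rw [← Real.norm_eq_abs]
    exact norm_setIntegral_le_of_norm_le_const hμ fun x hx => hM τ hτ x hx

lemma gradient_congr {v w : E d → ℝ} (ho : IsOpen Ω) (heq : ∀ x ∈ Ω, v x = w x) {x : E d}
    (hx : x ∈ Ω) : gradient v x = gradient w x :=
  Filter.EventuallyEq.gradient_eq (Filter.mem_of_superset (ho.mem_nhds hx) heq)

namespace IsCutSetting

/-- The rays in the side limits enter the open sets `Ω₀` and `G`, where gradients depend only on
values inside. -/
lemma avgNormalDeriv_congr (H : IsCutSetting κ h Ω₀ G 𝒯₀ 𝒯G)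
    {v w : Broken d} (h1 : ∀ x ∈ Ω₀, v.1 x = w.1 x)
    (h2 : ∀ x ∈ G, v.2 x = w.2 x) (ω₁ ω₂ : ℝ) (s : E d) :
    avgNormalDeriv ω₁ ω₂ Ω₀ G v s = avgNormalDeriv ω₁ ω₂ Ω₀ G w s := by
  rcases unitNormal_spec Ω₀ G s with hν | hν
  · simp [avgNormalDeriv, hν]
  · have e1 : sideLim (gradient v.1) (unitNormal Ω₀ G s) s =
        sideLim (gradient w.1) (unitNormal Ω₀ G s) s := by
      unfold sideLim limUnder
      congr 1
      refine Filter.map_congr ?_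
      filter_upwards [hν.eventually_left] with ε hε
      exact gradient_congr H.isOpen₀ h1 (Omega1_subset hε)
    have e2 : sideLim (gradient v.2) (-unitNormal Ω₀ G s) s =
        sideLim (gradient w.2) (-unitNormal Ω₀ G s) s := by
      unfold sideLim limUnder
      congr 1
      refine Filter.map_congr ?_
      filter_upwards [hν.eventually_right] with ε hε
      exact gradient_congr H.isOpenG h2 hε.2
    simp only [avgNormalDeriv, e1, e2]

/-- On a time slab, the form `A` of a space-time finite element function is integrable. -/
lemma integrableOn_formA (H : IsCutSetting κ h Ω₀ G 𝒯₀ 𝒯G)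
    {q : ℕ} {v : ℝ → Broken d} {a b : ℝ} {c₁ c₂ : Fin (q + 1) → E d → ℝ}
    (hc₁ : ∀ j, IsFEFunction p 𝒯₀ Ω₀ (c₁ j)) (hc₂ : ∀ j, IsFEFunction p 𝒯G G (c₂ j))
    (hv₁ : ∀ τ ∈ Set.Ioc a b, ∀ x ∈ closure Ω₀, (v τ).1 x = ∑ j : Fin (q + 1), τ ^ (j : ℕ) * c₁ j x)
    (hv₂ : ∀ τ ∈ Set.Ioc a b, ∀ x ∈ closure G, (v τ).2 x = ∑ j : Fin (q + 1), τ ^ (j : ℕ) * c₂ j x)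
    {ω₁ ω₂ γ : ℝ} (hω₁ : ω₁ ∈ Set.Icc (0 : ℝ) 1) (hω₂ : ω₂ ∈ Set.Icc (0 : ℝ) 1) :
    IntegrableOn (fun τ => formA ω₁ ω₂ γ Ω₀ G 𝒯₀ (v τ) (v τ)) (Set.Ioc a b) := by
  have hκ := H.κ_pos
  have hh := H.h_pos
  choose e₁ he₁ he₁' using fun j => exists_continuous_extension isClosed_closure (hc₁ j).1
  choose e₂ he₂ he₂' using fun j => exists_continuous_extension isClosed_closure (hc₂ j).1
  choose P₁ hP₁ using fun j => ((hc₁ j).congr H.mesh₀ (he₁' j)).exists_isPiecewise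
  choose P₂ hP₂ using fun j => ((hc₂ j).congr H.meshG (he₂' j)).exists_isPiecewise
  choose M₁ hM₁ hM₁' using fun j => H.mesh₀.exists_bound_polyGrad (P₁ j)
  choose M₂ hM₂ hM₂' using fun j => H.meshG.exists_bound_polyGrad (P₂ j)
  -- This representative is continuous in time and space jointly and agrees with `v` on the
  -- closures, so every integrand over the domains or the interface can be computed from `w`.
  let w : ℝ → Broken d := fun τ =>
    (fun x => ∑ j : Fin (q + 1), τ ^ (j : ℕ) * e₁ j x,
      fun x => ∑ j : Fin (q + 1), τ ^ (j : ℕ) * e₂ j x)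
  have hw₁ : Continuous (Function.uncurry fun τ => (w τ).1) := by
    change Continuous fun z : ℝ × E d => ∑ j : Fin (q + 1), z.1 ^ (j : ℕ) * e₁ j z.2
    fun_prop
  have hw₂ : Continuous (Function.uncurry fun τ => (w τ).2) := by
    change Continuous fun z : ℝ × E d => ∑ j : Fin (q + 1), z.1 ^ (j : ℕ) * e₂ j z.2
    fun_prop
  have hg₁ := measurable_gradient_with_param hw₁
  have hg₂ := measurable_gradient_with_param hw₂
  have hpw₁ : ∀ τ, IsPiecewise p 𝒯₀ (w τ).1
      fun K => ∑ j : Fin (q + 1), MvPolynomial.C (τ ^ (j : ℕ)) * P₁ j K := fun τ =>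
    IsPiecewise.sum hP₁ fun j => τ ^ (j : ℕ)
  have hpw₂ : ∀ τ, IsPiecewise p 𝒯G (w τ).2
      fun K => ∑ j : Fin (q + 1), MvPolynomial.C (τ ^ (j : ℕ)) * P₂ j K := fun τ =>
    IsPiecewise.sum hP₂ fun j => τ ^ (j : ℕ)
  have heq₁ : ∀ τ ∈ Set.Ioc a b, ∀ x ∈ closure Ω₀, (v τ).1 x = (w τ).1 x := fun τ hτ x hx => by
    rw [hv₁ τ hτ x hx]
    exact Finset.sum_congr rfl fun j _ => by rw [he₁' j x hx]
  have heq₂ : ∀ τ ∈ Set.Ioc a b, ∀ x ∈ closure G, (v τ).2 x = (w τ).2 x := fun τ hτ x hx => by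
    rw [hv₂ τ hτ x hx]
    exact Finset.sum_congr rfl fun j _ => by rw [he₂' j x hx]
  have hfe₁ : ∀ τ ∈ Set.Ioc a b, ContinuousOn (v τ).1 (closure Ω₀) := fun τ hτ =>
    ((IsFEFunction.sum hc₁ _).congr H.mesh₀ (hv₁ τ hτ)).1
  have hfe₂ : ∀ τ ∈ Set.Ioc a b, ContinuousOn (v τ).2 (closure G) := fun τ hτ =>
    ((IsFEFunction.sum hc₂ _).congr H.meshG (hv₂ τ hτ)).1
  -- bounds
  set R := max |a| |b| with hR
  have hτR : ∀ τ ∈ Set.Ioc a b, |τ| ≤ R := fun τ hτ => abs_le_max_abs_abs hτ.1.le hτ.2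
  have hbd : ∀ (P : Fin (q + 1) → MvPolynomial (Fin d) ℝ) (M : Fin (q + 1) → ℝ) (y : E d),
      (∀ j, ‖polyGrad (P j) y‖ ≤ M j) → ∀ τ ∈ Set.Ioc a b,
      ‖polyGrad (∑ j : Fin (q + 1), MvPolynomial.C (τ ^ (j : ℕ)) * P j) y‖ ≤ ∑ j : Fin (q + 1), R ^ (j : ℕ) * M j := by
    intro P M y hM τ hτ
    rw [polyGrad_sum]
    refine (norm_sum_le _ _).trans (Finset.sum_le_sum fun j _ => ?_)
    rw [norm_smul, norm_pow, Real.norm_eq_abs]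
    exact mul_le_mul (pow_le_pow_left₀ (abs_nonneg _) (hτR τ hτ) _) (hM j) (norm_nonneg _)
      (by positivity)
  set N₁ := ∑ j : Fin (q + 1), R ^ (j : ℕ) * M₁ j
  set N₂ := ∑ j : Fin (q + 1), R ^ (j : ℕ) * M₂ j
  have hN₁ : ∀ τ ∈ Set.Ioc a b, ∀ K ∈ cells 𝒯₀, ∀ y ∈ K,
      ‖polyGrad (∑ j : Fin (q + 1), MvPolynomial.C (τ ^ (j : ℕ)) * P₁ j K) y‖ ≤ N₁ := fun τ hτ K hK y hy =>
    hbd (fun j => P₁ j K) M₁ y (fun j => hM₁' j K hK y hy) τ hτ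
  have hN₂ : ∀ τ ∈ Set.Ioc a b, ∀ K ∈ cells 𝒯G, ∀ y ∈ K,
      ‖polyGrad (∑ j : Fin (q + 1), MvPolynomial.C (τ ^ (j : ℕ)) * P₂ j K) y‖ ≤ N₂ := fun τ hτ K hK y hy =>
    hbd (fun j => P₂ j K) M₂ y (fun j => hM₂' j K hK y hy) τ hτ
  have hgb₁ : ∀ τ ∈ Set.Ioc a b, ∀ x ∈ Ω₀, ‖gradient (w τ).1 x‖ ≤ N₁ := fun τ hτ x hx =>
    (hpw₁ τ).norm_gradient_le_of_bound H.mesh₀ H.isOpen₀ (hN₁ τ hτ) (subset_closure hx)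
  have hgb₂ : ∀ τ ∈ Set.Ioc a b, ∀ x ∈ G, ‖gradient (w τ).2 x‖ ≤ N₂ := fun τ hτ x hx =>
    (hpw₂ τ).norm_gradient_le_of_bound H.meshG H.isOpenG (hN₂ τ hτ) (subset_closure hx)
  have hge₁ : ∀ τ ∈ Set.Ioc a b, ∀ x ∈ Ω₀, gradient (v τ).1 x = gradient (w τ).1 x :=
    fun τ hτ x hx => gradient_congr H.isOpen₀ (fun y hy => heq₁ τ hτ y (subset_closure hy)) hx
  have hge₂ : ∀ τ ∈ Set.Ioc a b, ∀ x ∈ G, gradient (v τ).2 x = gradient (w τ).2 x :=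
    fun τ hτ x hx => gradient_congr H.isOpenG (fun y hy => heq₂ τ hτ y (subset_closure hy)) hx
  have hvol : ∀ S ⊆ Ω₀, volume S < ⊤ := fun S hS => (H.isBounded₀.subset hS).measure_lt_top
  -- bulk terms
  have hself : ∀ (g : E d) (N : ℝ), ‖g‖ ≤ N → |inner ℝ g g| ≤ N ^ 2 := fun g N hg => by
    rw [real_inner_self_eq_norm_sq, abs_of_nonneg (by positivity)]
    exact pow_le_pow_left₀ (norm_nonneg _) hg 2
  have t1 : IntegrableOn (fun τ => ∫ x in Omega1 Ω₀ G,
      inner ℝ (gradient (v τ).1 x) (gradient (v τ).1 x)) (Set.Ioc a b) :=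
    integrableOn_setIntegral H.isOpen_Omega1.measurableSet (hvol _ Omega1_subset)
      (hg₁.inner hg₁) (fun τ hτ x hx => by rw [hge₁ τ hτ x (Omega1_subset hx)])
      (fun τ hτ x hx => hself _ N₁ (by
        rw [hge₁ τ hτ x (Omega1_subset hx)]; exact hgb₁ τ hτ x (Omega1_subset hx)))
  have t2 : IntegrableOn (fun τ => ∫ x in Omega2 Ω₀ G,
      inner ℝ (gradient (v τ).2 x) (gradient (v τ).2 x)) (Set.Ioc a b) :=
    integrableOn_setIntegral H.isOpen_Omega2.measurableSet (hvol _ Set.inter_subset_left)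
      (hg₂.inner hg₂) (fun τ hτ x hx => by rw [hge₂ τ hτ x hx.2])
      (fun τ hτ x hx => hself _ N₂ (by rw [hge₂ τ hτ x hx.2]; exact hgb₂ τ hτ x hx.2))
  have t6 : IntegrableOn (fun τ => ∫ x in OmegaO Ω₀ G 𝒯₀,
      inner ℝ (jumpGrad (v τ) x) (jumpGrad (v τ) x)) (Set.Ioc a b) :=
    integrableOn_setIntegral H.measurableSet_OmegaO
      (hvol _ (OmegaO_subset.trans Set.inter_subset_left))
      ((hg₁.sub hg₂).inner (hg₁.sub hg₂))
      (fun τ hτ x hx => by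
        have hx' := OmegaO_subset hx
        simp only [jumpGrad, Pi.sub_apply, hge₁ τ hτ x hx'.1, hge₂ τ hτ x hx'.2])
      (fun τ hτ x hx => hself _ (N₁ + N₂) (by
        have hx' := OmegaO_subset hx
        rw [jumpGrad, hge₁ τ hτ x hx'.1, hge₂ τ hτ x hx'.2]
        exact (norm_sub_le _ _).trans (add_le_add (hgb₁ τ hτ x hx'.1) (hgb₂ τ hτ x hx'.2))))
  -- interface terms
  have hD := H.measurable_avgNormalDeriv w hpw₁ hpw₂ hg₁ hg₂ ω₁ ω₂
  have hDeq : ∀ τ ∈ Set.Ioc a b, ∀ s, avgNormalDeriv ω₁ ω₂ Ω₀ G (v τ) s =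
      avgNormalDeriv ω₁ ω₂ Ω₀ G (w τ) s := fun τ hτ s =>
    H.avgNormalDeriv_congr (fun y hy => heq₁ τ hτ y (subset_closure hy))
      (fun y hy => heq₂ τ hτ y (subset_closure hy)) ω₁ ω₂ s
  have hDb : ∀ τ ∈ Set.Ioc a b, ∀ s ∈ Gam Ω₀ G, |avgNormalDeriv ω₁ ω₂ Ω₀ G (w τ) s| ≤ N₁ + N₂ :=
    fun τ hτ s hs =>
      H.abs_avgNormalDeriv_le_of_bound (hpw₁ τ) (hpw₂ τ) hω₁ hω₂ (hN₁ τ hτ) (hN₂ τ hτ) hs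
  have hJeq : ∀ τ ∈ Set.Ioc a b, ∀ s ∈ Gam Ω₀ G,
      jumpGam Ω₀ G (v τ) s = (w τ).1 s - (w τ).2 s := fun τ hτ s hs => by
    rw [H.jumpGam_eq (hfe₁ τ hτ) (hfe₂ τ hτ) hs, heq₁ τ hτ s (Gam_subset_closure hs),
      heq₂ τ hτ s (H.Gam_subset_closureG hs)]
  have hJc : Continuous fun z : ℝ × E d => (w z.1).1 z.2 - (w z.1).2 z.2 := hw₁.sub hw₂
  obtain ⟨MJ, hMJ⟩ := (isCompact_Icc.prod H.isCompact_Gam :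
    IsCompact (Set.Icc a b ×ˢ Gam Ω₀ G)).exists_bound_of_continuousOn hJc.continuousOn
  have hJb : ∀ τ ∈ Set.Ioc a b, ∀ s ∈ Gam Ω₀ G, |(w τ).1 s - (w τ).2 s| ≤ MJ := fun τ hτ s hs =>
    hMJ (τ, s) ⟨Set.Ioc_subset_Icc_self hτ, hs⟩
  have t3 : IntegrableOn (fun τ => ∫ s in Gam Ω₀ G,
      avgNormalDeriv ω₁ ω₂ Ω₀ G (v τ) s * jumpGam Ω₀ G (v τ) s ∂(surface d)) (Set.Ioc a b) :=
    integrableOn_setIntegral isClosed_Gam.measurableSet H.surface_Gam_lt_top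
      (hD.mul hJc.measurable)
      (fun τ hτ s hs => by
        simp only [Pi.mul_apply, Set.indicator_of_mem hs, hDeq τ hτ s, hJeq τ hτ s hs])
      (M := (N₁ + N₂) * MJ) (fun τ hτ s hs => by
        rw [hDeq τ hτ s, hJeq τ hτ s hs, abs_mul]
        exact mul_le_mul (hDb τ hτ s hs) (hJb τ hτ s hs) (abs_nonneg _)
          ((abs_nonneg _).trans (hDb τ hτ s hs)))
  obtain ⟨f, hf, hfeq⟩ := exists_measurable_localSize H.mesh₀ H.isOpen₀
  have t5 : IntegrableOn (fun τ => ∫ s in Gam Ω₀ G, γ * (localSize 𝒯₀ s)⁻¹ *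
      jumpGam Ω₀ G (v τ) s * jumpGam Ω₀ G (v τ) s ∂(surface d)) (Set.Ioc a b) :=
    integrableOn_setIntegral isClosed_Gam.measurableSet H.surface_Gam_lt_top
      ((((hf.comp measurable_snd).inv.const_mul γ).mul hJc.measurable).mul hJc.measurable)
      (fun τ hτ s hs => by
        simp only [Pi.mul_apply, Pi.inv_apply, Function.comp_apply, hJeq τ hτ s hs,
          hfeq s (Gam_subset_closure hs)])
      (M := |γ| * (h / κ)⁻¹ * MJ * MJ) (fun τ hτ s hs => by
        have h1 := H.le_localSize (Gam_subset_closure hs)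
        have h2 : 0 < h / κ := by positivity
        have h3 : (localSize 𝒯₀ s)⁻¹ ≤ (h / κ)⁻¹ := inv_anti₀ h2 h1
        have h4 : 0 ≤ (localSize 𝒯₀ s)⁻¹ := inv_nonneg.2 (h2.le.trans h1)
        have h5 := hJb τ hτ s hs
        have h6 := (abs_nonneg _).trans h5
        rw [hJeq τ hτ s hs, abs_mul, abs_mul, abs_mul, abs_of_nonneg h4]
        gcongr)
  unfold formA
  exact ((((t1.add t2).sub t3).sub t3).add t5).add t6

end IsCutSetting

end

section

/-! ### The space-time discretization -/

lemma HasPolygonalBoundary.volume_frontier {d : ℕ} {Ω : Set (E d)} (h : HasPolygonalBoundary Ω) :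
    volume (frontier Ω) = 0 := by
  obtain ⟨S, hS, hdim, hsub⟩ := h
  refine measure_mono_null hsub ((measure_biUnion_null_iff hS.countable).2 fun A hA => ?_)
  refine Measure.addHaar_affineSubspace _ _ fun htop => ?_
  have := hdim A hA
  rw [htop, AffineSubspace.direction_top, finrank_top, finrank_euclideanSpace_fin] at this
  omega

namespace Discretization

variable {d : ℕ} (D : Discretization d) {p q : ℕ} {u : ℝ → Broken d}

lemma t_lt_of_lt {m n : ℕ} (hmn : m < n) (hn : n ≤ D.N) : D.t m < D.t n := by
  induction n, hmn using Nat.le_induction with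
  | base => exact D.t_lt m (by omega)
  | succ k hk ih => exact (ih (by omega)).trans (D.t_lt k (by omega))

lemma t_le_of_le {m n : ℕ} (hmn : m ≤ n) (hn : n ≤ D.N) : D.t m ≤ D.t n := by
  rcases hmn.eq_or_lt with rfl | h
  · exact le_rfl
  · exact (D.t_lt_of_lt h hn).le

lemma t_pred_lt {n : ℕ} (hn : n ∈ Set.Icc 1 D.N) : D.t (n - 1) < D.t n :=
  D.t_lt_of_lt (by have := hn.1; omega) hn.2

lemma k_pos {n : ℕ} (hn : n ∈ Set.Icc 1 D.N) : 0 < D.k n := sub_pos.2 (D.t_pred_lt hn)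

lemma t_mem {n : ℕ} (hn : n ∈ Set.Icc 1 D.N) : D.t n ∈ Set.Icc 0 (D.t D.N) :=
  ⟨D.t_zero ▸ D.t_le_of_le (Nat.zero_le n) hn.2, D.t_le_of_le hn.2 le_rfl⟩

lemma eq_of_mem_I {m n : ℕ} (hm : m ∈ Set.Icc 1 D.N) (hn : n ∈ Set.Icc 1 D.N) {τ : ℝ}
    (h1 : τ ∈ D.I m) (h2 : τ ∈ D.I n) : m = n := by
  by_contra hne
  rcases Nat.lt_or_gt_of_ne hne with h | h
  · have := D.t_le_of_le (m := m) (n := n - 1) (by omega) (by have := hn.2; omega)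
    linarith [h1.2, h2.1]
  · have := D.t_le_of_le (m := n) (n := m - 1) (by omega) (by have := hm.2; omega)
    linarith [h2.2, h1.1]

/-- The slabs are disjoint, so exactly one index contributes and the geometry is frozen on each
slab. -/
lemma Gh_eq {n : ℕ} (hn : n ∈ Set.Icc 1 D.N) {τ : ℝ} (hτ : τ ∈ D.I n) :
    D.Gh τ = D.G (D.t n) := by
  ext x
  constructor
  · rintro ⟨m, hm, hτm, hx⟩
    rwa [← D.eq_of_mem_I hm hn hτm hτ]
  · exact fun hx => ⟨n, hn, hτ, hx⟩

variable {D} in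
-- Comparing the positive step `k_1` with itself suffices; this uses that there is at least one
-- slab.
lemma QuasiUniform.one_le {σ : ℝ} (hσ : D.QuasiUniform σ) : 1 ≤ σ := by
  have h1 : 1 ∈ Set.Icc 1 D.N := ⟨le_rfl, D.N_pos⟩
  have := hσ.time 1 h1 1 h1
  have hk := D.k_pos h1
  by_contra! hlt
  nlinarith

variable {D} in
-- The step `k_1` serves as the common mesh size for all slabs. Diameters are at most `σ k_1`, and
-- an inscribed radius is at least a diameter over `σ`, hence at least `k_1 / σ ^ 2`; so `σ ^ 2`
-- works as regularity constant throughout.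
lemma QuasiUniform.isCutSetting {σ : ℝ} (hσ : D.QuasiUniform σ) (hd : 0 < d) {n : ℕ}
    (hn : n ∈ Set.Icc 1 D.N) :
    IsCutSetting (σ ^ 2) (D.k 1) D.Ω₀ (D.G (D.t n)) D.𝒯₀ (D.𝒯G n) := by
  have h1 : 1 ∈ Set.Icc 1 D.N := ⟨le_rfl, D.N_pos⟩
  have hσ1 := hσ.one_le
  have hσ0 : 0 < σ := by linarith
  have hk := D.k_pos h1
  have hG := D.domain_G _ (D.t_mem hn)
  have hcell₀ : ∀ K ∈ cells D.𝒯₀, K ∈ D.allCells := fun K hK => Or.inl hK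
  have hcellG : ∀ K ∈ cells (D.𝒯G n), K ∈ D.allCells := fun K hK =>
    Or.inr (Set.mem_biUnion hn hK)
  have hreg : ∀ 𝒯 : Geometry.SimplicialComplex ℝ (E d), IsQuasiUniform σ 𝒯 →
      (∀ K ∈ cells 𝒯, K ∈ D.allCells) → MeshReg (σ ^ 2) (D.k 1) 𝒯 := by
    intro 𝒯 hq hall
    refine ⟨fun K hK => ?_, fun K hK => ?_⟩
    · have hle : σ ≤ σ ^ 2 := by nlinarith
      exact (hσ.space_le_time K (hall K hK) 1 h1).trans (mul_le_mul_of_nonneg_right hle hk.le)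
    · obtain ⟨c, r, hr, hb, hdiam⟩ := hq K hK K hK
      refine ⟨c, (Metric.closedBall_subset_closedBall ?_).trans hb⟩
      have := hσ.time_le_space K (hall K hK) 1 h1
      rw [div_le_iff₀ (by positivity)]
      nlinarith
  exact
    { d_pos := hd
      one_le := by nlinarith
      h_pos := hk
      isOpen₀ := D.domain_Ω₀.isOpen
      isBounded₀ := D.domain_Ω₀.isBounded
      isOpenG := hG.isOpen
      subset := D.G_subset _ (D.t_mem hn)
      null₀ := D.domain_Ω₀.polygonal.volume_frontier
      nullG := hG.polygonal.volume_frontier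
      mesh₀ := D.mesh₀
      meshG := D.meshG n hn
      reg₀ := hreg _ hσ.mesh₀ hcell₀
      regG := hreg _ (hσ.meshG n hn) hcellG
      le_diam := fun K hK => by
        have h2 := hσ.time_le_space K (hcell₀ K hK) 1 h1
        have h3 : 0 ≤ Metric.diam K := Metric.diam_nonneg
        nlinarith }

/-! ### Polynomials in time with values in `L²(Ω₀)` -/

/-- The functions in `L²(Ω₀)`. -/
abbrev MemL2 (φ : E d → ℝ) : Prop := MemLp φ 2 (volume.restrict D.Ω₀)

lemma ip_eq {φ ψ : E d → ℝ} (hφ : D.MemL2 φ) (hψ : D.MemL2 ψ) :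
    D.ip φ ψ = inner ℝ (hφ.toLp φ) (hψ.toLp ψ) := by
  rw [L2.inner_def]
  refine integral_congr_ae ?_
  filter_upwards [hφ.coeFn_toLp, hψ.coeFn_toLp] with x h1 h2
  rw [h1, h2]
  simp [mul_comm]

lemma normSq_eq {φ : E d → ℝ} (hφ : D.MemL2 φ) : D.normSq φ = ‖hφ.toLp φ‖ ^ 2 := by
  rw [← real_inner_self_eq_norm_sq, ← D.ip_eq hφ hφ]
  simp only [normSq, ip, sq]

/-- On the slab with index `n`, the function `u` is the polynomial in time with the coefficients
`α`. -/
def IsSlabPoly (u : ℝ → Broken d) (n : ℕ) {q : ℕ} (α : Fin (q + 1) → E d → ℝ) : Prop :=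
  (∀ j, D.MemL2 (α j)) ∧ ∀ τ ∈ D.I n, ∀ x, D.val u τ x = ∑ j : Fin (q + 1), τ ^ (j : ℕ) * α j x

lemma memL2_val {n : ℕ} (hn : n ∈ Set.Icc 1 D.N) {v : Broken d}
    (h1 : ContinuousOn v.1 (closure D.Ω₀)) (h2 : ContinuousOn v.2 (closure (D.G (D.t n)))) :
    D.MemL2 (v.val D.Ω₀ (D.G (D.t n))) := by
  classical
  have hG := D.domain_G _ (D.t_mem hn)
  have hb := D.domain_Ω₀.isBounded
  have hsub := D.G_subset _ (D.t_mem hn)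
  have : IsFiniteMeasure (volume.restrict D.Ω₀) :=
    ⟨by rw [Measure.restrict_apply_univ]; exact hb.measure_lt_top⟩
  obtain ⟨M₁, hM₁⟩ := hb.isCompact_closure.exists_bound_of_continuousOn h1
  obtain ⟨M₂, hM₂⟩ := (hb.subset hsub).isCompact_closure.exists_bound_of_continuousOn h2
  have hO1 : IsOpen (Omega1 D.Ω₀ (D.G (D.t n))) := by
    rw [Omega1_eq]; exact D.domain_Ω₀.isOpen.sdiff isClosed_closure
  have hO2 : IsOpen (Omega2 D.Ω₀ (D.G (D.t n))) := D.domain_Ω₀.isOpen.inter hG.isOpen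
  have heq : v.val D.Ω₀ (D.G (D.t n)) = (Omega1 D.Ω₀ (D.G (D.t n))).indicator v.1 +
      (Omega2 D.Ω₀ (D.G (D.t n))).indicator v.2 := by
    ext x
    simp only [Broken.val, Pi.add_apply, Set.indicator_apply]
    by_cases hx : x ∈ Omega1 D.Ω₀ (D.G (D.t n))
    · simp [hx, Set.disjoint_left.1 disjoint_Omega1_Omega2 hx]
    · simp [hx]
  have hm1 : AEStronglyMeasurable ((Omega1 D.Ω₀ (D.G (D.t n))).indicator v.1)
      (volume.restrict D.Ω₀) := by
    rw [aestronglyMeasurable_indicator_iff hO1.measurableSet]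
    exact ((h1.mono (Omega1_subset.trans subset_closure)).aestronglyMeasurable
      hO1.measurableSet (μ := volume.restrict D.Ω₀))
  have hm2 : AEStronglyMeasurable ((Omega2 D.Ω₀ (D.G (D.t n))).indicator v.2)
      (volume.restrict D.Ω₀) := by
    rw [aestronglyMeasurable_indicator_iff hO2.measurableSet]
    exact ((h2.mono (Set.inter_subset_right.trans subset_closure)).aestronglyMeasurable
      hO2.measurableSet (μ := volume.restrict D.Ω₀))
  rw [heq]
  refine MemLp.add ?_ ?_
  · refine MemLp.of_bound hm1 |M₁| (ae_of_all _ fun x => ?_)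
    by_cases hx : x ∈ Omega1 D.Ω₀ (D.G (D.t n))
    · simp only [Set.indicator_of_mem hx]
      exact (hM₁ x (subset_closure (Omega1_subset hx))).trans (le_abs_self _)
    · simp [Set.indicator_of_notMem hx]
  · refine MemLp.of_bound hm2 |M₂| (ae_of_all _ fun x => ?_)
    by_cases hx : x ∈ Omega2 D.Ω₀ (D.G (D.t n))
    · simp only [Set.indicator_of_mem hx]
      exact (hM₂ x (subset_closure hx.2)).trans (le_abs_self _)
    · simp [Set.indicator_of_notMem hx]

/-- With `G` frozen, passing from a pair to its broken function is linear, so the two time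
expansions merge into one. The value `0` off `Ω₁ ∪ Ω₂` is consistent with this. -/
lemma exists_isSlabPoly (hu : D.IsVh p q u) {n : ℕ} (hn : n ∈ Set.Icc 1 D.N) :
    ∃ α : Fin (q + 1) → E d → ℝ, D.IsSlabPoly u n α := by
  classical
  obtain ⟨⟨c₁, hc₁, h1⟩, ⟨c₂, hc₂, h2⟩⟩ := hu n hn
  refine ⟨fun j => Broken.val D.Ω₀ (D.G (D.t n)) (c₁ j, c₂ j),
    fun j => D.memL2_val hn (hc₁ j).1.1 (hc₂ j).1, fun τ hτ x => ?_⟩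
  rw [val, D.Gh_eq hn hτ]
  simp only [Broken.val]
  split_ifs with hx1 hx2
  · exact h1 τ hτ x (subset_closure (Omega1_subset hx1))
  · exact h2 τ hτ x (subset_closure hx2.2)
  · simp

/-- A polynomial in time with coefficients `α`. -/
def slab {q : ℕ} (α : Fin (q + 1) → E d → ℝ) (τ : ℝ) (x : E d) : ℝ :=
  ∑ j : Fin (q + 1), τ ^ (j : ℕ) * α j x

/-- The time derivative of `slab α`. -/
def slabDeriv {q : ℕ} (α : Fin (q + 1) → E d → ℝ) (τ : ℝ) (x : E d) : ℝ :=
  ∑ j : Fin (q + 1), ((j : ℕ) * τ ^ ((j : ℕ) - 1)) * α j x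

variable {D} in
lemma memL2_sum {α : Fin (q + 1) → E d → ℝ} (hα : ∀ j, D.MemL2 (α j)) (a : Fin (q + 1) → ℝ) :
    D.MemL2 fun x => ∑ j, a j * α j x :=
  memLp_finsetSum _ fun j _ => (hα j).const_mul (a j)

variable {D} in
-- This turns the slab function into a polynomial curve in the Hilbert space `L²(Ω₀)`, so that its
-- norm is differentiated by Hilbert space calculus and not under the integral sign.
lemma toLp_sum {α : Fin (q + 1) → E d → ℝ} (hα : ∀ j, D.MemL2 (α j)) (a : Fin (q + 1) → ℝ) :
    (memL2_sum hα a).toLp _ = ∑ j, a j • (hα j).toLp (α j) := by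
  refine Lp.ext ?_
  have h1 : ∀ᵐ x ∂(volume.restrict D.Ω₀), ∀ j, (hα j).toLp (α j) x = α j x :=
    ae_all_iff.2 fun j => (hα j).coeFn_toLp
  have h2 : ∀ᵐ x ∂(volume.restrict D.Ω₀), ∀ j,
      (a j • (hα j).toLp (α j) : Lp ℝ 2 (volume.restrict D.Ω₀)) x = a j * (hα j).toLp (α j) x :=
    ae_all_iff.2 fun j => Lp.coeFn_smul _ _
  filter_upwards [(memL2_sum hα a).coeFn_toLp, h1, h2,
    Lp.coeFn_finsetSum Finset.univ fun j => a j • (hα j).toLp (α j)] with x e1 e2 e3 e4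
  rw [e1, e4]
  simp only [Finset.sum_apply]
  exact Finset.sum_congr rfl fun j _ => by rw [e3 j, e2 j]

variable {D} in
lemma memL2_slab {α : Fin (q + 1) → E d → ℝ} (hα : ∀ j, D.MemL2 (α j)) (τ : ℝ) :
    D.MemL2 (slab α τ) := memL2_sum hα fun j => τ ^ (j : ℕ)

variable {D} in
lemma memL2_slabDeriv {α : Fin (q + 1) → E d → ℝ} (hα : ∀ j, D.MemL2 (α j)) (τ : ℝ) :
    D.MemL2 (slabDeriv α τ) := memL2_sum hα fun j => (j : ℕ) * τ ^ ((j : ℕ) - 1)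

variable {D} in
lemma hasDerivAt_normSq_slab {α : Fin (q + 1) → E d → ℝ} (hα : ∀ j, D.MemL2 (α j)) (τ : ℝ) :
    HasDerivAt (fun τ => D.normSq (slab α τ)) (2 * D.ip (slabDeriv α τ) (slab α τ)) τ := by
  have h1 : ∀ τ, D.normSq (slab α τ) = ‖∑ j : Fin (q + 1), τ ^ (j : ℕ) • (hα j).toLp (α j)‖ ^ 2 :=
    fun τ => by rw [D.normSq_eq (memL2_slab hα τ)]; exact congrArg (‖·‖ ^ 2) (toLp_sum hα _)
  have h2 : HasDerivAt (fun τ : ℝ => ∑ j : Fin (q + 1), τ ^ (j : ℕ) • (hα j).toLp (α j))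
      (∑ j : Fin (q + 1), ((j : ℕ) * τ ^ ((j : ℕ) - 1)) • (hα j).toLp (α j)) τ :=
    HasDerivAt.fun_sum fun j _ => (hasDerivAt_pow _ τ).smul_const _
  have h3 := h2.norm_sq
  simp_rw [h1]
  convert h3 using 2
  rw [D.ip_eq (memL2_slabDeriv hα τ) (memL2_slab hα τ), real_inner_comm]
  congr 1
  · exact toLp_sum hα _
  · exact toLp_sum hα _

variable {D} in
lemma continuous_ip_slab {α : Fin (q + 1) → E d → ℝ} (hα : ∀ j, D.MemL2 (α j)) :
    Continuous fun τ => D.ip (slabDeriv α τ) (slab α τ) := by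
  have h1 : ∀ τ, D.ip (slabDeriv α τ) (slab α τ) =
      inner ℝ (∑ j : Fin (q + 1), ((j : ℕ) * τ ^ ((j : ℕ) - 1)) • (hα j).toLp (α j))
        (∑ j : Fin (q + 1), τ ^ (j : ℕ) • (hα j).toLp (α j)) := fun τ => by
    rw [D.ip_eq (memL2_slabDeriv hα τ) (memL2_slab hα τ)]
    congr 1
    · exact toLp_sum hα _
    · exact toLp_sum hα _
  simp_rw [h1]
  fun_prop

/-! ### One-sided limits and the energy balance on one slab -/

section Slab

variable {D} {n : ℕ} {α : Fin (q + 1) → E d → ℝ}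

lemma IsSlabPoly.minus_eq (hα : D.IsSlabPoly u n α)
    (hn : n ∈ Set.Icc 1 D.N) : D.minus u n = slab α (D.t n) := by
  ext x
  refine Tendsto.limUnder_eq ?_
  have hc : Continuous fun ε : ℝ => slab α (D.t n - ε) x := by unfold slab; fun_prop
  have h0 := hc.tendsto 0
  rw [sub_zero] at h0
  refine Tendsto.congr' ?_ (h0.mono_left nhdsWithin_le_nhds)
  filter_upwards [Ioo_mem_nhdsGT (D.k_pos hn)] with ε hε
  refine (hα.2 _ ⟨?_, ?_⟩ x).symm
  · have := hε.2; unfold k at this; linarith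
  · linarith [hε.1]

/-- The limit from the right at `t_{n-1}` is taken inside slab `n`, which explains the index shift.
-/
lemma IsSlabPoly.plus_eq (hα : D.IsSlabPoly u n α)
    (hn : n ∈ Set.Icc 1 D.N) : D.plus u (n - 1) = slab α (D.t (n - 1)) := by
  ext x
  refine Tendsto.limUnder_eq ?_
  have hc : Continuous fun ε : ℝ => slab α (D.t (n - 1) + ε) x := by unfold slab; fun_prop
  have h0 := hc.tendsto 0
  rw [add_zero] at h0
  refine Tendsto.congr' ?_ (h0.mono_left nhdsWithin_le_nhds)
  filter_upwards [Ioo_mem_nhdsGT (D.k_pos hn)] with ε hε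
  refine (hα.2 _ ⟨?_, ?_⟩ x).symm
  · linarith [hε.1]
  · have := hε.2; unfold k at this; linarith

lemma IsSlabPoly.val_eq (hα : D.IsSlabPoly u n α) {τ : ℝ} (hτ : τ ∈ D.I n) :
    D.val u τ = slab α τ :=
  funext (hα.2 τ hτ)

lemma IsSlabPoly.deriv_eq (hα : D.IsSlabPoly u n α)
    {τ : ℝ} (hτ : τ ∈ Set.Ioo (D.t (n - 1)) (D.t n)) (x : E d) :
    deriv (fun r => D.val u r x) τ = slabDeriv α τ x := by
  have he : (fun r => D.val u r x) =ᶠ[𝓝 τ] fun r => slab α r x :=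
    Filter.mem_of_superset (isOpen_Ioo.mem_nhds hτ) fun r hr => hα.2 r ⟨hr.1, hr.2.le⟩ x
  rw [he.deriv_eq]
  exact (HasDerivAt.fun_sum fun j _ => (hasDerivAt_pow _ τ).mul_const _).deriv

/-- The endpoint `t_n` belongs to the slab, but `deriv` there also sees times beyond it; one point
is discarded. -/
lemma IsSlabPoly.ae_ip_eq (hα : D.IsSlabPoly u n α) : ∀ᵐ τ ∂(volume.restrict (D.I n)),
    D.ip (fun x => deriv (fun r => D.val u r x) τ) (D.val u τ) =
      D.ip (slabDeriv α τ) (slab α τ) := by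
  have hne : ∀ᵐ τ ∂(volume.restrict (D.I n)), τ ≠ D.t n :=
    ae_restrict_of_ae (Measure.ae_ne volume (D.t n))
  filter_upwards [ae_restrict_mem measurableSet_Ioc, hne] with τ hτ hτn
  rw [hα.val_eq hτ, funext (hα.deriv_eq ⟨hτ.1, lt_of_le_of_ne hτ.2 hτn⟩)]

/-- The pairing is half the time derivative of the squared norm, so the fundamental theorem of
calculus applies to the polynomial representative, which is smooth up to both ends. -/
lemma IsSlabPoly.integral_eq (hα : D.IsSlabPoly u n α)
    (hn : n ∈ Set.Icc 1 D.N) {f : ℝ → ℝ} (hf : IntegrableOn f (D.I n)) :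
    ∫ τ in D.I n, (D.ip (fun x => deriv (fun r => D.val u r x) τ) (D.val u τ) + f τ) =
      (D.normSq (D.minus u n) - D.normSq (D.plus u (n - 1))) / 2 + ∫ τ in D.I n, f τ := by
  have hci : IntegrableOn (fun τ => D.ip (slabDeriv α τ) (slab α τ)) (D.I n) :=
    ((continuous_ip_slab hα.1).continuousOn.integrableOn_Icc).mono_set Set.Ioc_subset_Icc_self
  have h1 : ∫ τ in D.I n, (D.ip (fun x => deriv (fun r => D.val u r x) τ) (D.val u τ) + f τ) =
      ∫ τ in D.I n, (D.ip (slabDeriv α τ) (slab α τ) + f τ) := by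
    refine integral_congr_ae ?_
    filter_upwards [hα.ae_ip_eq] with τ hτ
    rw [hτ]
  rw [h1, integral_add hci hf, hα.minus_eq hn, hα.plus_eq hn]
  congr 1
  have h2 := intervalIntegral.integral_eq_sub_of_hasDerivAt (a := D.t (n - 1)) (b := D.t n)
    (fun τ _ => hasDerivAt_normSq_slab hα.1 τ)
    ((continuous_const.mul (continuous_ip_slab hα.1)).intervalIntegrable _ _)
  rw [intervalIntegral.integral_of_le (D.t_pred_lt hn).le, integral_const_mul] at h2
  change ∫ τ in Set.Ioc _ _, _ = _
  linarith

lemma IsSlabPoly.memL2_minus (hα : D.IsSlabPoly u n α)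
    (hn : n ∈ Set.Icc 1 D.N) : D.MemL2 (D.minus u n) := by
  rw [hα.minus_eq hn]; exact memL2_slab hα.1 _

lemma IsSlabPoly.memL2_plus (hα : D.IsSlabPoly u n α)
    (hn : n ∈ Set.Icc 1 D.N) : D.MemL2 (D.plus u (n - 1)) := by
  rw [hα.plus_eq hn]; exact memL2_slab hα.1 _

end Slab

end Discretization

end

section

/-! ### The stability estimate -/

/-- Here `M`, `P` and `J` stand for the squared norms of `u_n^-`, `u_n^+` and `[u]_n`. Interior
values cancel between the slab and jump terms. -/
lemma sum_telescope (M P J : ℕ → ℝ) (K : ℕ) :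
    ∑ n ∈ Finset.Icc 1 (K + 1), (M n - P (n - 1)) / 2 +
      ∑ n ∈ Finset.Icc 1 K, (P n - M n + J n) / 2 =
      M (K + 1) / 2 - P 0 / 2 + ∑ n ∈ Finset.Icc 1 K, J n / 2 := by
  induction K with
  | zero => simp; ring
  | succ K ih =>
    rw [Finset.sum_Icc_succ_top (by omega : 1 ≤ K + 1 + 1),
      Finset.sum_Icc_succ_top (by omega : 1 ≤ K + 1) fun n => (P n - M n + J n) / 2,
      Finset.sum_Icc_succ_top (by omega : 1 ≤ K + 1) fun n => J n / 2, Nat.add_sub_cancel]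
    linarith

namespace Discretization

variable {d : ℕ} (D : Discretization d) {p q : ℕ} {u : ℝ → Broken d}

lemma ip_sub_self {φ ψ : E d → ℝ} (hφ : D.MemL2 φ) (hψ : D.MemL2 ψ) :
    D.ip (fun x => φ x - ψ x) φ =
      (D.normSq φ - D.normSq ψ + D.normSq fun x => φ x - ψ x) / 2 := by
  have hs : D.MemL2 fun x => φ x - ψ x := hφ.sub hψ
  have he : hs.toLp _ = hφ.toLp φ - hψ.toLp ψ := MemLp.toLp_sub hφ hψ
  rw [D.ip_eq hs hφ, D.normSq_eq hφ, D.normSq_eq hψ, D.normSq_eq hs, he, norm_sub_sq_real,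
    inner_sub_left, real_inner_self_eq_norm_sq, real_inner_comm]
  ring

/-- Used for the data term: it turns `(u₀, u_0^+)` into squares and so produces the initial jump
`[u]_0` in the energy identity. -/
lemma ip_eq_half {φ ψ : E d → ℝ} (hφ : D.MemL2 φ) (hψ : D.MemL2 ψ) :
    D.ip ψ φ = (D.normSq φ + D.normSq ψ - D.normSq fun x => φ x - ψ x) / 2 := by
  have hs : D.MemL2 fun x => φ x - ψ x := hφ.sub hψ
  have he : hs.toLp _ = hφ.toLp φ - hψ.toLp ψ := MemLp.toLp_sub hφ hψ
  rw [D.ip_eq hψ hφ, D.normSq_eq hφ, D.normSq_eq hψ, D.normSq_eq hs, he, norm_sub_sq_real,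
    real_inner_comm]
  ring

/-- The time integral of `A_n(u, u)` over the slab with index `n`. -/
def slabEnergy (ω₁ ω₂ γ : ℝ) (u : ℝ → Broken d) (n : ℕ) : ℝ :=
  ∫ τ in D.I n, formA ω₁ ω₂ γ D.Ω₀ (D.G (D.t n)) D.𝒯₀ (u τ) (u τ)

variable {D} in
lemma QuasiUniform.integrableOn_formA {σ : ℝ} (hσ : D.QuasiUniform σ) (hd : 0 < d)
    (hu : D.IsVh p q u) {ω₁ ω₂ γ : ℝ} (hω₁ : ω₁ ∈ Set.Icc (0 : ℝ) 1)
    (hω₂ : ω₂ ∈ Set.Icc (0 : ℝ) 1) {n : ℕ} (hn : n ∈ Set.Icc 1 D.N) :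
    IntegrableOn (fun τ => formA ω₁ ω₂ γ D.Ω₀ (D.G (D.t n)) D.𝒯₀ (u τ) (u τ)) (D.I n) := by
  obtain ⟨⟨c₁, hc₁, h1⟩, ⟨c₂, hc₂, h2⟩⟩ := hu n hn
  exact (hσ.isCutSetting hd hn).integrableOn_formA (fun j => (hc₁ j).1) hc₂ h1 h2 hω₁ hω₂

/-- The energy identity for `B_h(u, u)`. -/
lemma B_self {ω₁ ω₂ γ : ℝ} (hu : D.IsVh p q u)
    (hint : ∀ n ∈ Set.Icc 1 D.N, IntegrableOn
      (fun τ => formA ω₁ ω₂ γ D.Ω₀ (D.G (D.t n)) D.𝒯₀ (u τ) (u τ)) (D.I n)) :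
    D.B ω₁ ω₂ γ u u = D.normSq (D.minus u D.N) / 2 + D.normSq (D.plus u 0) / 2 +
      (∑ n ∈ Finset.Icc 1 (D.N - 1), D.normSq (D.jump u n) / 2) +
      ∑ n ∈ Finset.Icc 1 D.N, D.slabEnergy ω₁ ω₂ γ u n := by
  have hN := D.N_pos
  have hA : ∀ n ∈ Finset.Icc 1 D.N, ∫ τ in D.I n,
      (D.ip (fun x => deriv (fun r => D.val u r x) τ) (D.val u τ) + D.A ω₁ ω₂ γ τ (u τ) (u τ)) =
      (D.normSq (D.minus u n) - D.normSq (D.plus u (n - 1))) / 2 + D.slabEnergy ω₁ ω₂ γ u n := by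
    intro n hn
    rw [Finset.mem_Icc] at hn
    obtain ⟨α, hα⟩ := D.exists_isSlabPoly hu hn
    rw [slabEnergy, ← hα.integral_eq hn (hint n hn)]
    refine setIntegral_congr_fun measurableSet_Ioc fun τ hτ => ?_
    simp only [A, D.Gh_eq hn hτ]
  have hJ : ∀ n ∈ Finset.Icc 1 (D.N - 1), D.ip (D.jump u n) (D.plus u n) =
      (D.normSq (D.plus u n) - D.normSq (D.minus u n) + D.normSq (D.jump u n)) / 2 := by
    intro n hn
    rw [Finset.mem_Icc] at hn
    have hn1 : n ∈ Set.Icc 1 D.N := ⟨hn.1, by omega⟩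
    have hn2 : n + 1 ∈ Set.Icc 1 D.N := ⟨by omega, by omega⟩
    obtain ⟨α, hα⟩ := D.exists_isSlabPoly hu hn1
    obtain ⟨β, hβ⟩ := D.exists_isSlabPoly hu hn2
    exact D.ip_sub_self (hβ.memL2_plus hn2) (hα.memL2_minus hn1)
  have hP : D.ip (D.plus u 0) (D.plus u 0) = D.normSq (D.plus u 0) := by
    simp only [ip, normSq, sq]
  rw [B, Finset.sum_congr rfl hA, Finset.sum_congr rfl hJ, hP, Finset.sum_add_distrib]
  have ht := sum_telescope (fun n => D.normSq (D.minus u n)) (fun n => D.normSq (D.plus u n))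
    (fun n => D.normSq (D.jump u n)) (D.N - 1)
  rw [Nat.sub_add_cancel hN] at ht
  linarith

variable {D} in
/-- The energy identity for the solution of the homogeneous problem. -/
lemma IsSolution.energy_identity {ω₁ ω₂ γ : ℝ} {u₀ : E d → ℝ} (hu₀ : D.MemL2 u₀)
    (hu : D.IsSolution p q ω₁ ω₂ γ (fun _ _ => 0) u₀ u)
    (hint : ∀ n ∈ Set.Icc 1 D.N, IntegrableOn
      (fun τ => formA ω₁ ω₂ γ D.Ω₀ (D.G (D.t n)) D.𝒯₀ (u τ) (u τ)) (D.I n)) :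
    D.normSq (D.minus u D.N) + (∑ n ∈ Finset.Icc 1 D.N, D.normSq (D.jumpFrom u₀ u (n - 1))) +
      2 * ∑ n ∈ Finset.Icc 1 D.N, D.slabEnergy ω₁ ω₂ γ u n = D.normSq u₀ := by
  have h1 : 1 ∈ Set.Icc 1 D.N := ⟨le_rfl, D.N_pos⟩
  obtain ⟨α, hα⟩ := D.exists_isSlabPoly hu.1 h1
  -- The solution is itself an admissible test function.
  have hB := hu.2 u hu.1
  rw [D.B_self hu.1 hint, D.ip_eq_half (hα.memL2_plus h1) hu₀] at hB
  have h0 : ∫ τ in Set.Ioc 0 D.T, D.ip (fun _ => 0) (D.val u τ) = 0 := by simp [ip]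
  rw [h0] at hB
  have hsum : ∑ n ∈ Finset.Icc 1 D.N, D.normSq (D.jumpFrom u₀ u (n - 1)) =
      D.normSq (fun x => D.plus u 0 x - u₀ x) +
        ∑ n ∈ Finset.Icc 1 (D.N - 1), D.normSq (D.jump u n) := by
    -- The term `n = 1` is split off: its index `n - 1 = 0` is where `jumpFrom` compares with `u₀`.
    rw [← Finset.sum_Ioc_add_eq_sum_Icc D.N_pos, add_comm]
    congr 1
    refine Finset.sum_nbij' (fun n => n - 1) (fun n => n + 1) ?_ ?_ ?_ ?_ ?_
    · intro n hn; rw [Finset.mem_Ioc] at hn; rw [Finset.mem_Icc]; omega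
    · intro n hn; rw [Finset.mem_Icc] at hn; rw [Finset.mem_Ioc]; omega
    · intro n hn; rw [Finset.mem_Ioc] at hn; omega
    · intro n _; omega
    · intro n hn
      rw [Finset.mem_Ioc] at hn
      congr 1
      ext x
      rw [jumpFrom, if_neg (by omega)]
  rw [hsum]
  rw [← Finset.sum_div] at hB
  linarith

variable {D} in
lemma IsVh.isFEFunction (hu : D.IsVh p q u) {n : ℕ} (hn : n ∈ Set.Icc 1 D.N) {τ : ℝ}
    (hτ : τ ∈ D.I n) :
    IsFEFunction p D.𝒯₀ D.Ω₀ (u τ).1 ∧ IsFEFunction p (D.𝒯G n) (D.G (D.t n)) (u τ).2 := by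
  obtain ⟨⟨c₁, hc₁, h1⟩, ⟨c₂, hc₂, h2⟩⟩ := hu n hn
  exact ⟨(IsFEFunction.sum (fun j => (hc₁ j).1) _).congr D.mesh₀ (h1 τ hτ),
    (IsFEFunction.sum hc₂ _).congr (D.meshG n hn) (h2 τ hτ)⟩

lemma normSq_nonneg (φ : E d → ℝ) : 0 ≤ D.normSq φ := integral_nonneg fun _ => sq_nonneg _

end Discretization

end

end OverlappingCutFEM

end

/-! ### Assembly of the stability estimate -/

theorem lemma5p3 (d : ℕ) (hd : d = 1 ∨ d = 2 ∨ d = 3) (p : ℕ) (σ : ℝ) :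
    ∃ γ₀ C : ℝ, 0 < γ₀ ∧ 0 < C ∧
      ∀ D : OverlappingCutFEM.Discretization d, D.QuasiUniform σ →
      ∀ (q : ℕ) (ω₁ ω₂ γ : ℝ), ω₁ ∈ Set.Icc (0 : ℝ) 1 → ω₂ ∈ Set.Icc (0 : ℝ) 1 → ω₁ + ω₂ = 1 →
      γ₀ ≤ γ →
      ∀ u₀ : OverlappingCutFEM.E d → ℝ,
        MeasureTheory.MemLp u₀ 2 (MeasureTheory.volume.restrict D.Ω₀) →
      ∀ u : ℝ → OverlappingCutFEM.Broken d,
        D.IsSolution p q ω₁ ω₂ γ (fun _ _ => 0) u₀ u →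
        D.normSq (D.minus u D.N) +
          (∑ n ∈ Finset.Icc 1 D.N, ∫ τ in D.I n,
            OverlappingCutFEM.energySq ω₁ ω₂ D.Ω₀ (D.G (D.t n)) D.𝒯₀ (u τ)) +
          (∑ n ∈ Finset.Icc 1 D.N, D.normSq (D.jumpFrom u₀ u (n - 1)))
        ≤ C * D.normSq u₀ := by
  -- The constants must be fixed before a discretization is given, when `1 ≤ σ` is not yet known;
  -- the maximum equals `σ` as soon as one is.
  obtain ⟨γ₀, C, hγ₀, hC, H⟩ :=
    OverlappingCutFEM.exists_coercivity d p (κ := max σ 1 ^ 2) (by positivity)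
  refine ⟨γ₀, 1 + C, hγ₀, by positivity, ?_⟩
  intro D hσ q ω₁ ω₂ γ hω₁ hω₂ _ hγ u₀ hu₀ u hu
  have hd0 : 0 < d := by omega
  have hint := fun n (hn : n ∈ Set.Icc 1 D.N) =>
    hσ.integrableOn_formA hd0 hu.1 hω₁ hω₂ (γ := γ) hn
  have hid := hu.energy_identity hu₀ hint
  rw [max_eq_left hσ.one_le] at H
  have hle : ∀ n ∈ Finset.Icc 1 D.N,
      ∫ τ in D.I n, OverlappingCutFEM.energySq ω₁ ω₂ D.Ω₀ (D.G (D.t n)) D.𝒯₀ (u τ) ≤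
        C * D.slabEnergy ω₁ ω₂ γ u n := by
    intro n hn
    rw [Finset.mem_Icc] at hn
    rw [OverlappingCutFEM.Discretization.slabEnergy, ← MeasureTheory.integral_const_mul]
    -- Only the majorant has to be integrable, so the time integrability of the energy norm is never
    -- needed.
    refine MeasureTheory.integral_mono_of_nonneg
      (MeasureTheory.ae_of_all _ fun τ => OverlappingCutFEM.energySq_nonneg ω₁ ω₂ (u τ))
      ((hint n hn).const_mul C) ?_
    filter_upwards [MeasureTheory.ae_restrict_mem measurableSet_Ioc] with τ hτ
    have hfe := hu.1.isFEFunction hn hτ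
    exact H _ _ _ _ _ (hσ.isCutSetting hd0 hn) _ hfe.1 hfe.2 _ _ _ hω₁ hω₂ hγ
  have hE := Finset.sum_le_sum hle
  rw [← Finset.mul_sum] at hE
  have hE0 : 0 ≤ ∑ n ∈ Finset.Icc 1 D.N,
      ∫ τ in D.I n, OverlappingCutFEM.energySq ω₁ ω₂ D.Ω₀ (D.G (D.t n)) D.𝒯₀ (u τ) :=
    Finset.sum_nonneg fun n _ => MeasureTheory.integral_nonneg fun τ =>
      OverlappingCutFEM.energySq_nonneg ω₁ ω₂ (u τ)
  have hJ : 0 ≤ ∑ n ∈ Finset.Icc 1 D.N, D.normSq (D.jumpFrom u₀ u (n - 1)) :=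
    Finset.sum_nonneg fun n _ => D.normSq_nonneg _
  have hM := D.normSq_nonneg (D.minus u D.N)
  -- The sum of the form integrals is nonnegative by coercivity. The energy identity then bounds it,
  -- and also the end value plus the jumps, by `‖u₀‖²`; this gives the constant `1 + C`.
  have hS := nonneg_of_mul_nonneg_right (hE0.trans hE) hC
  nlinarith
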